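/- Let $0\le l<n$ be integers. Let $\mathfrak{gl}(1|1)$ have the basis $e_{ij}$ ($i,j\in\{1,2\}$, $|1|=\bar 0$, $|2|=\bar 1$, $e_{ij}$ of parity $|i|+|j|$), put $e_{ij}[r]=e_{ij}\otimes t^r\in\mathfrak{gl}(1|1)[t]$, with $$[e_{ij}[r],e_{ks}[q]]=\delta_{jk}e_{is}[r+q]-(-1)^{(|i|+|j|)(|k|+|s|)}\delta_{is}e_{kj}[r+q],$$ and $e_{ij}(x)=\sum_{r\ge 0}e_{ij}[r]x^{-r-1}$. Put $$\mathscr H(x)=\tfrac12\sum_{a,b=1}^2(-1)^{|b|}e_{ab}(x)e_{ba}(x),\qquad \mathcal T(x)=\tfrac12\,\partial_x\big(e_{11}(x)+e_{22}(x)\big)+\tfrac12\big(e_{11}(x)+e_{22}(x)\big)^2-\mathscr H(x).$$ The Bethe algebra $\mathcal B$ is the unital subalgebra of $\mathrm U(\mathfrak{gl}(1|1)[t])$ generated by the coefficients of $e_{11}(x)+e_{22}(x)$ and of $2\mathscr H(x)$. Let $\mathbb C^{1|1}$ have the even basis vector $v_1$ and the odd basis vector $v_2$, and let $\mathcal V=(\mathbb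 C^{1|1})^{\otimes n}\otimes\mathbb C[z_1,\dots,z_n]$, graded by the degree in $\bm z=(z_1,\dots,z_n)$. The algebra $\mathfrak{gl}(1|1)[t]$ acts on $\mathcal V$ by $$e_{ij}[r](p\,w_1\otimes\cdots\otimes w_n)=p\sum_{s=1}^n(-1)^{(|w_1|+\cdots+|w_{s-1}|)(|i|+|j|)}z_s^r\,w_1\otimes\cdots\otimes e_{ij}w_s\otimes\cdots\otimes w_n .$$ The symmetric group $\mathfrak S_n$ acts on $\mathcal V$, the simple transposition $s_i$ sending $\bm f(z_1,\dots,z_n)$ to $P^{(i,i+1)}\bm f(\dots,z_{i+1},z_i,\dots)$, where $P^{(i,i+1)}$ is the graded flip of the factors $i$ and $i+1$. Let $\mathcal V^{\mathfrak S}$ be the space of invariants and $$\mathcal M_l=(\mathcal V^{\mathfrak S})^{\rm sing}_{(n-l,l)}=\{v\in\mathcal V^{\mathfrak S}: e_{12}[0]v=0,\ e_{11}[0]v=(n-l)v,\ e_{22}[0]v=lv\}.$$ The Bethe algebra preserves $\mathcal M_l$; let $\mathcal B_l$ be its image in $\mathrm{End}(\mathcal M_l)$, graded by the degree of endomorphisms,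 and write $X(\bm z)$ for the operator on $\mathcal M_l$ given by $X$. There are central elements $C_1,\dots,C_n$ of $\mathrm U(\mathfrak{gl}(1|1)[t])$ such that $C_j$ acts on $\mathcal V^{\mathfrak S}$ as multiplication by the elementary symmetric polynomial $\sigma_j(\bm z)$. Fix any such elements and define $B_i$ by $$\Big(x^n+\sum_{j=1}^n(-1)^jC_jx^{n-j}\Big)\mathcal T(x)=x^n\sum_{i\ge 2}B_ix^{-i}.$$ Let $\mathcal O_l=\mathbb C[f_1,\dots,f_l,g_1,\dots,g_{n-l-1},\varSigma_n]$ with $\deg f_i=i$, $\deg g_j=j$, $\deg\varSigma_n=n$; put $f(x)=x^l+\sum_{i=1}^l f_ix^{l-i}$ and $g(x)=x^{n-l-1}+\sum_{j=1}^{n-l-1}g_jx^{n-l-1-j}$, and define $\varSigma_1,\dots,\varSigma_{n-1}$ and $G_1,\dots,G_{n-2}$ in $\mathcal O_l$ by $$nf(x)g(x)=nx^{n-1}+\sum_{i=1}^{n-1}(-1)^i(n-i)\varSigma_ix^{n-1-i},\qquad nf'(x)g(x)=nl\,x^{n-2}+\sum_{i=1}^{n-2}G_ix^{n-2-i}.$$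 The algebra $\mathbb C[\bm z]^{\mathfrak S}$ acts on $\mathcal O_l$ through the homomorphism $\sigma_j(\bm z)\mapsto\varSigma_j$, $1\le j\le n$, and on $\mathcal B_l$ by multiplication of operators by symmetric polynomials. Let $\mathfrak u_l=e_{12}[0]e_{21}[0]e_{21}[1]\cdots e_{21}[l]\,v_1^{\otimes n}$, which lies in $\mathcal M_l$. 1. The assignment $G_i\mapsto B_{i+2}(\bm z)$ ($1\le i\le n-2$), $\varSigma_j\mapsto C_j(\bm z)$ ($1\le j\le n$) extends uniquely to an algebra homomorphism $\eta_l:\mathcal O_l\to\mathcal B_l$. It is an isomorphism of graded algebras and of $\mathbb C[\bm z]^{\mathfrak S}$-modules. 2. The map $\rho_l:\mathcal O_l\to\mathcal M_l$, $F\mapsto\eta_l(F)\mathfrak u_l$, is an isomorphism of vector spaces that maps the component of degree $d$ of $\mathcal O_l$ onto the component of degree $d+l(l+1)/2$ of $\mathcal M_l$ for every $d\ge 0$, and $\rho_l(FH)=\eta_l(F)\rho_l(H)$ for all $F,H\in\mathcal O_l$; so it identifies the $\mathcal B_l$-module $\mathcal M_l$ with the regular representation of $\mathcal O_l$. -/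

import Mathlib

open scoped BigOperators

noncomputable section

namespace Gaudin

/-! Indices `1, 2` of `gl(1|1)` are the elements `0, 1` of `Fin 2`; the parity `|i|` is the value
of `i : Fin 2`. -/

/-! ### The universal enveloping superalgebra of `gl(1|1)[t]` -/

/-- The supercommutator relations of `gl(1|1)[t]`, the letter `(i, j, r)` standing for
`e_{ij}[r] = e_{ij} ⊗ t ^ r`. -/
inductive CurrentRel :
    FreeAlgebra ℂ (Fin 2 × Fin 2 × ℕ) → FreeAlgebra ℂ (Fin 2 × Fin 2 × ℕ) → Prop
  | supercomm (i j k l : Fin 2) (r s : ℕ) : CurrentRel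
      (FreeAlgebra.ι ℂ (i, j, r) * FreeAlgebra.ι ℂ (k, l, s)
        - (-1 : ℂ) ^ (((i : ℕ) + j) * ((k : ℕ) + l)) •
          (FreeAlgebra.ι ℂ (k, l, s) * FreeAlgebra.ι ℂ (i, j, r)))
      ((if j = k then FreeAlgebra.ι ℂ (i, l, r + s) else 0)
        - (-1 : ℂ) ^ (((i : ℕ) + j) * ((k : ℕ) + l)) •
          (if i = l then FreeAlgebra.ι ℂ (k, j, r + s) else 0))

/-- `U(gl(1|1)[t])`, by generators `e_{ij}[r]` and relations. -/
abbrev CurrentU : Type := RingQuot CurrentRel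

/-- The generator `e_{ij}[r]`. -/
def e (i j : Fin 2) (r : ℕ) : CurrentU :=
  RingQuot.mkAlgHom ℂ CurrentRel (FreeAlgebra.ι ℂ (i, j, r))

/-! ### Generating series: power series in `X = x⁻¹` with coefficients in `U(gl(1|1)[t])` -/

/-- `e_{ij}(x) = ∑_{r ≥ 0} e_{ij}[r] x^{-r-1}`. -/
def eSer (i j : Fin 2) : PowerSeries CurrentU :=
  PowerSeries.mk fun m => match m with
    | 0 => 0
    | r + 1 => e i j r

/-- The derivation `∂_x`, with `∂_x x^{-m} = -m x^{-m-1}`. -/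
def dx (a : PowerSeries CurrentU) : PowerSeries CurrentU :=
  PowerSeries.mk fun m => match m with
    | 0 => 0
    | k + 1 => -((k : ℂ) • PowerSeries.coeff k a)

/-- `𝓗(x) = (1/2) ∑_{a,b} e_{ab}(x) e_{ba}(x) (-1)^{|b|}`. -/
def hamSer : PowerSeries CurrentU :=
  (1 / 2 : ℂ) • ∑ a : Fin 2, ∑ b : Fin 2, (-1 : ℂ) ^ (b : ℕ) • (eSer a b * eSer b a)

/-- `𝓣(x) = (1/2)(e₁₁(x) + e₂₂(x))' + (1/2)(e₁₁(x) + e₂₂(x))² - 𝓗(x)`. -/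
def transferSer : PowerSeries CurrentU :=
  (1 / 2 : ℂ) • (dx (eSer 0 0) + dx (eSer 1 1))
    + (1 / 2 : ℂ) • (eSer 0 0 + eSer 1 1) ^ 2 - hamSer

/-- The Bethe algebra: the unital subalgebra of `U(gl(1|1)[t])` generated by the coefficients of
`e₁₁(x) + e₂₂(x)` and `2 𝓗(x)`. -/
def bethe : Subalgebra ℂ CurrentU :=
  Algebra.adjoin ℂ
    (Set.range (fun m : ℕ => PowerSeries.coeff m (eSer 0 0 + eSer 1 1)) ∪
      Set.range (fun m : ℕ => PowerSeries.coeff m ((2 : ℂ) • hamSer)))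

/-! ### The module `𝒱 = (ℂ^{1|1})^{⊗ n} ⊗ ℂ[z₁, …, z_n]` -/

/-- `𝒱`, the free `ℂ[z₁, …, z_n]`-module on the basis `v_I = v_{I 1} ⊗ ⋯ ⊗ v_{I n}` of
`(ℂ^{1|1})^{⊗ n}`, an element being given by its coordinates. -/
abbrev VPoly (n : ℕ) : Type := (Fin n → Fin 2) → MvPolynomial (Fin n) ℂ

/-- The operator `e_{ij}` in the `s`-th tensor factor, with the Koszul sign. -/
def siteOp (n : ℕ) (i j : Fin 2) (s : Fin n) : VPoly n →ₗ[MvPolynomial (Fin n) ℂ] VPoly n where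
  toFun F J :=
    if J s = i then
      (-1) ^ ((∑ k ∈ Finset.Iio s, (J k : ℕ)) * ((i : ℕ) + j)) * F (Function.update J s j)
    else 0
  map_add' F G := by
    funext J
    by_cases h : J s = i <;> simp [h, mul_add]
  map_smul' c F := by
    funext J
    by_cases h : J s = i <;> simp [h, mul_left_comm]

/-- The operator by which `e_{ij}[r]` acts on `𝒱`, as a `ℂ[z₁, …, z_n]`-linear map. -/
def polyOp (n : ℕ) (i j : Fin 2) (r : ℕ) : Module.End (MvPolynomial (Fin n) ℂ) (VPoly n) :=
  ∑ s : Fin n, (MvPolynomial.X s : MvPolynomial (Fin n) ℂ) ^ r • siteOp n i j s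

/-- The operator by which `e_{ij}[r]` acts on `𝒱`. -/
def currentOp (n : ℕ) (i j : Fin 2) (r : ℕ) : Module.End ℂ (VPoly n) :=
  (polyOp n i j r).restrictScalars ℂ

/-- `e_{ij}[r] (p v_I) = ∑_s (-1)^{(|I₁| + ⋯ + |I_{s-1}|)(|i| + |j|)} z_s^r p ⋯ ⊗ e_{ij} v_{I_s} ⊗ ⋯`. -/
theorem currentOp_single (n : ℕ) (i j : Fin 2) (r : ℕ) (I : Fin n → Fin 2)
    (p : MvPolynomial (Fin n) ℂ) :
    currentOp n i j r (Pi.single I p) =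
      ∑ s : Fin n, if I s = j then
        Pi.single (Function.update I s i)
          ((-1) ^ ((∑ k ∈ Finset.Iio s, (I k : ℕ)) * ((i : ℕ) + j)) * MvPolynomial.X s ^ r * p)
      else 0 := by
  simp only [currentOp, polyOp, LinearMap.sum_apply, LinearMap.restrictScalars_apply, LinearMap.smul_apply]
  refine Finset.sum_congr rfl fun s _ => ?_
  funext J
  simp only [siteOp, Pi.smul_apply, smul_eq_mul, LinearMap.coe_mk, AddHom.coe_mk]
  by_cases h : J = Function.update I s i ∧ I s = j
  · obtain ⟨rfl, rfl⟩ := h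
    have hs : ∀ k ∈ Finset.Iio s, (Function.update I s i k : ℕ) = I k := by
      intro k hk
      rw [Function.update_of_ne (Finset.mem_Iio.1 hk).ne]
    simp only [Function.update_self, if_true, Function.update_idem, Function.update_eq_self,
      Pi.single_eq_same]
    rw [Finset.sum_congr rfl hs]
    ring
  · have hR : (if I s = j then (Pi.single (Function.update I s i)
          ((-1) ^ ((∑ k ∈ Finset.Iio s, (I k : ℕ)) * ((i : ℕ) + j)) * MvPolynomial.X s ^ r * p) :
            VPoly n) else 0) J = 0 := by
      by_cases hI : I s = j
      · rw [if_pos hI, Pi.single_eq_of_ne]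
        exact fun hJ => h ⟨hJ, hI⟩
      · rw [if_neg hI]; rfl
    rw [hR]
    by_cases hJ : J s = i
    · rw [if_pos hJ, Pi.single_eq_of_ne, mul_zero, mul_zero]
      rintro rfl
      refine h ⟨?_, by simp⟩
      rw [Function.update_idem, ← hJ, Function.update_eq_self]
    · rw [if_neg hJ, mul_zero]

theorem siteOp_mul_self (n : ℕ) (i j k l : Fin 2) (s : Fin n) :
    siteOp n i j s * siteOp n k l s = if j = k then siteOp n i l s else 0 := by
  refine LinearMap.ext fun F => funext fun J => ?_
  have hs : ∀ m ∈ Finset.Iio s, (Function.update J s j m : ℕ) = J m := by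
    intro m hm
    rw [Function.update_of_ne (Finset.mem_Iio.1 hm).ne]
  by_cases hjk : j = k
  · subst hjk
    by_cases hJ : J s = i
    · simp only [siteOp, Module.End.mul_apply, LinearMap.coe_mk, AddHom.coe_mk, hJ, if_true,
        Function.update_self, Function.update_idem]
      rw [Finset.sum_congr rfl hs, ← mul_assoc, ← pow_add, ← mul_add]
      congr 1
      have : (i : ℕ) + j + (j + l) = (i + l) + 2 * j := by ring
      rw [this, mul_add, pow_add, mul_left_comm, pow_mul (-1) 2]
      simp
    · simp [siteOp, hJ]
  · simp [siteOp, hjk]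

theorem siteOp_mul_of_lt (n : ℕ) (i j k l : Fin 2) {s t : Fin n} (h : s < t) :
    siteOp n i j s * siteOp n k l t =
      (-1 : MvPolynomial (Fin n) ℂ) ^ (((i : ℕ) + j) * ((k : ℕ) + l)) •
        (siteOp n k l t * siteOp n i j s) := by
  refine LinearMap.ext fun F => funext fun J => ?_
  simp only [siteOp, Module.End.mul_apply, LinearMap.coe_mk, AddHom.coe_mk,
    LinearMap.smul_apply, Pi.smul_apply, smul_eq_mul, Function.update_of_ne h.ne,
    Function.update_of_ne h.ne']
  by_cases hs : J s = i
  · by_cases ht : J t = k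
    · have hsum1 : ∑ m ∈ Finset.Iio s, (Function.update J t l m : ℕ)
          = ∑ m ∈ Finset.Iio s, (J m : ℕ) := by
        refine Finset.sum_congr rfl fun m hm => ?_
        rw [Function.update_of_ne ((Finset.mem_Iio.1 hm).trans h).ne]
      have hmem : s ∈ Finset.Iio t := Finset.mem_Iio.2 h
      have hsum2 : (∑ m ∈ Finset.Iio t, (Function.update J s j m : ℕ)) + i
          = (∑ m ∈ Finset.Iio t, (J m : ℕ)) + j := by
        rw [← Finset.add_sum_erase _ _ hmem, ← Finset.add_sum_erase _ (fun m => (J m : ℕ)) hmem]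
        rw [Finset.sum_congr rfl (g := fun m => (J m : ℕ))]
        · simp only [Function.update_self, hs]; ring
        · intro m hm
          rw [Function.update_of_ne (Finset.ne_of_mem_erase hm)]
      simp only [hs, ht, if_true, hsum1, Function.update_comm h.ne]
      have key : (-1 : MvPolynomial (Fin n) ℂ) ^
            ((∑ m ∈ Finset.Iio t, (Function.update J s j m : ℕ)) * ((k : ℕ) + l)) =
          (-1) ^ (((i : ℕ) + j) * ((k : ℕ) + l)) *
            (-1) ^ ((∑ m ∈ Finset.Iio t, (J m : ℕ)) * ((k : ℕ) + l)) := by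
        have h1 : (-1 : MvPolynomial (Fin n) ℂ) ^
            (∑ m ∈ Finset.Iio t, (Function.update J s j m : ℕ)) =
            (-1) ^ ((i : ℕ) + j) * (-1) ^ (∑ m ∈ Finset.Iio t, (J m : ℕ)) := by
          have h2 : (-1 : MvPolynomial (Fin n) ℂ) ^ (i : ℕ) * (-1) ^ (i : ℕ) = 1 := by
            rw [← pow_add, ← two_mul, pow_mul]; simp
          have h3 := congrArg (fun m => (-1 : MvPolynomial (Fin n) ℂ) ^ m) hsum2
          simp only [pow_add] at h3
          calc _ = (-1 : MvPolynomial (Fin n) ℂ) ^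
                (∑ m ∈ Finset.Iio t, (Function.update J s j m : ℕ)) *
                ((-1) ^ (i : ℕ) * (-1) ^ (i : ℕ)) := by rw [h2, mul_one]
            _ = _ := by rw [← mul_assoc, h3, pow_add]; ring
        rw [pow_mul, h1, mul_pow, ← pow_mul, ← pow_mul]
      rw [key]
      ring
    · simp [ht]
  · simp [hs]

theorem siteOp_mul_of_ne (n : ℕ) (i j k l : Fin 2) {s t : Fin n} (h : s ≠ t) :
    siteOp n i j s * siteOp n k l t =
      (-1 : MvPolynomial (Fin n) ℂ) ^ (((i : ℕ) + j) * ((k : ℕ) + l)) •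
        (siteOp n k l t * siteOp n i j s) := by
  rcases lt_or_gt_of_ne h with h | h
  · exact siteOp_mul_of_lt n i j k l h
  · rw [siteOp_mul_of_lt n k l i j h, smul_smul, mul_comm ((k : ℕ) + l), ← mul_pow]
    simp

theorem polyOp_mul (n : ℕ) (i j k l : Fin 2) (r u : ℕ) :
    polyOp n i j r * polyOp n k l u =
      ∑ s : Fin n, ∑ t : Fin n, ((MvPolynomial.X s : MvPolynomial (Fin n) ℂ) ^ r *
        MvPolynomial.X t ^ u) • (siteOp n i j s * siteOp n k l t) := by
  simp only [polyOp, Finset.sum_mul_sum, smul_mul_smul_comm]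

theorem polyOp_supercomm (n : ℕ) (i j k l : Fin 2) (r u : ℕ) :
    polyOp n i j r * polyOp n k l u
        - (-1 : MvPolynomial (Fin n) ℂ) ^ (((i : ℕ) + j) * ((k : ℕ) + l)) •
          (polyOp n k l u * polyOp n i j r) =
      (if j = k then polyOp n i l (r + u) else 0)
        - (-1 : MvPolynomial (Fin n) ℂ) ^ (((i : ℕ) + j) * ((k : ℕ) + l)) •
          (if i = l then polyOp n k j (r + u) else 0) := by
  have hd : ∀ (a b c d : Fin 2), (if b = c then polyOp n a d (r + u) else 0) =
      ∑ s : Fin n, (MvPolynomial.X s : MvPolynomial (Fin n) ℂ) ^ (r + u) •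
        (siteOp n a b s * siteOp n c d s) := by
    intro a b c d
    simp only [siteOp_mul_self]
    split_ifs
    · rfl
    · simp
  rw [hd i j k l]
  have hd' : (if i = l then polyOp n k j (r + u) else 0) =
      ∑ s : Fin n, (MvPolynomial.X s : MvPolynomial (Fin n) ℂ) ^ (r + u) •
        (siteOp n k l s * siteOp n i j s) := by
    rw [← hd k l i j]
    simp only [eq_comm]
  rw [hd', polyOp_mul, polyOp_mul,
    Finset.sum_comm (f := fun s t => ((MvPolynomial.X s : MvPolynomial (Fin n) ℂ) ^ u *
        MvPolynomial.X t ^ r) • (siteOp n k l s * siteOp n i j t)),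
    Finset.smul_sum, Finset.smul_sum, ← Finset.sum_sub_distrib, ← Finset.sum_sub_distrib]
  refine Finset.sum_congr rfl fun s _ => ?_
  rw [Finset.smul_sum, ← Finset.sum_sub_distrib, Finset.sum_eq_single s]
  · rw [pow_add, mul_comm (MvPolynomial.X s ^ u)]
  · intro t _ hts
    rw [siteOp_mul_of_ne n i j k l hts.symm, smul_comm, mul_comm (MvPolynomial.X t ^ u), sub_self]
  · simp

/-- The supercommutator relations hold for the operators on `𝒱`. -/
theorem currentOp_supercomm (n : ℕ) (i j k l : Fin 2) (r s : ℕ) :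
    currentOp n i j r * currentOp n k l s
        - (-1 : ℂ) ^ (((i : ℕ) + j) * ((k : ℕ) + l)) • (currentOp n k l s * currentOp n i j r) =
      (if j = k then currentOp n i l (r + s) else 0)
        - (-1 : ℂ) ^ (((i : ℕ) + j) * ((k : ℕ) + l)) •
          (if i = l then currentOp n k j (r + s) else 0) := by
  refine LinearMap.ext fun F => ?_
  have h := congrArg (fun A => A F) (polyOp_supercomm n i j k l r s)
  have hr : ∀ (P : Prop) [Decidable P] (a b : Fin 2),
      (if P then currentOp n a b (r + s) else 0) F = (if P then polyOp n a b (r + s) else 0) F := by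
    intro P _ a b
    split_ifs <;> rfl
  simp only [LinearMap.sub_apply, LinearMap.smul_apply, Module.End.mul_apply, hr] at h ⊢
  rcases Nat.even_or_odd (((i : ℕ) + j) * ((k : ℕ) + l)) with hp | hp <;>
  · simp only [hp.neg_one_pow, one_smul, neg_smul] at h ⊢
    exact h

/-- The action of `U(gl(1|1)[t])` on `𝒱`. -/
def act (n : ℕ) : CurrentU →ₐ[ℂ] Module.End ℂ (VPoly n) :=
  RingQuot.liftAlgHom ℂ ⟨FreeAlgebra.lift ℂ fun x => currentOp n x.1 x.2.1 x.2.2, by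
    rintro _ _ ⟨i, j, k, l, r, s⟩
    have h := currentOp_supercomm n i j k l r s
    simp only [map_sub, map_mul, map_smul, FreeAlgebra.lift_ι_apply, apply_ite
      (FreeAlgebra.lift ℂ fun x : Fin 2 × Fin 2 × ℕ => currentOp n x.1 x.2.1 x.2.2), map_zero]
    exact h⟩

theorem act_e (n : ℕ) (i j : Fin 2) (r : ℕ) : act n (e i j r) = currentOp n i j r := by
  simp [act, e]

/-- `v⁺ = v₁ ⊗ ⋯ ⊗ v₁`. -/
def vplus (n : ℕ) : VPoly n := Pi.single (fun _ => 0) 1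

/-- The simple transposition exchanging the positions `a` and `b = a + 1`, acting on `𝒱` by
`f(z) ↦ P^{(a,b)} f(…, z_b, z_a, …)` with the graded flip `P^{(a,b)}`, which sends `v_I` to
`(-1)^{|I a||I b|} v_{I ∘ (a b)}`. -/
def flipOp (n : ℕ) (a b : Fin n) (F : VPoly n) : VPoly n := fun J =>
  (-1) ^ ((J a : ℕ) * J b) *
    MvPolynomial.rename (Equiv.swap a b) (F (J ∘ Equiv.swap a b))

/-- `𝒱^𝔖`, the vectors fixed by the symmetric group, that is, by its simple transpositions. -/
def VSym (n : ℕ) : Submodule ℂ (VPoly n) where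
  carrier := {F | ∀ a b : Fin n, (b : ℕ) = a + 1 → flipOp n a b F = F}
  add_mem' {F G} hF hG a b h := by
    conv_rhs => rw [← hF a b h, ← hG a b h]
    funext J
    simp [flipOp, mul_add]
  zero_mem' a b _ := by
    funext J
    simp [flipOp]
  smul_mem' c F hF a b h := by
    conv_rhs => rw [← hF a b h]
    funext J
    simp [flipOp]

/-- `𝓜_l = (𝒱^𝔖)^{sing}_{(n-l,l)}`: the vectors of `𝒱^𝔖` killed by `e₁₂` and of weight
`(n - l, l)`. -/
def M (n l : ℕ) : Submodule ℂ (VPoly n) where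
  carrier := {F | F ∈ VSym n ∧ act n (e 0 1 0) F = 0 ∧
    act n (e 0 0 0) F = ((n : ℂ) - l) • F ∧ act n (e 1 1 0) F = (l : ℂ) • F}
  add_mem' {F G} hF hG := by
    refine ⟨add_mem hF.1 hG.1, ?_, ?_, ?_⟩
    · rw [map_add, hF.2.1, hG.2.1, add_zero]
    · rw [map_add, hF.2.2.1, hG.2.2.1, smul_add]
    · rw [map_add, hF.2.2.2, hG.2.2.2, smul_add]
  zero_mem' := ⟨zero_mem _, by simp, by simp, by simp⟩
  smul_mem' c F hF := by
    refine ⟨Submodule.smul_mem _ c hF.1, ?_, ?_, ?_⟩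
    · rw [map_smul, hF.2.1, smul_zero]
    · rw [map_smul, hF.2.2.1, smul_comm]
    · rw [map_smul, hF.2.2.2, smul_comm]

/-- `u_l = e₁₂[0] e₂₁[0] e₂₁[1] ⋯ e₂₁[l] v⁺`. -/
def uvec (n l : ℕ) : VPoly n :=
  act n (e 0 1 0 * ((List.range (l + 1)).map fun r => e 1 0 r).prod) (vplus n)

/-- The homogeneous component of degree `d` of `𝒱`, where `deg (v ⊗ p) = deg p`. -/
def VHom (n d : ℕ) : Submodule ℂ (VPoly n) where
  carrier := {F | ∀ J, (F J).IsHomogeneous d}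
  add_mem' hF hG J := (hF J).add (hG J)
  zero_mem' _ := MvPolynomial.isHomogeneous_zero _ _ _
  smul_mem' c F hF J := by
    have h := (MvPolynomial.homogeneousSubmodule (Fin n) ℂ d).smul_mem c (x := F J) (hF J)
    exact h

/-- An endomorphism of `𝓜_l` is of degree `d` if it raises degrees by `d`. -/
def EndHasDegree (n l d : ℕ) (φ : Module.End ℂ (M n l)) : Prop :=
  ∀ (m : ℕ) (v : M n l), (v : VPoly n) ∈ VHom n m → (φ v : VPoly n) ∈ VHom n (m + d)

/-- `𝓑_l`, the image of the Bethe algebra in `End(𝓜_l)`: the endomorphisms of `𝓜_l` that are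
given by the action of an element of the Bethe algebra. -/
def betheM (n l : ℕ) : Subalgebra ℂ (Module.End ℂ (M n l)) where
  carrier := {φ | ∃ b ∈ bethe, ∀ v : M n l, (φ v : VPoly n) = act n b v}
  mul_mem' := by
    rintro φ ψ ⟨b, hb, hφ⟩ ⟨c, hc, hψ⟩
    refine ⟨b * c, mul_mem hb hc, fun v => ?_⟩
    rw [Module.End.mul_apply, hφ, hψ, map_mul, Module.End.mul_apply]
  add_mem' := by
    rintro φ ψ ⟨b, hb, hφ⟩ ⟨c, hc, hψ⟩
    refine ⟨b + c, add_mem hb hc, fun v => ?_⟩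
    rw [LinearMap.add_apply, Submodule.coe_add, hφ, hψ, map_add, LinearMap.add_apply]
  algebraMap_mem' c := by
    refine ⟨algebraMap ℂ CurrentU c, Subalgebra.algebraMap_mem _ c, fun v => ?_⟩
    rw [AlgHom.commutes, Module.algebraMap_end_apply, Module.algebraMap_end_apply,
      Submodule.coe_smul]

/-! ### The elements `C_j` and `B_i` -/

/-- `C₁, …, C_n` are central elements of `U(gl(1|1)[t])` such that `C_j` acts on `𝒱^𝔖` by
multiplication by the elementary symmetric polynomial `σ_j(z₁, …, z_n)`. -/
def IsCentralLift (n : ℕ) (C : ℕ → CurrentU) : Prop :=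
  ∀ j, 1 ≤ j → j ≤ n → C j ∈ Subalgebra.center ℂ CurrentU ∧
    ∀ v ∈ VSym n, act n (C j) v = MvPolynomial.esymm (Fin n) ℂ j • v

/-- The series `x^{-n} (x^n + ∑_{j=1}^n (-1)^j C_j x^{n-j})`. -/
def centralSer (n : ℕ) (C : ℕ → CurrentU) : PowerSeries CurrentU :=
  1 + ∑ j ∈ Finset.Icc 1 n, PowerSeries.monomial j ((-1 : ℂ) ^ j • C j)

/-- The elements `B_i` with
`(x^n + ∑_{j=1}^n (-1)^j C_j x^{n-j}) 𝓣(x) = x^n ∑_i B_i x^{-i}`. -/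
def B (n : ℕ) (C : ℕ → CurrentU) (i : ℕ) : CurrentU :=
  PowerSeries.coeff i (centralSer n C * transferSer)

/-! ### The algebra `𝓞_l = ℂ[f₁, …, f_l, g₁, …, g_{n-l-1}, Σ_n]` -/

/-- The coordinates `f₁, …, f_l`, then `g₁, …, g_{n-l-1}`, then `Σ_n`. -/
abbrev OIdx (n l : ℕ) : Type := Fin l ⊕ Fin (n - l - 1) ⊕ Unit

/-- `𝓞_l`. -/
abbrev O (n l : ℕ) : Type := MvPolynomial (OIdx n l) ℂ

/-- `deg f_i = i`, `deg g_j = j`, `deg Σ_n = n`. -/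
def OWeight (n l : ℕ) : OIdx n l → ℕ
  | Sum.inl i => i + 1
  | Sum.inr (Sum.inl j) => j + 1
  | Sum.inr (Sum.inr _) => n

/-- `f(x) = x^l + ∑_{i=1}^l f_i x^{l-i}`. -/
def fPoly (n l : ℕ) : Polynomial (O n l) :=
  Polynomial.X ^ l + ∑ i : Fin l,
    Polynomial.C (MvPolynomial.X (Sum.inl i)) * Polynomial.X ^ (l - ((i : ℕ) + 1))

/-- `g(x) = x^{n-l-1} + ∑_{j=1}^{n-l-1} g_j x^{n-l-1-j}`. -/
def gPoly (n l : ℕ) : Polynomial (O n l) :=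
  Polynomial.X ^ (n - l - 1) + ∑ j : Fin (n - l - 1),
    Polynomial.C (MvPolynomial.X (Sum.inr (Sum.inl j))) *
      Polynomial.X ^ (n - l - 1 - ((j : ℕ) + 1))

/-- `Σ_j` for `1 ≤ j ≤ n`: `Σ_n` is the coordinate, and for `j < n` the coefficient of
`x^{n-1-j}` in `n f(x) g(x)` is `(-1)^j (n - j) Σ_j`. -/
def SigmaO (n l j : ℕ) : O n l :=
  if j = n then MvPolynomial.X (Sum.inr (Sum.inr ()))
  else ((-1 : ℂ) ^ j / ((n : ℂ) - j)) •
    ((Polynomial.C (n : O n l) * fPoly n l * gPoly n l).coeff (n - 1 - j))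

/-- `G_i` for `1 ≤ i ≤ n - 2`: the coefficient of `x^{n-2-i}` in `n f'(x) g(x)`. -/
def GO (n l i : ℕ) : O n l :=
  (Polynomial.C (n : O n l) * Polynomial.derivative (fPoly n l) * gPoly n l).coeff (n - 2 - i)

/-- The homomorphism `π_l : ℂ[z₁, …, z_n]^𝔖 → 𝓞_l` with `σ_j(z) ↦ Σ_j`, through which `𝓞_l` is a
`ℂ[z₁, …, z_n]^𝔖`-module. -/
def symToO (n l : ℕ) : MvPolynomial.symmetricSubalgebra (Fin n) ℂ →ₐ[ℂ] O n l :=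
  (MvPolynomial.aeval fun j : Fin n => SigmaO n l (j + 1)).comp
    (MvPolynomial.esymmAlgEquiv (Fin n) ℂ (Fintype.card_fin n)).symm.toAlgHom

/-- An algebra homomorphism `η : 𝓞_l → 𝓑_l` sends `G_i` to `B_{i+2}(z)` for `1 ≤ i ≤ n - 2` and
`Σ_j` to `C_j(z)` for `1 ≤ j ≤ n`, where `X(z)` is the operator by which `X` acts on `𝓜_l`. -/
def SendsGenerators (n l : ℕ) (C : ℕ → CurrentU) (η : O n l →ₐ[ℂ] betheM n l) : Prop :=
  (∀ i, 1 ≤ i → i + 2 ≤ n → ∀ v : M n l,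
    (((η (GO n l i) : Module.End ℂ (M n l)) v : M n l) : VPoly n) = act n (B n C (i + 2)) v) ∧
  (∀ j, 1 ≤ j → j ≤ n → ∀ v : M n l,
    (((η (SigmaO n l j) : Module.End ℂ (M n l)) v : M n l) : VPoly n) = act n (C j) v)

end Gaudin

end

/-!
Let `Q` be the polynomial of degree `n` with `Q' = n f g` and constant term `(-1)^n Σ_n`, and
specialize `z₁, …, z_n` to its roots, in a field that contains the roots of `f` and `g` as
independent variables. For a root `c` of `f g` the weight `w_c(s) = (c - z_s)⁻¹` has vanishing sum,
which is the Bethe equation, and the commutators of `∑ₛ w_c(s) e₁₂⁽ˢ⁾` with the transfer operators,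
the coefficients of `𝒯(x)`, are scalar multiples of it. Applying these operators for the `l` roots
of `f` and reading off the coefficient of the vacuum is therefore a joint eigenfunctional of the
Bethe algebra on `𝓜_l`. Permuting the roots of `f g` turns `f` into any other divisor of degree `l`,
so on the invariant vectors of `𝓜_l` the functional is injective. It takes every invariant vector to
an element of `𝓞_l` times the Vandermonde determinant of the roots of `f`, and `u_l` to a nonzero
constant times that determinant. Hence `𝓜_l` is free of rank one on `u_l` over `𝓞_l`, and `𝓑_l` acts
through eigenvalues in `𝓞_l`. The eigenvalues of `B_{i+2}` and `C_j` are `G_i` and `Σ_j`, which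
generate `𝓞_l`.
-/

noncomputable section

namespace Gaudin

open Finset
open scoped Matrix

/-! ### Symmetric and alternating polynomials -/

section Symmetric

open MvPolynomial

variable {σ τ ι R : Type*} [CommRing R]

theorem aeval_mem {A : Type*} [CommRing A] [Algebra R A] (S : Subalgebra R A) {f : σ → A}
    (h : ∀ i, f i ∈ S) (p : MvPolynomial σ R) : aeval f p ∈ S := by
  refine Algebra.adjoin_le (Set.range_subset_iff.2 h) ?_
  rw [Algebra.adjoin_range_eq_range_aeval]
  exact ⟨p, rfl⟩

theorem sumAlgEquiv_rename_sumMap (π : Equiv.Perm σ) (q : MvPolynomial (σ ⊕ τ) R) :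
    sumAlgEquiv R σ τ (rename (Sum.map π id) q) = rename π (sumAlgEquiv R σ τ q) := by
  have : (sumAlgEquiv R σ τ).toAlgHom.comp (rename (Sum.map π id)) =
      ((rename π : MvPolynomial σ (MvPolynomial τ R) →ₐ[MvPolynomial τ R] _).restrictScalars
        R).comp (sumAlgEquiv R σ τ).toAlgHom :=
    algHom_ext fun i => by rcases i with i | i <;> simp
  exact DFunLike.congr_fun this q

variable [Algebra ℚ R] [Fintype σ] [Fintype τ] [Fintype ι]

theorem esymm_mem_of_psum_mem (S : Subalgebra R (MvPolynomial σ R)) (h : ∀ k, psum σ R k ∈ S)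
    (k : ℕ) : esymm σ R k ∈ S := by
  classical
  induction k using Nat.strong_induction_on with
  | _ k ih =>
    rcases Nat.eq_zero_or_pos k with rfl | hk
    · rw [esymm_zero]
      exact one_mem _
    · have hmem : (k : ℚ) • esymm σ R k ∈ S := by
        rw [Nat.cast_smul_eq_nsmul, nsmul_eq_mul, mul_esymm_eq_sum σ R k]
        refine mul_mem (pow_mem (neg_mem (one_mem _)) _) (sum_mem fun a ha => ?_)
        exact mul_mem (mul_mem (pow_mem (neg_mem (one_mem _)) _) (ih _ (mem_filter.1 ha).2)) (h _)
      rw [← inv_smul_smul₀ (Nat.cast_ne_zero.2 hk.ne' : (k : ℚ) ≠ 0) (esymm σ R k),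
        ← algebraMap_smul R]
      exact S.smul_mem hmem _

theorem mem_of_isSymmetric_of_psum_mem (S : Subalgebra R (MvPolynomial σ R))
    (h : ∀ k, psum σ R k ∈ S) {p : MvPolynomial σ R} (hp : p.IsSymmetric) : p ∈ S := by
  obtain ⟨q, hq⟩ := esymmAlgHom_surjective R le_rfl ⟨p, hp⟩
  have hq' : aeval (fun i : Fin (Fintype.card σ) => esymm σ R (i + 1)) q = p := by
    rw [← esymmAlgHom_apply, hq]
  rw [← hq']
  exact aeval_mem S (fun i => esymm_mem_of_psum_mem S h _) q

theorem mem_of_rename_sumMap_eq (S : Subalgebra R (MvPolynomial (σ ⊕ τ) R))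
    (hX : ∀ i, X (Sum.inr i) ∈ S) (hp : ∀ k, psum (σ ⊕ τ) R k ∈ S)
    {q : MvPolynomial (σ ⊕ τ) R} (hq : ∀ π : Equiv.Perm σ, rename (Sum.map π id) q = q) :
    q ∈ S := by
  let E := sumAlgEquiv R σ τ
  have hC (r : MvPolynomial τ R) : E.symm (C r) ∈ S := by
    have hr : E.symm (C r) = rename Sum.inr r :=
      E.symm_apply_eq.2 (DFunLike.congr_fun (sumAlgEquiv_comp_rename_inr R σ τ) r).symm
    rw [hr, rename_eq_aeval]
    exact aeval_mem S hX r
  let S' : Subalgebra (MvPolynomial τ R) (MvPolynomial σ (MvPolynomial τ R)) :=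
    { S.comap E.symm.toAlgHom with algebraMap_mem' := hC }
  have hpsum (k : ℕ) : psum σ (MvPolynomial τ R) k ∈ S' := by
    have : E.symm (psum σ (MvPolynomial τ R) k) =
        psum (σ ⊕ τ) R k - ∑ i, X (Sum.inr i) ^ k := by
      rw [AlgEquiv.symm_apply_eq]
      simp [E, psum]
    change E.symm _ ∈ S
    rw [this]
    exact sub_mem (hp k) (sum_mem fun i _ => pow_mem (hX i) k)
  have hsymm : (E q).IsSymmetric := fun π => by
    rw [← sumAlgEquiv_rename_sumMap, hq]
  have : E.symm (E q) ∈ S := mem_of_isSymmetric_of_psum_mem S' hpsum hsymm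
  rwa [E.symm_apply_apply] at this

theorem mem_of_rename_eq_of_fixing (s : Set ι) (S : Subalgebra R (MvPolynomial ι R))
    (hX : ∀ i ∈ s, X i ∈ S) (hp : ∀ k, psum ι R k ∈ S) {q : MvPolynomial ι R}
    (hq : ∀ π : Equiv.Perm ι, (∀ i ∈ s, π i = i) → rename π q = q) : q ∈ S := by
  classical
  let ε : ↥sᶜ ⊕ ↥s ≃ ι := (Equiv.sumComm _ _).trans (Equiv.Set.sumCompl s)
  have hε (i : s) : ε (Sum.inr i) = i := rfl
  have := mem_of_rename_sumMap_eq (S.comap (rename ε)) (fun i => ?_) (fun k => ?_)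
    (q := rename ε.symm q) fun π => ?_
  · simpa [rename_rename] using this
  · simpa [hε] using hX i i.2
  · simpa [rename_psum] using hp k
  · let π' : Equiv.Perm ι := (ε.symm.trans (Equiv.sumCongr π 1)).trans ε
    have h := hq π' fun i hi => by
      have : ε.symm i = Sum.inr ⟨i, hi⟩ := ε.symm_apply_eq.2 rfl
      simp [π', this, hε]
    conv_rhs => rw [← h]
    rw [rename_rename, rename_rename]
    congr 2
    funext i
    simp [π']

end Symmetric

section Alternating

open MvPolynomial

variable {ι R : Type*} [DecidableEq ι] [CommRing R]

/-- A polynomial that changes by the sign of a permutation when the variables are permuted. -/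
def IsAlternating [Fintype ι] (P : MvPolynomial ι R) : Prop :=
  ∀ σ : Equiv.Perm ι, rename σ P = Equiv.Perm.sign σ • P

/-- The signed sum over all permutations of the variables. -/
def alternization [Fintype ι] (P : MvPolynomial ι R) : MvPolynomial ι R :=
  ∑ σ : Equiv.Perm ι, Equiv.Perm.sign σ • rename σ P

theorem isAlternating_alternization [Fintype ι] (P : MvPolynomial ι R) :
    IsAlternating (alternization P) := by
  intro σ
  rw [alternization, map_sum, smul_sum]
  refine Fintype.sum_equiv (Equiv.mulLeft σ) _ _ fun τ => ?_
  rw [Equiv.coe_mulLeft, Equiv.Perm.sign_mul, smul_smul, ← mul_assoc, Int.units_mul_self,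
    one_mul, Units.smul_def, map_zsmul, rename_rename]
  rfl

theorem IsAlternating.C_mul [Fintype ι] {P : MvPolynomial ι R} (hP : IsAlternating P) (c : R) :
    IsAlternating (C c * P) := fun σ => by
  rw [map_mul, rename_C, hP σ, mul_smul_comm]

theorem rename_det_vandermonde_X {l : ℕ} (σ : Fin l → Fin l) :
    rename σ (Matrix.vandermonde (X : Fin l → MvPolynomial (Fin l) R)).det =
      (Matrix.vandermonde fun i => (X (σ i) : MvPolynomial (Fin l) R)).det := by
  rw [AlgHom.map_det]
  congr 1
  ext i j
  simp [Matrix.vandermonde]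

theorem isAlternating_det_vandermonde_X (l : ℕ) :
    IsAlternating (Matrix.vandermonde (X : Fin l → MvPolynomial (Fin l) R)).det := fun σ => by
  rw [rename_det_vandermonde_X, Units.smul_def, zsmul_eq_mul, ← Matrix.det_permute]
  rfl

theorem X_sub_X_dvd_iff {i j : ι} {P : MvPolynomial ι R} :
    X i - X j ∣ P ↔ rename (Function.update id i j) P = 0 := by
  constructor
  · rintro ⟨Q, rfl⟩
    rw [map_mul, map_sub, rename_X, rename_X, Function.update_self]
    obtain rfl | hj := eq_or_ne j i <;> simp [*]
  · intro h
    let I := Ideal.span {(X i - X j : MvPolynomial ι R)}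
    have hI : (Ideal.Quotient.mkₐ R I).comp (rename (Function.update id i j)) =
        Ideal.Quotient.mkₐ R I := by
      refine algHom_ext fun k => ?_
      obtain rfl | hk := eq_or_ne k i
      · simp only [AlgHom.comp_apply, rename_X, Function.update_self]
        exact (Ideal.Quotient.eq.2 (Ideal.mem_span_singleton_self _)).symm
      · simp [hk]
    have hP := DFunLike.congr_fun hI P
    rw [AlgHom.comp_apply, h, map_zero] at hP
    exact Ideal.mem_span_singleton.1 (Ideal.Quotient.eq_zero_iff_mem.1 hP.symm)

theorem IsAlternating.X_sub_X_dvd [Fintype ι] [IsDomain R] [CharZero R] {P : MvPolynomial ι R}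
    (hP : IsAlternating P) {i j : ι} (hij : i ≠ j) : X i - X j ∣ P := by
  rw [X_sub_X_dvd_iff]
  have hswap : Function.update id i j ∘ Equiv.swap i j = Function.update id i j := by
    funext k
    grind [Function.update_apply]
  have h := congrArg (rename (Function.update id i j)) (hP (Equiv.swap i j))
  rw [rename_rename, hswap, Equiv.Perm.sign_swap hij, Units.smul_def] at h
  simpa [eq_neg_iff_add_eq_zero, ← two_mul] using h

variable [IsDomain R]

omit [DecidableEq ι] in
theorem prime_X_sub_X {i j : ι} (hij : i ≠ j) : Prime (X i - X j : MvPolynomial ι R) := by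
  classical
  have h0 : (X i - X j : MvPolynomial ι R) ≠ 0 := sub_ne_zero.2 fun h => hij (X_injective h)
  rw [← Ideal.span_singleton_prime h0]
  have : Ideal.span {(X i - X j : MvPolynomial ι R)} =
      RingHom.ker (rename (R := R) (Function.update id i j)) := by
    ext P
    rw [Ideal.mem_span_singleton, X_sub_X_dvd_iff, RingHom.mem_ker]
  rw [this]
  exact RingHom.ker_isPrime _

theorem isRelPrime_X_sub_X {l : ℕ} {i j i' j' : Fin l} (h : i < j) (h' : i' < j')
    (hne : (i, j) ≠ (i', j')) :
    IsRelPrime (X j - X i : MvPolynomial (Fin l) R) (X j' - X i') := by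
  rw [(prime_X_sub_X h.ne').irreducible.isRelPrime_iff_not_dvd, X_sub_X_dvd_iff, map_sub,
    rename_X, rename_X, sub_eq_zero, X_injective.eq_iff]
  grind [Function.update_apply]

variable [UniqueFactorizationMonoid R] [CharZero R] {l : ℕ}

theorem IsAlternating.det_vandermonde_dvd {P : MvPolynomial (Fin l) R} (hP : IsAlternating P) :
    (Matrix.vandermonde X).det ∣ P := by
  rw [Matrix.det_vandermonde, Finset.prod_sigma']
  refine Finset.prod_dvd_of_isRelPrime ?_ fun p hp => hP.X_sub_X_dvd (by simp_all [ne_of_gt])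
  rintro ⟨i, j⟩ hp ⟨i', j'⟩ hp' hne
  exact isRelPrime_X_sub_X (by simpa using hp) (by simpa using hp') (by grind)

theorem IsAlternating.exists_eq_det_vandermonde_mul {P : MvPolynomial (Fin l) R}
    (hP : IsAlternating P) :
    ∃ S : MvPolynomial (Fin l) R, S.IsSymmetric ∧ P = (Matrix.vandermonde X).det * S := by
  obtain ⟨S, rfl⟩ := hP.det_vandermonde_dvd
  refine ⟨S, fun σ => ?_, rfl⟩
  have hv : (Matrix.vandermonde (X : Fin l → MvPolynomial (Fin l) R)).det ≠ 0 :=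
    Matrix.det_vandermonde_ne_zero_iff.2 X_injective
  have h := hP σ
  rw [map_mul, isAlternating_det_vandermonde_X l σ, smul_mul_assoc, smul_left_cancel_iff] at h
  exact mul_left_cancel₀ hv h

end Alternating

/-! ### Polynomials and their roots -/

section Reversed

open Polynomial

variable {R S : Type*} [CommRing R] [CommRing S] {m : ℕ}

/-- The monic polynomial `x ^ m + a₀ x ^ (m - 1) + ⋯ + a_{m - 1}`. -/
def monicPoly (a : Fin m → R) : R[X] :=
  X ^ m + ∑ i : Fin m, C (a i) * X ^ (m - ((i : ℕ) + 1))

/-- The reversal `1 + a₀ x + ⋯ + a_{m - 1} x ^ m` of `monicPoly a`, in which the variable is the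
inverse of the original one. -/
def unitPoly (a : Fin m → R) : R[X] :=
  1 + ∑ i : Fin m, C (a i) * X ^ ((i : ℕ) + 1)

/-- The operator `m - x d/dx`; under the reversal of polynomials of degree at most `m` it
corresponds to `d/dx`. -/
def eulerOp (m : ℕ) (P : R[X]) : R[X] :=
  C (m : R) * P - X * derivative P

theorem coeff_eulerOp (P : R[X]) (k : ℕ) :
    (eulerOp m P).coeff k = ((m : R) - k) * P.coeff k := by
  rw [eulerOp, coeff_sub, coeff_C_mul]
  cases k with
  | zero => simp
  | succ k =>
    rw [coeff_X_mul, coeff_derivative]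
    push_cast
    ring

theorem reflect_derivative {P : R[X]} (hP : P.natDegree ≤ m) :
    reflect (m - 1) (derivative P) = eulerOp m (reflect m P) := by
  rcases Nat.eq_zero_or_pos m with rfl | hm
  · rw [eq_C_of_natDegree_le_zero hP]
    simp [eulerOp]
  ext k
  rw [coeff_eulerOp, coeff_reflect, coeff_reflect, coeff_derivative]
  rcases Nat.lt_or_ge k m with hk | hk
  · obtain ⟨i, rfl⟩ := Nat.exists_eq_add_of_lt hk
    rw [revAt_le (by omega), revAt_le (by omega), show k + i + 1 - 1 - k = i by omega,
      show k + i + 1 - k = i + 1 by omega]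
    push_cast
    ring
  · rw [revAt_eq_self_of_lt (by omega), coeff_eq_zero_of_natDegree_lt (by omega), zero_mul]
    rcases hk.eq_or_lt with rfl | hk
    · simp
    · rw [revAt_eq_self_of_lt hk, coeff_eq_zero_of_natDegree_lt (by omega), mul_zero]

theorem coeff_unitPoly_zero (a : Fin m → R) : (unitPoly a).coeff 0 = 1 := by
  simp [unitPoly, coeff_X_pow]

theorem coeff_unitPoly_succ (a : Fin m → R) (i : Fin m) : (unitPoly a).coeff (i + 1) = a i := by
  simp [unitPoly, coeff_X_pow, coeff_one, Fin.val_inj]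

theorem coeff_unitPoly_of_lt (a : Fin m → R) {k : ℕ} (hk : m < k) : (unitPoly a).coeff k = 0 := by
  have hne (i : Fin m) : k ≠ i + 1 := by omega
  simp [unitPoly, coeff_X_pow, coeff_one, hne, Nat.ne_zero_of_lt hk]

theorem natDegree_unitPoly_le (a : Fin m → R) : (unitPoly a).natDegree ≤ m :=
  natDegree_le_iff_coeff_eq_zero.2 fun _ => coeff_unitPoly_of_lt a

theorem reflect_unitPoly (a : Fin m → R) : reflect m (unitPoly a) = monicPoly a := by
  ext k
  rw [coeff_reflect, unitPoly, monicPoly, coeff_add, coeff_add, finsetSum_coeff, finsetSum_coeff]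
  congr 1
  · by_cases hk : k ≤ m
    · rw [revAt_le hk, coeff_one, coeff_X_pow]
      congr 1
      grind
    · rw [revAt_eq_self_of_lt (by omega), coeff_one, coeff_X_pow, if_neg (by omega),
        if_neg (by omega)]
  · refine sum_congr rfl fun i _ => ?_
    rw [coeff_C_mul_X_pow, coeff_C_mul_X_pow]
    congr 1
    by_cases hk : k ≤ m
    · rw [revAt_le hk]; grind
    · rw [revAt_eq_self_of_lt (by omega)]; grind

theorem reflect_monicPoly (a : Fin m → R) : reflect m (monicPoly a) = unitPoly a := by
  rw [← reflect_unitPoly, reflect_reflect]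

theorem natDegree_monicPoly_le (a : Fin m → R) : (monicPoly a).natDegree ≤ m :=
  natDegree_add_le_of_degree_le (natDegree_X_pow_le m) <|
    natDegree_sum_le_of_forall_le _ _ fun _ _ =>
      (natDegree_C_mul_X_pow_le _ _).trans (Nat.sub_le _ _)

theorem monic_monicPoly (a : Fin m → R) : (monicPoly a).Monic := by
  refine monic_of_natDegree_le_of_coeff_eq_one m (natDegree_monicPoly_le a) ?_
  rw [← reflect_unitPoly, coeff_reflect, revAt_le le_rfl, Nat.sub_self, coeff_unitPoly_zero]

theorem coeff_mul_of_reflect {P Q : R[X]} {p q k : ℕ} (hP : P.natDegree ≤ p) (hQ : Q.natDegree ≤ q)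
    (hk : k ≤ p + q) : (P * Q).coeff (p + q - k) = (reflect p P * reflect q Q).coeff k := by
  rw [← reflect_mul _ _ hP hQ, coeff_reflect, revAt_le hk]

theorem coeff_monicPoly_mul {q k : ℕ} (a : Fin m → R) (b : Fin q → R) (hk : k ≤ m + q) :
    (monicPoly a * monicPoly b).coeff (m + q - k) = (unitPoly a * unitPoly b).coeff k := by
  rw [coeff_mul_of_reflect (natDegree_monicPoly_le a) (natDegree_monicPoly_le b) hk,
    reflect_monicPoly, reflect_monicPoly]

theorem coeff_derivative_monicPoly_mul {q k : ℕ} (a : Fin m → R) (b : Fin q → R)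
    (hk : k + 1 ≤ m + q) :
    (derivative (monicPoly a) * monicPoly b).coeff (m + q - 1 - k) =
      (eulerOp m (unitPoly a) * unitPoly b).coeff k := by
  rcases Nat.eq_zero_or_pos m with rfl | hm
  · simp [monicPoly, unitPoly, eulerOp]
  have hdeg : (derivative (monicPoly a)).natDegree ≤ m - 1 :=
    (natDegree_derivative_le _).trans (Nat.sub_le_sub_right (natDegree_monicPoly_le a) 1)
  rw [show m + q - 1 - k = m - 1 + q - k by omega,
    coeff_mul_of_reflect hdeg (natDegree_monicPoly_le b) (by omega),
    reflect_derivative (natDegree_monicPoly_le a), reflect_monicPoly, reflect_monicPoly]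

theorem map_unitPoly (φ : R →+* S) (a : Fin m → R) :
    (unitPoly a).map φ = unitPoly fun i => φ (a i) := by
  simp [unitPoly, Polynomial.map_sum]

theorem map_monicPoly (φ : R →+* S) (a : Fin m → R) :
    (monicPoly a).map φ = monicPoly fun i => φ (a i) := by
  simp [monicPoly, Polynomial.map_sum]

theorem map_eulerOp (φ : R →+* S) (P : R[X]) :
    (eulerOp m P).map φ = eulerOp m (P.map φ) := by
  simp [eulerOp, derivative_map]

end Reversed

section Roots

open Polynomial

variable {R S ι : Type*} [CommRing R] [CommRing S]

theorem reflect_prod_X_sub_C (x : ι → R) (s : Finset ι) :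
    reflect #s (∏ i ∈ s, (X - C (x i))) = ∏ i ∈ s, (1 - C (x i) * X) := by
  classical
  induction s using Finset.induction_on with
  | empty => simp
  | insert i s hi ih =>
    have hdeg : (∏ i ∈ s, (X - C (x i))).natDegree ≤ #s := by
      simpa using (natDegree_prod_le s _).trans
        (sum_le_card_nsmul s _ 1 fun i _ => natDegree_X_sub_C_le (x i))
    rw [prod_insert hi, prod_insert hi, card_insert_of_notMem hi, add_comm,
      reflect_mul _ _ (natDegree_X_sub_C_le _) hdeg, ih, reflect_sub, reflect_C, pow_one,
      reflect_one_X]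

variable [Fintype ι]

/-- The reversal `∏ᵢ (1 - xᵢ X)` of `∏ᵢ (X - xᵢ)`. -/
def revProd (x : ι → R) : R[X] := ∏ i, (1 - C (x i) * X)

theorem coeff_revProd_zero (x : ι → R) : (revProd x).coeff 0 = 1 := by
  simp [coeff_zero_eq_eval_zero, revProd, eval_prod]

theorem coeff_revProd (A : Type*) [CommRing A] [Algebra A R] (x : ι → R) (k : ℕ) :
    (revProd x).coeff k = (-1) ^ k * MvPolynomial.aeval x (MvPolynomial.esymm ι A k) := by
  have hexp : revProd x = ∑ s : Finset ι, C (∏ i ∈ s, -x i) * X ^ #s := by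
    have hneg (i) : 1 - C (x i) * X = 1 + C (-x i) * X := by rw [C_neg, neg_mul, sub_eq_add_neg]
    simp only [revProd, hneg, prod_one_add, powerset_univ, prod_mul_distrib, prod_const, map_prod]
  rw [hexp, finsetSum_coeff]
  simp_rw [coeff_C_mul_X_pow, ← sum_filter, MvPolynomial.esymm, map_sum, map_prod,
    MvPolynomial.aeval_X, mul_sum]
  refine sum_congr (by ext s; simp [eq_comm]) fun s hs => ?_
  rw [prod_neg, mem_powersetCard_univ.1 hs]

theorem reflect_revProd (x : ι → R) :
    reflect (Fintype.card ι) (revProd x) = ∏ i, (X - C (x i)) := by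
  rw [revProd, ← reflect_prod_X_sub_C, Finset.card_univ, reflect_reflect]

theorem natDegree_revProd_le (x : ι → R) : (revProd x).natDegree ≤ Fintype.card ι := by
  refine (natDegree_prod_le _ _).trans ((sum_le_card_nsmul _ _ 1 fun i _ => ?_).trans ?_)
  · rw [sub_eq_neg_add, ← neg_mul, ← C_neg, ← C_1]
    exact natDegree_linear_le
  · simp

theorem unitPoly_coeff_revProd {m : ℕ} (hm : Fintype.card ι = m) (x : ι → R) :
    unitPoly (fun i : Fin m => (revProd x).coeff (i + 1)) = revProd x := by
  ext k
  rcases Nat.eq_zero_or_pos k with rfl | hk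
  · rw [coeff_unitPoly_zero, coeff_revProd_zero]
  obtain ⟨k, rfl⟩ := Nat.exists_eq_add_of_le' hk
  rcases Nat.lt_or_ge k m with hkm | hkm
  · exact coeff_unitPoly_succ _ (⟨k, hkm⟩ : Fin m)
  · rw [coeff_unitPoly_of_lt _ (by omega),
      coeff_eq_zero_of_natDegree_lt ((natDegree_revProd_le x).trans_lt (by omega))]

theorem unitPoly_eq_revProd_iff {m : ℕ} (hm : Fintype.card ι = m) (x : ι → R) (a : Fin m → R) :
    unitPoly a = revProd x ↔ monicPoly a = ∏ i, (X - C (x i)) := by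
  subst hm
  rw [← reflect_unitPoly, ← reflect_revProd]
  exact ⟨fun h => h ▸ rfl, fun h => by simpa using congrArg (reflect (Fintype.card ι)) h⟩

theorem sum_prod_erase_eq_eulerOp [DecidableEq ι] (x : ι → R) :
    ∑ i, ∏ j ∈ univ.erase i, (1 - C (x j) * X) = eulerOp (Fintype.card ι) (revProd x) := by
  have hprod (i : ι) : (∏ j ∈ univ.erase i, (1 - C (x j) * X)) * (1 - C (x i) * X) = revProd x :=
    prod_erase_mul _ _ (mem_univ i)
  have hcard : C (Fintype.card ι : R) * revProd x =
      ∑ i, (∏ j ∈ univ.erase i, (1 - C (x j) * X)) * (1 - C (x i) * X) := by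
    simp only [hprod, sum_const, card_univ, nsmul_eq_mul, map_natCast]
  rw [eulerOp, hcard, revProd, derivative_prod_finset, mul_sum, ← sum_sub_distrib]
  refine sum_congr rfl fun i _ => ?_
  rw [derivative_sub, derivative_one, derivative_C_mul_X]
  ring

theorem map_revProd (φ : R →+* S) (x : ι → R) :
    (revProd x).map φ = revProd fun i => φ (x i) := by
  simp [revProd, Polynomial.map_prod]

theorem revProd_sumElim {κ : Type*} [Fintype κ] (x : ι ⊕ κ → R) :
    revProd x = revProd (fun i => x (Sum.inl i)) * revProd fun i => x (Sum.inr i) :=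
  Fintype.prod_sum_type _

theorem exists_unitPoly_eq_revProd {K : Type*} [Field K] [IsAlgClosed K] {n : ℕ} (a : Fin n → K) :
    ∃ ζ : Fin n → K, unitPoly a = revProd ζ := by
  have hsplits := IsAlgClosed.splits (monicPoly a)
  have hdeg : (monicPoly a).natDegree = n :=
    (natDegree_monicPoly_le a).antisymm <| le_natDegree_of_ne_zero <| by
      rw [← reflect_unitPoly, coeff_reflect, revAt_le le_rfl, Nat.sub_self, coeff_unitPoly_zero]
      exact one_ne_zero
  have hlength : (monicPoly a).roots.toList.length = n := by
    rw [Multiset.length_toList, ← hsplits.natDegree_eq_card_roots, hdeg]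
  refine ⟨fun s => (monicPoly a).roots.toList.get (s.cast hlength.symm),
    (unitPoly_eq_revProd_iff (Fintype.card_fin n) _ a).2 ?_⟩
  calc monicPoly a = ((monicPoly a).roots.map fun c => X - C c).prod :=
        hsplits.eq_prod_roots_of_monic (monic_monicPoly a)
    _ = ((monicPoly a).roots.toList.map fun c => X - C c).prod := by
        rw [← Multiset.prod_coe, ← Multiset.map_coe, Multiset.coe_toList]
    _ = _ := by
        rw [← List.prod_ofFn]
        refine congrArg List.prod (List.ext_getElem (by simp [hlength]) fun i _ _ => by simp)

theorem mk_pow_mul_one_sub (x : R) :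
    PowerSeries.mk (fun k => x ^ k) * (1 - PowerSeries.C x * PowerSeries.X) = 1 := by
  simpa [PowerSeries.rescale_X, PowerSeries.rescale_mk] using
    congrArg (PowerSeries.rescale x) (PowerSeries.mk_one_mul_one_sub_eq_one R)

theorem revProd_mul_mk_sum_pow (x : ι → R) :
    (revProd x : PowerSeries R) * PowerSeries.mk (fun k => ∑ i, x i ^ k) =
      (eulerOp (Fintype.card ι) (revProd x) : R[X]) := by
  classical
  have hmk : PowerSeries.mk (fun k => ∑ i, x i ^ k) =
      ∑ i, PowerSeries.mk fun k => x i ^ k := by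
    ext k
    simp
  have hfactor (i : ι) : (revProd x : PowerSeries R) =
      ((∏ j ∈ univ.erase i, (1 - C (x j) * X) : R[X]) : PowerSeries R) *
        (1 - PowerSeries.C (x i) * PowerSeries.X) := by
    rw [revProd, ← prod_erase_mul _ _ (mem_univ i)]
    simp
  rw [hmk, mul_sum, ← sum_prod_erase_eq_eulerOp, ← coeToPowerSeries.ringHom_apply (φ := ∑ i, _),
    map_sum]
  refine sum_congr rfl fun i _ => ?_
  rw [hfactor i, mul_assoc, mul_comm (1 - _), mk_pow_mul_one_sub, mul_one,
    coeToPowerSeries.ringHom_apply]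

end Roots

section Graded

open MvPolynomial

theorem mem_of_isWeightedHomogeneous {σ R M : Type*} [CommSemiring R] [AddCommMonoid M] {w : σ → M}
    (A : M → Submodule R (MvPolynomial σ R)) [SetLike.GradedMonoid A] (hX : ∀ i, X i ∈ A (w i))
    {F : MvPolynomial σ R} {d : M} (hF : IsWeightedHomogeneous w F d) : F ∈ A d := by
  have hmonomial (m : σ →₀ ℕ) : monomial m (1 : R) ∈ A (Finsupp.weight w m) := by
    induction m using Finsupp.induction_linear with
    | zero => simpa using SetLike.GradedOne.one_mem (A := A)
    | add a b ha hb =>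
      rw [map_add, ← one_mul (1 : R), ← monomial_mul]
      exact SetLike.GradedMul.mul_mem ha hb
    | single i k =>
      rw [← X_pow_eq_monomial, Finsupp.weight_single]
      exact SetLike.pow_mem_graded k (hX i)
  rw [F.as_sum]
  refine Submodule.sum_mem _ fun m hm => ?_
  rw [← hF (mem_support_iff.1 hm), ← mul_one (F.coeff m), ← smul_eq_mul, ← smul_monomial]
  exact Submodule.smul_mem _ _ (hmonomial m)

end Graded

section Integral

open MvPolynomial

theorem injective_of_isIntegralElem {ι κ k : Type*} [Finite ι] [Finite κ] [Field k]
    (hcard : Nat.card ι = Nat.card κ) (f : MvPolynomial ι k →ₐ[k] MvPolynomial κ k)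
    (hf : ∀ i, f.toRingHom.IsIntegralElem (X i)) : Function.Injective f := by
  have hfa : f = aeval fun i => f (X i) := algHom_ext fun i => by simp
  have hrange : Algebra.adjoin k (Set.range fun i => f (X i)) = f.range := by
    conv_rhs => rw [hfa]
    rw [Algebra.adjoin_range_eq_range_aeval]
  have hint : Algebra.IsIntegral (Algebra.adjoin k (Set.range fun i => f (X i)))
      (MvPolynomial κ k) := by
    rw [hrange]
    refine ⟨fun x => ?_⟩
    induction x using MvPolynomial.induction_on with
    | C c => exact isIntegral_algebraMap (x := (⟨C c, f.range.algebraMap_mem c⟩ : f.range))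
    | add a b ha hb => exact ha.add hb
    | mul_X a i ha =>
      obtain ⟨p, hp, hp0⟩ := hf i
      exact ha.mul ⟨p.map f.rangeRestrict.toRingHom, hp.map _, (Polynomial.eval₂_map ..).trans hp0⟩
  have hbasis := Algebra.IsAlgebraic.isTranscendenceBasis_of_lift_le_trdeg_of_finite
    (R := k) (fun i => f (X i)) (by
      rw [trdeg_of_isDomain]
      simp only [← Nat.cast_card, hcard, Cardinal.lift_natCast, le_refl])
  have hindep := hbasis.1
  rwa [AlgebraicIndependent, ← hfa] at hindep

theorem injective_of_injective_comp {ι κ k A : Type*} [Finite ι] [Finite κ] [Field k] [CommRing A]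
    [IsDomain A] [Algebra k A] (hcard : Nat.card ι ≤ Nat.card κ) (f : MvPolynomial ι k →ₐ[k] A)
    (g : MvPolynomial κ k →ₐ[k] MvPolynomial ι k) (h : Function.Injective (f.comp g)) :
    Function.Injective f := by
  let F : MvPolynomial ι k →ₐ[k] f.range := f.rangeRestrict
  have hF : F = aeval fun i => F (X i) := algHom_ext fun i => by simp
  have hgen : Algebra.adjoin k (Set.range fun i => F (X i)) = ⊤ := by
    rw [Algebra.adjoin_range_eq_range_aeval, ← hF, AlgHom.range_eq_top]
    exact f.rangeRestrict_surjective
  have hFg : F.comp g = aeval fun j => F (g (X j)) := algHom_ext fun j => by simp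
  have hindep : AlgebraicIndependent k fun j => F (g (X j)) := by
    rw [AlgebraicIndependent, ← hFg]
    exact fun a b hab => h (congrArg Subtype.val hab)
  have : Algebra.IsAlgebraic (Algebra.adjoin k (Set.range fun i => F (X i))) f.range :=
    ⟨fun a => isAlgebraic_algebraMap (⟨a, hgen ▸ Algebra.mem_top⟩ : Algebra.adjoin k _)⟩
  have htrdeg := hindep.lift_cardinalMk_le_trdeg
  rw [← Nat.cast_card, Cardinal.lift_natCast, Cardinal.nat_le_lift_iff] at htrdeg
  have hbasis := Algebra.IsAlgebraic.isTranscendenceBasis_of_lift_le_trdeg_of_finite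
    (R := k) (fun i => F (X i)) (by
      rw [← Nat.cast_card, Cardinal.lift_natCast, Cardinal.nat_le_lift_iff]
      exact (Nat.cast_le.2 hcard).trans htrdeg)
  have hinj := hbasis.1
  rw [AlgebraicIndependent, ← hF] at hinj
  exact fun a b hab => hinj (Subtype.ext hab)

end Integral

section Graded

open MvPolynomial

variable {R : Type*} [CommSemiring R]

theorem gradedMonoid_comap {ι S T : Type*} [AddMonoid ι] [Semiring S] [Semiring T] [Algebra R S]
    [Algebra R T] (f : S →ₐ[R] T) (A : ι → Submodule R T) [SetLike.GradedMonoid A] :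
    SetLike.GradedMonoid fun i => (A i).comap f.toLinearMap where
  one_mem := by simpa using SetLike.GradedOne.one_mem (A := A)
  mul_mem i j a b ha hb := by simpa using SetLike.GradedMul.mul_mem (A := A) ha hb

variable {σ τ : Type*} {w : σ → ℕ} {N : ℕ}

theorem homogeneousComponent_apply_eq (ρ : MvPolynomial σ R →ₗ[R] MvPolynomial τ R)
    (hρ : ∀ d F, IsWeightedHomogeneous w F d → (ρ F).IsHomogeneous (d + N)) (d : ℕ)
    (F : MvPolynomial σ R) :
    homogeneousComponent (d + N) (ρ F) = ρ (weightedHomogeneousComponent w d F) := by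
  induction F using MvPolynomial.induction_on' with
  | monomial m a =>
    have hm := isWeightedHomogeneous_monomial w m a rfl
    rw [homogeneousComponent_of_mem (hρ _ _ hm), weightedHomogeneousComponent_of_mem hm]
    simp only [add_left_inj]
    split_ifs
    · rfl
    · rw [map_zero]
  | add p q hp hq => simp only [map_add, hp, hq]

theorem isWeightedHomogeneous_iff_of_injective {κ : Type*}
    (ρ : MvPolynomial σ R →ₗ[R] κ → MvPolynomial τ R) (hinj : Function.Injective ρ)
    (hρ : ∀ d F, IsWeightedHomogeneous w F d → ∀ J, (ρ F J).IsHomogeneous (d + N)) {d : ℕ}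
    {F : MvPolynomial σ R} :
    IsWeightedHomogeneous w F d ↔ ∀ J, (ρ F J).IsHomogeneous (d + N) := by
  refine ⟨hρ d F, fun h m hm => ?_⟩
  by_contra hne
  have hzero : weightedHomogeneousComponent w (Finsupp.weight w m) F = 0 := by
    refine hinj (funext fun J => ?_)
    have hJ := homogeneousComponent_apply_eq ((LinearMap.proj J).comp ρ)
      (fun d F hF => hρ d F hF J) (Finsupp.weight w m) F
    rw [LinearMap.comp_apply, LinearMap.comp_apply, LinearMap.proj_apply, LinearMap.proj_apply,
      homogeneousComponent_of_mem (h J), if_neg (by omega)] at hJ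
    rw [← hJ, map_zero, Pi.zero_apply]
  have hcoeff := congrArg (coeff m) hzero
  rw [coeff_weightedHomogeneousComponent, if_pos rfl, coeff_zero] at hcoeff
  exact hm hcoeff

end Graded

/-! ### Fermionic Fock space -/

/-- The space `(ℂ^{1|1})^{⊗ n}` with coefficients in `R`, so that `VPoly n` is the case
`R = ℂ[z₁, …, z_n]`. -/
abbrev Fock (R : Type*) (n : ℕ) : Type _ := (Fin n → Fin 2) → R

theorem neg_one_pow_eq_of_add_eq {R : Type*} [CommRing R] {a b i j : ℕ} (h : a + i = b + j) :
    (-1 : R) ^ a = (-1) ^ (i + j) * (-1) ^ b := by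
  rw [← pow_add, neg_one_pow_congr]
  grind

section Fock

variable {R : Type*} [CommRing R] {n : ℕ}

/-- The exponent `|J 1| + ⋯ + |J (s - 1)|` of the Koszul sign of an odd operator in the factor
`s`. -/
def parityBelow (J : Fin n → Fin 2) (s : Fin n) : ℕ := ∑ k ∈ Iio s, (J k : ℕ)

theorem parityBelow_update_of_le (J : Fin n → Fin 2) {s t : Fin n} (h : s ≤ t) (j : Fin 2) :
    parityBelow (Function.update J t j) s = parityBelow J s :=
  sum_congr rfl fun k hk => by rw [Function.update_of_ne ((mem_Iio.1 hk).trans_le h).ne]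

theorem parityBelow_update_add_of_lt (J : Fin n → Fin 2) {s t : Fin n} (h : s < t) (j : Fin 2) :
    parityBelow (Function.update J s j) t + J s = parityBelow J t + j := by
  have hs : s ∈ Iio t := mem_Iio.2 h
  have hrest : ∑ k ∈ (Iio t).erase s, (Function.update J s j k : ℕ) =
      ∑ k ∈ (Iio t).erase s, (J k : ℕ) :=
    sum_congr rfl fun k hk => by rw [Function.update_of_ne (ne_of_mem_erase hk)]
  simp only [parityBelow, ← add_sum_erase _ _ hs, hrest, Function.update_self]
  ring

/-- The operator `e_{ij}` in the `s`-th tensor factor, with the Koszul sign: `siteOp` over an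
arbitrary ring. -/
def fockOp (i j : Fin 2) (s : Fin n) : Module.End R (Fock R n) where
  toFun F J :=
    if J s = i then (-1) ^ (parityBelow J s * ((i : ℕ) + j)) * F (Function.update J s j) else 0
  map_add' F G := by
    funext J
    by_cases h : J s = i <;> simp [h, mul_add]
  map_smul' c F := by
    funext J
    by_cases h : J s = i <;> simp [h, mul_left_comm]

theorem fockOp_apply (i j : Fin 2) (s : Fin n) (F : Fock R n) (J : Fin n → Fin 2) :
    fockOp i j s F J =
      if J s = i then (-1) ^ (parityBelow J s * ((i : ℕ) + j)) * F (Function.update J s j)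
      else 0 :=
  rfl

theorem fockOp_mul_self (i j k l : Fin 2) (s : Fin n) :
    (fockOp i j s * fockOp k l s : Module.End R (Fock R n)) =
      if j = k then fockOp i l s else 0 := by
  refine LinearMap.ext fun F => funext fun J => ?_
  by_cases hjk : j = k
  · subst hjk
    have hsign (m : ℕ) : (-1 : R) ^ (m * ((i : ℕ) + j)) * (-1) ^ (m * ((j : ℕ) + l)) =
        (-1) ^ (m * ((i : ℕ) + l)) := by
      rw [← pow_add, neg_one_pow_congr]
      grind
    by_cases hJ : J s = i
    · simp [fockOp_apply, hJ, parityBelow_update_of_le, ← mul_assoc, hsign]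
    · simp [fockOp_apply, hJ]
  · simp [fockOp_apply, hjk]

theorem fockOp_mul_of_lt (i j k l : Fin 2) {s t : Fin n} (h : s < t) :
    (fockOp i j s * fockOp k l t : Module.End R (Fock R n)) =
      (-1 : R) ^ (((i : ℕ) + j) * ((k : ℕ) + l)) • (fockOp k l t * fockOp i j s) := by
  refine LinearMap.ext fun F => funext fun J => ?_
  by_cases hs : J s = i
  · subst hs
    have hsign : (-1 : R) ^ (parityBelow (Function.update J s j) t * ((k : ℕ) + l)) =
        (-1) ^ (((J s : ℕ) + j) * ((k : ℕ) + l)) * (-1) ^ (parityBelow J t * ((k : ℕ) + l)) := by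
      simp only [pow_mul, neg_one_pow_eq_of_add_eq (parityBelow_update_add_of_lt J h j), mul_pow]
    by_cases ht : J t = k
    · simp only [Module.End.mul_apply, LinearMap.smul_apply, Pi.smul_apply, smul_eq_mul,
        fockOp_apply, Function.update_of_ne h.ne, Function.update_of_ne h.ne', ht, if_true,
        parityBelow_update_of_le J h.le, Function.update_comm h.ne, hsign]
      ring
    · simp [fockOp_apply, h.ne', ht]
  · simp [fockOp_apply, h.ne, hs]

theorem fockOp_mul_of_ne (i j k l : Fin 2) {s t : Fin n} (h : s ≠ t) :
    (fockOp i j s * fockOp k l t : Module.End R (Fock R n)) =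
      (-1 : R) ^ (((i : ℕ) + j) * ((k : ℕ) + l)) • (fockOp k l t * fockOp i j s) := by
  rcases lt_or_gt_of_ne h with h | h
  · exact fockOp_mul_of_lt i j k l h
  · rw [fockOp_mul_of_lt k l i j h, smul_smul, mul_comm ((k : ℕ) + l), ← mul_pow]
    simp

theorem fockOp_zero_zero_add_one_one (s : Fin n) :
    (fockOp 0 0 s + fockOp 1 1 s : Module.End R (Fock R n)) = 1 := by
  refine LinearMap.ext fun F => funext fun J => ?_
  have hup (i : Fin 2) (h : J s = i) : Function.update J s i = J := by
    rw [← h, Function.update_eq_self]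
  rcases Fin.exists_fin_two.1 ⟨J s, rfl⟩ with h | h
  · simp [fockOp_apply, h, hup 0 h]
  · simp [fockOp_apply, h, hup 1 h, mul_comm _ 2, pow_mul]

/-- The operator `∑_s w_s e_{ij}^{(s)}`; for `w_s = z_s ^ r` it is the action of `e_{ij}[r]`. -/
def weightedOp (i j : Fin 2) : (Fin n → R) →ₗ[R] Module.End R (Fock R n) :=
  Fintype.linearCombination R (fockOp i j)

theorem weightedOp_apply (i j : Fin 2) (w : Fin n → R) :
    weightedOp i j w = ∑ s, w s • fockOp i j s :=
  rfl

theorem weightedOp_supercomm (i j k l : Fin 2) (v w : Fin n → R) :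
    weightedOp i j v * weightedOp k l w -
        (-1 : R) ^ (((i : ℕ) + j) * ((k : ℕ) + l)) • (weightedOp k l w * weightedOp i j v) =
      (if j = k then weightedOp i l (v * w) else 0) -
        (-1 : R) ^ (((i : ℕ) + j) * ((k : ℕ) + l)) •
          (if i = l then weightedOp k j (v * w) else 0) := by
  have hdiag (a b c d : Fin 2) : (if b = c then weightedOp a d (v * w) else 0) =
      ∑ s, (v s * w s) • (fockOp a b s * fockOp c d s : Module.End R (Fock R n)) := by
    simp only [fockOp_mul_self]
    split_ifs <;> simp [weightedOp_apply]
  rw [hdiag i j k l, ← (by simp only [eq_comm] :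
    (if l = i then weightedOp k j (v * w) else 0) = if i = l then weightedOp k j (v * w) else 0),
    hdiag k l i j]
  simp only [weightedOp_apply, sum_mul_sum, smul_mul_smul_comm]
  rw [sum_comm (f := fun s t => (w s * v t) • (fockOp k l s * fockOp i j t)), smul_sum, smul_sum,
    ← sum_sub_distrib, ← sum_sub_distrib]
  refine sum_congr rfl fun s _ => ?_
  rw [smul_sum, ← sum_sub_distrib, sum_eq_single s, mul_comm (w s)]
  · intro t _ hts
    rw [fockOp_mul_of_ne i j k l hts.symm, smul_comm, mul_comm (w t), sub_self]
  · simp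

theorem weightedOp_zero_zero_add_one_one (w : Fin n → R) :
    weightedOp 0 0 w + weightedOp 1 1 w = (∑ s, w s) • 1 := by
  simp only [weightedOp_apply, ← sum_add_distrib, ← smul_add, fockOp_zero_zero_add_one_one,
    sum_smul]

/-- The annihilation operators, `e₁₂` with weights. -/
abbrev annOp : (Fin n → R) →ₗ[R] Module.End R (Fock R n) := weightedOp 0 1

/-- The creation operators, `e₂₁` with weights. -/
abbrev creOp : (Fin n → R) →ₗ[R] Module.End R (Fock R n) := weightedOp 1 0

/-- The weighted number operators, `e₂₂` with weights. -/
abbrev numOp : (Fin n → R) →ₗ[R] Module.End R (Fock R n) := weightedOp 1 1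

theorem annOp_annOp (v w : Fin n → R) (F : Fock R n) :
    annOp v (annOp w F) = -annOp w (annOp v F) := by
  have h := LinearMap.congr_fun (weightedOp_supercomm 0 1 0 1 v w) F
  simpa [add_eq_zero_iff_eq_neg] using h

theorem annOp_creOp (v w : Fin n → R) (F : Fock R n) :
    annOp v (creOp w F) = (v ⬝ᵥ w) • F - creOp w (annOp v F) := by
  have h := LinearMap.congr_fun (weightedOp_supercomm 0 1 1 0 v w) F
  have hsum := LinearMap.congr_fun (weightedOp_zero_zero_add_one_one (v * w)) F
  simp only [LinearMap.add_apply] at hsum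
  refine eq_sub_of_add_eq ?_
  simpa [hsum, dotProduct] using h

theorem annOp_numOp (v w : Fin n → R) (F : Fock R n) :
    annOp v (numOp w F) = numOp w (annOp v F) + annOp (v * w) F := by
  have h := LinearMap.congr_fun (weightedOp_supercomm 0 1 1 1 v w) F
  exact sub_eq_iff_eq_add'.1 (by simpa using h)

theorem numOp_creOp (v w : Fin n → R) (F : Fock R n) :
    numOp v (creOp w F) = creOp w (numOp v F) + creOp (v * w) F := by
  have h := LinearMap.congr_fun (weightedOp_supercomm 1 1 1 0 v w) F
  exact sub_eq_iff_eq_add'.1 (by simpa using h)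

theorem numOp_numOp (v w : Fin n → R) (F : Fock R n) :
    numOp v (numOp w F) = numOp w (numOp v F) := by
  have h := LinearMap.congr_fun (weightedOp_supercomm 1 1 1 1 v w) F
  simpa [sub_eq_zero, Even.neg_pow (show Even 4 by decide)] using h

theorem annOp_single (s : Fin n) : annOp (Pi.single s (1 : R)) = fockOp 0 1 s := by
  rw [annOp, weightedOp_apply, sum_eq_single s] <;> simp +contextual

theorem annOp_mul_self (w : Fin n → R) : annOp w * annOp w = 0 := by
  have hanti (s t : Fin n) :
      (fockOp 0 1 s * fockOp 0 1 t : Module.End R (Fock R n)) =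
        -(fockOp 0 1 t * fockOp 0 1 s) :=
    LinearMap.ext fun F => by
      simpa only [annOp_single, Module.End.mul_apply, LinearMap.neg_apply] using
        annOp_annOp (Pi.single s 1) (Pi.single t 1) F
  simp only [annOp, weightedOp_apply, sum_mul_sum, smul_mul_smul_comm]
  rw [← sum_product']
  refine sum_involution (fun p _ => (p.2, p.1)) ?_ ?_ (by simp) (by simp)
  · rintro ⟨s, t⟩ -
    simp only
    rw [hanti s t, mul_comm (w s), smul_neg, neg_add_cancel]
  · rintro ⟨s, t⟩ - h e
    obtain rfl : s = t := by simpa using congrArg Prod.snd e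
    exact h (by simp [fockOp_mul_self])

/-! ### Vacuum amplitudes -/

/-- The coordinate at the vacuum `v₁ ⊗ ⋯ ⊗ v₁`. -/
def vacuumCoeff : Fock R n →ₗ[R] R := LinearMap.proj 0

theorem vacuumCoeff_apply (F : Fock R n) : vacuumCoeff F = F 0 := rfl

theorem vacuumCoeff_creOp (w : Fin n → R) (F : Fock R n) : vacuumCoeff (creOp w F) = 0 := by
  simp [vacuumCoeff_apply, weightedOp_apply, fockOp_apply]

theorem vacuumCoeff_numOp (w : Fin n → R) (F : Fock R n) : vacuumCoeff (numOp w F) = 0 := by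
  simp [vacuumCoeff_apply, weightedOp_apply, fockOp_apply]

theorem annOp_vacuum (w : Fin n → R) : annOp w (Pi.single 0 1 : Fock R n) = 0 := by
  funext J
  simp only [weightedOp_apply, LinearMap.sum_apply, LinearMap.smul_apply, Finset.sum_apply,
    Pi.smul_apply, Pi.zero_apply]
  refine sum_eq_zero fun s _ => ?_
  have : Function.update J s 1 ≠ 0 := fun h => by simpa using congrFun h s
  simp [fockOp_apply, Pi.single_eq_of_ne this]

/-- The products of annihilation operators as a homomorphism from the exterior algebra, into the
opposite algebra in order that the first factor act first. -/
def annExt : ExteriorAlgebra R (Fin n → R) →ₐ[R] (Module.End R (Fock R n))ᵐᵒᵖ :=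
  ExteriorAlgebra.lift R
    ⟨(MulOpposite.opLinearEquiv R).toLinearMap ∘ₗ annOp, fun w => by
      simp [← MulOpposite.op_mul, annOp_mul_self]⟩

/-- The vacuum amplitude, the functional that sends `F` to the coordinate at the vacuum of
`annOp (w (k - 1)) (⋯ (annOp (w 0) F))`. -/
def amplitude (k : ℕ) : (Fin n → R) [⋀^Fin k]→ₗ[R] Module.Dual R (Fock R n) :=
  (((MulOpposite.opLinearEquiv R).symm.toLinearMap ∘ₗ annExt.toLinearMap).compr₂
    vacuumCoeff).compAlternatingMap (ExteriorAlgebra.ιMulti R k)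

theorem amplitude_zero (w : Fin 0 → Fin n → R) (F : Fock R n) : amplitude 0 w F = F 0 := by
  simp [amplitude, vacuumCoeff_apply]

theorem amplitude_succ (k : ℕ) (w : Fin (k + 1) → Fin n → R) (F : Fock R n) :
    amplitude (k + 1) w F = amplitude k (fun i => w i.succ) (annOp (w 0) F) := by
  simp only [amplitude, annExt, LinearMap.compAlternatingMap_apply, LinearMap.compr₂_apply,
    ExteriorAlgebra.ιMulti_succ_apply, LinearMap.coe_comp, Function.comp_apply,
    AlgHom.coe_toLinearMap, map_mul, ExteriorAlgebra.lift_ι_apply, LinearEquiv.coe_coe,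
    MulOpposite.coe_opLinearEquiv, MulOpposite.coe_opLinearEquiv_symm, MulOpposite.unop_mul,
    MulOpposite.unop_op, Module.End.mul_apply]
  rfl

theorem amplitude_eq_zero_of_annOp_eq_zero (k : ℕ) {w : Fin k → Fin n → R} {F : Fock R n}
    {j : Fin k} (hF : annOp (w j) F = 0) : amplitude k w F = 0 := by
  induction k generalizing F with
  | zero => exact j.elim0
  | succ k ih =>
    rw [amplitude_succ]
    induction j using Fin.cases with
    | zero => rw [hF, map_zero]
    | succ j =>
      refine ih (j := j) ?_
      rw [annOp_annOp, hF, map_zero, neg_zero]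

theorem amplitude_apply_of_comm (k : ℕ) {D : Module.End R (Fock R n)}
    (hD : ∀ F, vacuumCoeff (D F) = 0) {w : Fin k → Fin n → R} {μ : Fin k → R}
    (h : ∀ j F, annOp (w j) (D F) = D (annOp (w j) F) + μ j • annOp (w j) F) (F : Fock R n) :
    amplitude k w (D F) = (∑ j, μ j) * amplitude k w F := by
  induction k generalizing F with
  | zero => simpa [amplitude_zero, vacuumCoeff_apply] using hD F
  | succ k ih =>
    rw [amplitude_succ, h, map_add, map_smul, ih fun j => h j.succ, amplitude_succ,
      Fin.sum_univ_succ, smul_eq_mul]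
    ring

/-- `creOp (h 0) ⋯ creOp (h (k - 1))` applied to the vacuum. -/
def creationState (k : ℕ) (h : Fin k → Fin n → R) : Fock R n :=
  (List.ofFn fun i => creOp (h i)).prod (Pi.single 0 1)

theorem creationState_succ (k : ℕ) (h : Fin (k + 1) → Fin n → R) :
    creationState (k + 1) h = creOp (h 0) (creationState k fun i => h i.succ) := by
  simp [creationState, List.ofFn_succ]

theorem annOp_creationState (k : ℕ) (w : Fin n → R) (h : Fin (k + 1) → Fin n → R) :
    annOp w (creationState (k + 1) h) =
      ∑ j : Fin (k + 1), ((-1) ^ (j : ℕ) * (w ⬝ᵥ h j)) •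
        creationState k fun i => h (j.succAbove i) := by
  induction k with
  | zero =>
    rw [creationState_succ, annOp_creOp]
    simp [creationState, annOp_vacuum]
  | succ k ih =>
    rw [creationState_succ, annOp_creOp, ih, Fin.sum_univ_succ (n := k + 1), map_sum,
      sub_eq_add_neg, ← sum_neg_distrib]
    congr 1
    · simp
    · refine sum_congr rfl fun j _ => ?_
      rw [map_smul, ← neg_smul, creationState_succ k]
      simp [pow_succ]

theorem amplitude_creationState (k : ℕ) (w h : Fin k → Fin n → R) :
    amplitude k w (creationState k h) = (Matrix.of fun i j => w i ⬝ᵥ h j).det := by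
  induction k with
  | zero => simp [amplitude_zero, creationState]
  | succ k ih =>
    rw [amplitude_succ, annOp_creationState, map_sum,
      Matrix.det_succ_row_zero]
    refine sum_congr rfl fun j _ => ?_
    rw [map_smul, ih]
    rfl

theorem amplitude_eq_sum (k : ℕ) (w : Fin k → Fin n → R) (F : Fock R n) :
    amplitude k w F =
      ∑ t : Fin k → Fin n, (∏ j, w j (t j)) * amplitude k (fun j => Pi.single (t j) 1) F := by
  have hw : w = fun j => ∑ s, w j s • (Pi.single s 1 : Fin n → R) :=
    funext fun j => pi_eq_sum_univ' (w j)
  conv_lhs => rw [hw, ← AlternatingMap.coe_multilinearMap, MultilinearMap.map_sum]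
  rw [LinearMap.sum_apply]
  exact sum_congr rfl fun t _ => by rw [MultilinearMap.map_smul_univ]; rfl

theorem exists_amplitude_single_eq (k : ℕ) (F : Fock R n) {t : Fin k → Fin n}
    (ht : Function.Injective t) :
    ∃ ε : ℕ, amplitude k (fun j => Pi.single (t j) 1) F =
      (-1) ^ ε * F fun s => if ∃ j, t j = s then 1 else 0 := by
  induction k generalizing F with
  | zero => exact ⟨0, by simp [amplitude_zero, Pi.zero_def]⟩
  | succ k ih =>
    obtain ⟨ε, hε⟩ := ih (annOp (Pi.single (t 0) 1) F) (t := fun i => t i.succ)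
      (ht.comp (Fin.succ_injective _))
    have h₀ : ¬ ∃ j : Fin k, t j.succ = t 0 := fun ⟨j, hj⟩ => Fin.succ_ne_zero j (ht hj)
    have hupdate : Function.update
        (fun s => if ∃ j : Fin k, t j.succ = s then (1 : Fin 2) else 0) (t 0) 1 =
          fun s => if ∃ j, t j = s then 1 else 0 := by
      funext s
      by_cases hs : s = t 0
      · simp [hs]
      · simp [Function.update_of_ne hs, Fin.exists_fin_succ, Ne.symm hs]
    rw [amplitude_succ, hε, annOp_single, fockOp_apply]
    simp only [h₀, if_false, if_true, hupdate]
    exact ⟨ε + _, by rw [pow_add, mul_assoc]⟩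

theorem numOp_one_apply (F : Fock R n) (J : Fin n → Fin 2) :
    numOp 1 F J = (∑ s, ((J s : ℕ) : R)) * F J := by
  simp only [weightedOp_apply, LinearMap.sum_apply, Pi.one_apply, one_smul, Finset.sum_apply,
    sum_mul]
  refine sum_congr rfl fun s _ => ?_
  rcases Fin.exists_fin_two.1 ⟨J s, rfl⟩ with h | h
  · simp [fockOp_apply, h]
  · have hJ : Function.update J s 1 = J := by rw [← h, Function.update_eq_self]
    simp [fockOp_apply, h, hJ, mul_comm _ 2, pow_mul]

theorem numOp_one_creationState (k : ℕ) (h : Fin k → Fin n → R) :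
    numOp 1 (creationState k h) = (k : R) • creationState k h := by
  induction k with
  | zero =>
    funext J
    rw [numOp_one_apply]
    by_cases hJ : J = 0
    · simp [hJ]
    · simp [creationState, Pi.single_eq_of_ne hJ]
  | succ k ih =>
    rw [creationState_succ, numOp_creOp, ih, map_smul, one_mul, Nat.cast_succ, add_smul, one_smul]

theorem eq_zero_of_amplitude_single_eq_zero [IsDomain R] [CharZero R] {l : ℕ} {F : Fock R n}
    (hF : numOp 1 F = (l : R) • F)
    (h : ∀ t : Fin l → Fin n, amplitude l (fun j => Pi.single (t j) 1) F = 0) : F = 0 := by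
  funext J
  have hJ := congrFun hF J
  rw [numOp_one_apply, Pi.smul_apply, smul_eq_mul, ← sub_eq_zero, ← sub_mul, mul_eq_zero,
    ← Nat.cast_sum, sub_eq_zero, Nat.cast_inj] at hJ
  refine hJ.elim (fun hl => ?_) id
  have hcard : #{s | J s = 1} = l := by
    rw [← hl, card_filter]
    refine sum_congr rfl fun s _ => ?_
    rcases Fin.exists_fin_two.1 ⟨J s, rfl⟩ with h | h <;> simp [h]
  let t := orderEmbOfFin _ hcard
  have ht : (fun s => if ∃ j, t j = s then (1 : Fin 2) else 0) = J := by
    funext s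
    have hs : (∃ j, t j = s) ↔ J s = 1 := by
      rw [← Set.mem_range, range_orderEmbOfFin]
      simp
    rcases Fin.exists_fin_two.1 ⟨J s, rfl⟩ with h | h <;> simp [hs, h]
  obtain ⟨ε, hε⟩ := exists_amplitude_single_eq l F t.injective
  rw [h, ht] at hε
  simpa using hε.symm

/-! ### Transfer operators -/

/-- The coefficient of `x^{-m-2}` in the transfer series, acting on the Fock space with evaluation
parameters `ζ`. -/
def transferOp (ζ : Fin n → R) (m : ℕ) : Module.End R (Fock R n) :=
  ∑ x ∈ antidiagonal m,
    ((∑ s, ζ s ^ x.1) • numOp (ζ ^ x.2) - creOp (ζ ^ x.1) * annOp (ζ ^ x.2))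

/-- The weights of the commutator of `annOp w` with `transferOp ζ m`, which is again an
annihilation operator. -/
def transferWeight (ζ : Fin n → R) (m : ℕ) (w : Fin n → R) : Fin n → R :=
  ∑ x ∈ antidiagonal m, ((∑ s, ζ s ^ x.1) • (w * ζ ^ x.2) - (w ⬝ᵥ ζ ^ x.1) • ζ ^ x.2)

theorem annOp_transferOp (ζ : Fin n → R) (m : ℕ) (w : Fin n → R) (F : Fock R n) :
    annOp w (transferOp ζ m F) =
      transferOp ζ m (annOp w F) + annOp (transferWeight ζ m w) F := by
  simp only [transferOp, transferWeight, LinearMap.sum_apply, map_sum, ← sum_add_distrib]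
  refine sum_congr rfl fun x _ => ?_
  simp only [LinearMap.sub_apply, LinearMap.smul_apply, Module.End.mul_apply, map_sub, map_smul,
    annOp_numOp, annOp_creOp, annOp_annOp w (ζ ^ x.2), map_neg, smul_add]
  abel

theorem amplitude_transferOp (ζ : Fin n → R) (m k : ℕ) {w : Fin k → Fin n → R} {μ : Fin k → R}
    (h : ∀ j, transferWeight ζ m (w j) = μ j • w j) (F : Fock R n) :
    amplitude k w (transferOp ζ m F) = (∑ j, μ j) * amplitude k w F := by
  refine amplitude_apply_of_comm k (fun F => ?_) (fun j F => ?_) F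
  · simp [transferOp, vacuumCoeff_creOp, vacuumCoeff_numOp]
  · rw [annOp_transferOp, h, map_smul, LinearMap.smul_apply]

theorem annOp_one_transferOp (ζ : Fin n → R) (m : ℕ) (F : Fock R n) :
    annOp 1 (transferOp ζ m F) = transferOp ζ m (annOp 1 F) := by
  have : transferWeight ζ m 1 = 0 := by simp [transferWeight, dotProduct]
  rw [annOp_transferOp, this, map_zero, LinearMap.zero_apply, add_zero]

theorem numOp_one_transferOp (ζ : Fin n → R) (m : ℕ) (F : Fock R n) :
    numOp 1 (transferOp ζ m F) = transferOp ζ m (numOp 1 F) := by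
  simp only [transferOp, LinearMap.sum_apply, map_sum]
  refine sum_congr rfl fun x _ => ?_
  simp only [LinearMap.sub_apply, LinearMap.smul_apply, Module.End.mul_apply, map_sub, map_smul,
    numOp_numOp 1, numOp_creOp, annOp_numOp, map_add, one_mul, mul_one]

end Fock

section BaseChange

variable {R S : Type*} [CommRing R] [CommRing S] {n : ℕ} (f : R →+* S)

/-- Base change of the Fock space along a ring homomorphism. -/
def mapFock : Fock R n →ₛₗ[f] Fock S n where
  toFun F J := f (F J)
  map_add' F G := funext fun J => map_add f (F J) (G J)
  map_smul' c F := funext fun J => map_mul f c (F J)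

theorem mapFock_apply (F : Fock R n) (J : Fin n → Fin 2) : mapFock f F J = f (F J) := rfl

theorem mapFock_vacuum : mapFock f (Pi.single 0 1 : Fock R n) = Pi.single 0 1 := by
  funext J
  simp only [mapFock_apply, Pi.single_apply]
  split_ifs <;> simp

theorem mapFock_fockOp (i j : Fin 2) (s : Fin n) (F : Fock R n) :
    mapFock f (fockOp i j s F) = fockOp i j s (mapFock f F) := by
  funext J
  simp only [fockOp_apply, mapFock_apply]
  split_ifs <;> simp

theorem mapFock_weightedOp (i j : Fin 2) (w : Fin n → R) (F : Fock R n) :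
    mapFock f (weightedOp i j w F) = weightedOp i j (f ∘ w) (mapFock f F) := by
  simp [weightedOp_apply, map_sum, mapFock_fockOp]

theorem mapFock_transferOp (ζ : Fin n → R) (m : ℕ) (F : Fock R n) :
    mapFock f (transferOp ζ m F) = transferOp (f ∘ ζ) m (mapFock f F) := by
  have hpow (k : ℕ) : f ∘ (ζ ^ k) = (f ∘ ζ) ^ k := funext fun s => map_pow f (ζ s) k
  simp [transferOp, mapFock_weightedOp, hpow]

theorem mapFock_creationState (k : ℕ) (h : Fin k → Fin n → R) :
    mapFock f (creationState k h) = creationState k fun i => f ∘ h i := by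
  induction k with
  | zero => exact mapFock_vacuum f
  | succ k ih => rw [creationState_succ, mapFock_weightedOp, ih, creationState_succ]

theorem amplitude_mapFock (k : ℕ) (w : Fin k → Fin n → R) (F : Fock R n) :
    amplitude k (fun j => f ∘ w j) (mapFock f F) = f (amplitude k w F) := by
  induction k generalizing F with
  | zero => rw [amplitude_zero, amplitude_zero, mapFock_apply]
  | succ k ih => rw [amplitude_succ, amplitude_succ, ← mapFock_weightedOp, ← ih]

end BaseChange

/-! ### Bethe roots -/

section TransferEigenvalue

variable {R : Type*} [CommRing R] {n : ℕ}

/-- The scalar by which `e₁₂` with weights `betheWeight ζ c` shifts `transferOp ζ m`. -/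
def transferEigenvalue (ζ : Fin n → R) (m : ℕ) (c : R) : R :=
  ∑ x ∈ antidiagonal m, (∑ s, ζ s ^ x.1) * c ^ x.2

theorem transferEigenvalue_zero (ζ : Fin n → R) (c : R) : transferEigenvalue ζ 0 c = n := by
  simp [transferEigenvalue]

theorem transferEigenvalue_succ (ζ : Fin n → R) (m : ℕ) (c : R) :
    transferEigenvalue ζ (m + 1) c = ∑ s, ζ s ^ (m + 1) + c * transferEigenvalue ζ m c := by
  rw [transferEigenvalue, Nat.sum_antidiagonal_succ', pow_zero, mul_one, transferEigenvalue,
    mul_sum]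
  simp only [pow_succ', mul_left_comm c]

theorem det_transferEigenvalue (ζ : Fin n → R) {l : ℕ} (c : Fin l → R) :
    (Matrix.of fun i j : Fin l => transferEigenvalue ζ j (c i)).det =
      (Matrix.vandermonde c).det * n ^ l := by
  let T : Matrix (Fin l) (Fin l) R := .of fun i j =>
    if i ≤ j then ∑ s, ζ s ^ ((j : ℕ) - i) else 0
  have hT : T.det = n ^ l := by
    have htri : T.IsUpperTriangular := fun i j hij => if_neg (not_le.2 hij)
    rw [Matrix.det_of_isUpperTriangular htri]
    simp [T]
  rw [← hT, ← Matrix.det_mul]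
  congr 1
  ext i j
  rw [Matrix.mul_apply, Matrix.of_apply, transferEigenvalue, ← Nat.sum_antidiagonal_swap,
    Nat.sum_antidiagonal_eq_sum_range_succ_mk]
  simp only [T, Matrix.of_apply, Matrix.vandermonde_apply, mul_ite, mul_zero, Fin.le_def]
  rw [Fin.sum_univ_eq_sum_range (fun b => if b ≤ j then c i ^ b * ∑ s, ζ s ^ (j - b) else 0),
    ← sum_filter, show (range l).filter (fun b => b ≤ (j : ℕ)) = range (j + 1) by grind]
  exact sum_congr rfl fun b _ => mul_comm _ _

end TransferEigenvalue

section BetheRoot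

variable {K : Type*} [Field K] {n : ℕ} {ζ : Fin n → K} {c : K}

/-- The weights `w` for which `annOp w` is an eigenvector of the commutator with every transfer
operator. -/
def betheWeight (ζ : Fin n → K) (c : K) : Fin n → K := fun s => (c - ζ s)⁻¹

/-- The Bethe ansatz equation for one root. -/
structure IsBetheRoot (ζ : Fin n → K) (c : K) : Prop where
  ne (s : Fin n) : c ≠ ζ s
  sum_betheWeight : ∑ s, betheWeight ζ c s = 0

theorem isBetheRoot_of_isRoot_derivative (hne : ∀ s, c ≠ ζ s)
    (hroot : (∏ s, (Polynomial.X - Polynomial.C (ζ s))).derivative.IsRoot c) :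
    IsBetheRoot ζ c := by
  refine ⟨hne, ?_⟩
  have heval : (∏ s, (Polynomial.X - Polynomial.C (ζ s))).eval c ≠ 0 := by
    rw [Polynomial.eval_prod]
    exact prod_ne_zero_iff.2 fun s _ => by simpa using sub_ne_zero.2 (hne s)
  have hlog := (Polynomial.Splits.prod fun s _ =>
    Polynomial.Splits.X_sub_C (ζ s)).eval_derivative_div_eval_of_ne_zero heval
  rw [hroot.eq_zero, zero_div] at hlog
  have hroots : (∏ s, (Polynomial.X - Polynomial.C (ζ s))).roots = univ.val.map ζ := by
    rw [← Polynomial.roots_multiset_prod_X_sub_C (univ.val.map ζ), Multiset.map_map]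
    rfl
  rw [hroots, Multiset.map_map] at hlog
  simp only [Function.comp_def, one_div] at hlog
  exact hlog.symm

namespace IsBetheRoot

variable (h : IsBetheRoot ζ c)
include h

theorem betheWeight_mul (s : Fin n) : betheWeight ζ c s * (c - ζ s) = 1 :=
  inv_mul_cancel₀ (sub_ne_zero.2 (h.ne s))

theorem betheWeight_dotProduct_one : betheWeight ζ c ⬝ᵥ (1 : Fin n → K) = 0 := by
  simpa [dotProduct] using h.sum_betheWeight

theorem betheWeight_dotProduct_pow_succ_eq_mul_sub (q : ℕ) :
    betheWeight ζ c ⬝ᵥ ζ ^ (q + 1) = c * (betheWeight ζ c ⬝ᵥ ζ ^ q) - ∑ s, ζ s ^ q := by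
  simp only [dotProduct, mul_sum, ← sum_sub_distrib, Pi.pow_apply]
  refine sum_congr rfl fun s _ => ?_
  linear_combination (-ζ s ^ q) * h.betheWeight_mul s

theorem betheWeight_dotProduct_pow_succ (q : ℕ) :
    betheWeight ζ c ⬝ᵥ ζ ^ (q + 1) = -transferEigenvalue ζ q c := by
  induction q with
  | zero =>
    rw [h.betheWeight_dotProduct_pow_succ_eq_mul_sub, transferEigenvalue_zero, pow_zero,
      h.betheWeight_dotProduct_one]
    simp
  | succ q ih =>
    rw [h.betheWeight_dotProduct_pow_succ_eq_mul_sub, ih, transferEigenvalue_succ]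
    ring

theorem transferWeight_betheWeight (m : ℕ) :
    transferWeight ζ m (betheWeight ζ c) = transferEigenvalue ζ m c • betheWeight ζ c := by
  induction m with
  | zero =>
    simp [transferWeight, transferEigenvalue_zero, dotProduct, h.sum_betheWeight]
  | succ m ih =>
    have hrec : transferWeight ζ (m + 1) (betheWeight ζ c) =
        (∑ s, ζ s ^ (m + 1)) • betheWeight ζ c - (betheWeight ζ c ⬝ᵥ ζ ^ (m + 1)) • 1 +
          ζ * transferWeight ζ m (betheWeight ζ c) := by
      rw [transferWeight, Nat.sum_antidiagonal_succ', transferWeight, mul_sum]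
      simp only [pow_zero, mul_one, pow_succ', mul_sub, mul_smul_comm, mul_left_comm ζ]
    rw [hrec, ih, h.betheWeight_dotProduct_pow_succ, transferEigenvalue_succ]
    funext s
    simp only [Pi.add_apply, Pi.sub_apply, Pi.smul_apply, Pi.mul_apply, Pi.one_apply, smul_eq_mul]
    linear_combination (-transferEigenvalue ζ m c) * h.betheWeight_mul s

end IsBetheRoot

theorem eq_zero_of_forall_sum_mul_transferEigenvalue (hn : (n : K) ≠ 0) {ι : Type*} [Fintype ι]
    {c : ι → K} (hc : Function.Injective c) {g : ι → K}
    (h : ∀ q, ∑ i, g i * transferEigenvalue ζ q (c i) = 0) : g = 0 := by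
  have hprod : PowerSeries.mk (fun q => ∑ s, ζ s ^ q) *
      PowerSeries.mk (fun q => ∑ i, g i * c i ^ q) = 0 := by
    ext q
    rw [PowerSeries.coeff_mul, map_zero, ← h q]
    simp only [PowerSeries.coeff_mk, transferEigenvalue, mul_sum]
    rw [sum_comm]
    exact sum_congr rfl fun _ _ => sum_congr rfl fun _ _ => by ring
  have hp : PowerSeries.mk (fun q => ∑ s, ζ s ^ q) ≠ 0 := fun h0 =>
    hn (by simpa using congrArg (PowerSeries.coeff 0) h0)
  have hpow (q : ℕ) : ∑ i, g i * c i ^ q = 0 := by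
    simpa using congrArg (PowerSeries.coeff q) ((mul_eq_zero.1 hprod).resolve_left hp)
  let ε := (Fintype.equivFin ι).symm
  have hε := Matrix.eq_zero_of_forall_pow_sum_mul_pow_eq_zero (v := g ∘ ε)
    (hc.comp ε.injective) fun q => (ε.sum_comp fun i => g i * c i ^ (q : ℕ)).trans (hpow q)
  exact funext fun i => by simpa using congrFun hε (ε.symm i)

theorem linearIndependent_betheWeight (hn : (n : K) ≠ 0) {ι : Type*} [Finite ι] {c : ι → K}
    (hc : Function.Injective c) (h : ∀ i, IsBetheRoot ζ (c i)) :
    LinearIndependent K (Sum.elim (fun i => betheWeight ζ (c i)) fun _ : Unit => 1) := by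
  cases nonempty_fintype ι
  rw [Fintype.linearIndependent_iff]
  intro g hg
  have hmoment (q : ℕ) : ∑ i, g (Sum.inl i) * (betheWeight ζ (c i) ⬝ᵥ ζ ^ q) +
      g (Sum.inr ()) * ∑ s, ζ s ^ q = 0 := by
    have := congrArg (· ⬝ᵥ ζ ^ q) hg
    simpa only [Fintype.sum_sum_type, univ_unique, sum_singleton, Sum.elim_inl, Sum.elim_inr,
      add_dotProduct, sum_dotProduct, smul_dotProduct, one_dotProduct, zero_dotProduct,
      smul_eq_mul, Pi.pow_apply] using this
  have hone : g (Sum.inr ()) = 0 := by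
    have := hmoment 0
    simpa [dotProduct, (h _).sum_betheWeight, hn] using this
  have hinl : (fun i => g (Sum.inl i)) = 0 := by
    refine eq_zero_of_forall_sum_mul_transferEigenvalue (ζ := ζ) hn hc fun q => ?_
    simpa [hone, (h _).betheWeight_dotProduct_pow_succ] using hmoment (q + 1)
  rintro (i | ⟨⟩)
  · exact congrFun hinl i
  · exact hone

end BetheRoot

/-! ### The transfer series -/

theorem e_supercomm (i j k l : Fin 2) (r s : ℕ) :
    e i j r * e k l s - (-1 : ℂ) ^ (((i : ℕ) + j) * ((k : ℕ) + l)) • (e k l s * e i j r) =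
      (if j = k then e i l (r + s) else 0) -
        (-1 : ℂ) ^ (((i : ℕ) + j) * ((k : ℕ) + l)) • (if i = l then e k j (r + s) else 0) := by
  have h := RingQuot.mkAlgHom_rel ℂ (CurrentRel.supercomm i j k l r s)
  simp only [map_sub, map_mul, map_smul, apply_ite (RingQuot.mkAlgHom ℂ CurrentRel), map_zero] at h
  exact h

theorem e_zero_one_mul_e_one_zero (r s : ℕ) :
    e 0 1 r * e 1 0 s + e 1 0 s * e 0 1 r = e 0 0 (r + s) + e 1 1 (r + s) := by
  have h := e_supercomm 0 1 1 0 r s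
  have hneg (x : CurrentU) : (-1 : ℂ) • x = -x := neg_one_smul ℂ x
  simpa [hneg] using h

theorem commute_e_zero_zero_e_one_one (r s : ℕ) : Commute (e 0 0 r) (e 1 1 s) := by
  have h := e_supercomm 0 0 1 1 r s
  exact sub_eq_zero.1 (by simpa using h)

theorem eSer_eq_X_mul (i j : Fin 2) : eSer i j = PowerSeries.X * PowerSeries.mk (e i j) := by
  ext m
  cases m <;> simp [eSer, PowerSeries.coeff_succ_X_mul]

theorem eSer_mul_eSer (i j k l : Fin 2) :
    eSer i j * eSer k l =
      PowerSeries.X ^ 2 * (PowerSeries.mk (e i j) * PowerSeries.mk (e k l)) := by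
  rw [eSer_eq_X_mul, eSer_eq_X_mul, mul_assoc, ← mul_assoc (PowerSeries.mk _),
    (PowerSeries.commute_X _).eq, sq, mul_assoc, mul_assoc]

theorem commute_eSer_zero_zero_eSer_one_one : Commute (eSer 0 0) (eSer 1 1) := by
  rw [Commute, SemiconjBy, eSer_mul_eSer, eSer_mul_eSer]
  congr 1
  ext m
  rw [PowerSeries.coeff_mul, PowerSeries.coeff_mul, ← Nat.sum_antidiagonal_swap]
  exact sum_congr rfl fun x _ => by
    simpa using (commute_e_zero_zero_e_one_one x.2 x.1).eq

theorem dx_eSer (i j : Fin 2) :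
    dx (eSer i j) =
      -(PowerSeries.X ^ 2 * PowerSeries.mk fun m => ((m + 1 : ℕ) : ℂ) • e i j m) := by
  ext m
  rcases m with _ | _ | m
  · simp [dx]
  · simp [dx, eSer, PowerSeries.coeff_X_pow_mul']
  · simp [dx, eSer, PowerSeries.coeff_X_pow_mul']

theorem eSer_zero_one_mul_eSer_one_zero :
    eSer 0 1 * eSer 1 0 = -(dx (eSer 0 0) + dx (eSer 1 1)) - eSer 1 0 * eSer 0 1 := by
  rw [eq_sub_iff_add_eq, eSer_mul_eSer, eSer_mul_eSer, dx_eSer, dx_eSer, ← neg_add, neg_neg,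
    ← mul_add, ← mul_add]
  congr 1
  ext m
  simp only [map_add, PowerSeries.coeff_mul, PowerSeries.coeff_mk]
  rw [← Nat.sum_antidiagonal_swap (f := fun x => e 1 0 x.1 * e 0 1 x.2), ← sum_add_distrib]
  have h (x) (hx : x ∈ antidiagonal m) :
      e 0 1 x.1 * e 1 0 x.2 + e 1 0 x.swap.1 * e 0 1 x.swap.2 = e 0 0 m + e 1 1 m := by
    simpa [mem_antidiagonal.1 hx] using e_zero_one_mul_e_one_zero x.1 x.2
  rw [sum_congr rfl h, sum_const, Nat.card_antidiagonal, ← smul_add, Nat.cast_smul_eq_nsmul]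

theorem transferSer_eq :
    transferSer = (eSer 0 0 + eSer 1 1) * eSer 1 1 - eSer 1 0 * eSer 0 1 := by
  have identity {E : Type} [AddCommGroup E] [Module ℂ E] (d p q r s : E) :
      (1 / 2 : ℂ) • d + (1 / 2 : ℂ) • (p + q + (q + r)) -
        (1 / 2 : ℂ) • ((1 : ℂ) • p + (-1 : ℂ) • (-d - s) + ((1 : ℂ) • s + (-1 : ℂ) • r)) =
      q + r - s := by
    module
  rw [transferSer, hamSer]
  simp only [Fin.sum_univ_two, Fin.val_zero, Fin.val_one, pow_zero, pow_one, sq, add_mul, mul_add,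
    ← commute_eSer_zero_zero_eSer_one_one.eq, eSer_zero_one_mul_eSer_one_zero]
  exact identity (E := PowerSeries CurrentU) _ _ _ _ _

theorem transferSer_eq_X_pow_mul :
    transferSer = PowerSeries.X ^ 2 * PowerSeries.mk fun m =>
      ∑ x ∈ antidiagonal m, ((e 0 0 x.1 + e 1 1 x.1) * e 1 1 x.2 - e 1 0 x.1 * e 0 1 x.2) := by
  rw [transferSer_eq, add_mul, eSer_mul_eSer, eSer_mul_eSer, eSer_mul_eSer, ← mul_add, ← mul_sub]
  congr 1
  ext m
  simp only [map_sub, map_add, PowerSeries.coeff_mul, PowerSeries.coeff_mk, add_mul,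
    sum_sub_distrib, sum_add_distrib]

theorem coeff_transferSer (m : ℕ) :
    PowerSeries.coeff (m + 2) transferSer =
      ∑ x ∈ antidiagonal m, ((e 0 0 x.1 + e 1 1 x.1) * e 1 1 x.2 - e 1 0 x.1 * e 0 1 x.2) := by
  simp [transferSer_eq_X_pow_mul, PowerSeries.coeff_X_pow_mul']

theorem coeff_transferSer_of_lt {m : ℕ} (hm : m < 2) : PowerSeries.coeff m transferSer = 0 := by
  rw [transferSer_eq_X_pow_mul, PowerSeries.coeff_X_pow_mul', if_neg hm.not_ge]

theorem act_e_apply (n : ℕ) (i j : Fin 2) (r : ℕ) (F : VPoly n) :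
    act n (e i j r) F = weightedOp i j (MvPolynomial.X ^ r) F := by
  rw [act_e]
  rfl

theorem act_e_zero_zero_add_e_one_one (n r : ℕ) (F : VPoly n) :
    act n (e 0 0 r + e 1 1 r) F = MvPolynomial.psum (Fin n) ℂ r • F := by
  rw [map_add, LinearMap.add_apply, act_e_apply, act_e_apply]
  exact LinearMap.congr_fun (weightedOp_zero_zero_add_one_one _) F

theorem act_coeff_transferSer (n m : ℕ) (F : VPoly n) :
    act n (PowerSeries.coeff (m + 2) transferSer) F = transferOp MvPolynomial.X m F := by
  rw [coeff_transferSer, transferOp, map_sum, LinearMap.sum_apply, LinearMap.sum_apply]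
  refine sum_congr rfl fun x _ => ?_
  rw [map_sub, map_mul, map_mul, LinearMap.sub_apply, Module.End.mul_apply, Module.End.mul_apply,
    act_e_zero_zero_add_e_one_one, act_e_apply, act_e_apply, act_e_apply]
  rfl

theorem coeff_dx_mem {S : Subalgebra ℂ CurrentU}
    (h : ∀ m, PowerSeries.coeff m (eSer 0 0 + eSer 1 1) ∈ S) (m : ℕ) :
    PowerSeries.coeff m (dx (eSer 0 0) + dx (eSer 1 1)) ∈ S := by
  cases m with
  | zero => simp [dx]
  | succ k =>
    have hk : PowerSeries.coeff (k + 1) (dx (eSer 0 0) + dx (eSer 1 1)) =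
        -((k : ℂ) • PowerSeries.coeff k (eSer 0 0 + eSer 1 1)) := by
      rw [map_add, map_add, smul_add, neg_add]
      simp only [dx, PowerSeries.coeff_mk]
    exact hk ▸ neg_mem (S.smul_mem (h k) _)

theorem two_smul_hamSer :
    (2 : ℂ) • hamSer = dx (eSer 0 0) + dx (eSer 1 1) + (eSer 0 0 + eSer 1 1) ^ 2 -
      (2 : ℂ) • transferSer := by
  have identity {E : Type} [AddCommGroup E] [Module ℂ E] (d s x : E) :
      (2 : ℂ) • x = d + s - (2 : ℂ) • ((1 / 2 : ℂ) • d + (1 / 2 : ℂ) • s - x) := by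
    module
  exact identity (E := PowerSeries CurrentU) _ _ _

theorem coeff_transferSer_mem_iff {S : Subalgebra ℂ CurrentU}
    (h : ∀ m, PowerSeries.coeff m (eSer 0 0 + eSer 1 1) ∈ S) (m : ℕ) :
    PowerSeries.coeff m transferSer ∈ S ↔ PowerSeries.coeff m ((2 : ℂ) • hamSer) ∈ S := by
  have hsq : PowerSeries.coeff m ((eSer 0 0 + eSer 1 1) ^ 2) ∈ S := by
    rw [sq, PowerSeries.coeff_mul]
    exact sum_mem fun x _ => mul_mem (h _) (h _)
  have hsmul : PowerSeries.coeff m ((2 : ℂ) • transferSer) =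
      (2 : ℂ) • PowerSeries.coeff m transferSer := rfl
  rw [two_smul_hamSer, map_sub, map_add, sub_eq_add_neg,
    add_mem_cancel_left (add_mem (coeff_dx_mem h m) hsq), neg_mem_iff, hsmul]
  exact (S.toSubmodule.smul_mem_iff two_ne_zero).symm

theorem bethe_eq_adjoin :
    bethe = Algebra.adjoin ℂ (Set.range (fun r : ℕ => e 0 0 r + e 1 1 r) ∪
      Set.range fun m : ℕ => PowerSeries.coeff (m + 2) transferSer) := by
  refine le_antisymm (Algebra.adjoin_le ?_) (Algebra.adjoin_le ?_)
  · set S := Algebra.adjoin ℂ (Set.range (fun r : ℕ => e 0 0 r + e 1 1 r) ∪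
      Set.range fun m : ℕ => PowerSeries.coeff (m + 2) transferSer)
    have hdiag (m : ℕ) : PowerSeries.coeff m (eSer 0 0 + eSer 1 1) ∈ S := by
      cases m with
      | zero => simp [eSer]
      | succ r => exact Algebra.subset_adjoin (Or.inl ⟨r, by simp [eSer]⟩)
    rintro _ (⟨m, rfl⟩ | ⟨m, rfl⟩)
    · exact hdiag m
    · refine (coeff_transferSer_mem_iff hdiag m).1 ?_
      rcases Nat.lt_or_ge m 2 with hm | hm
      · exact coeff_transferSer_of_lt hm ▸ zero_mem S
      · exact Algebra.subset_adjoin (Or.inr ⟨m - 2, by simp [Nat.sub_add_cancel hm]⟩)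
  · have hdiag (m : ℕ) : PowerSeries.coeff m (eSer 0 0 + eSer 1 1) ∈ bethe :=
      Algebra.subset_adjoin (Or.inl ⟨m, rfl⟩)
    rintro _ (⟨r, rfl⟩ | ⟨m, rfl⟩)
    · simpa [eSer] using hdiag (r + 1)
    · exact (coeff_transferSer_mem_iff hdiag _).2 (Algebra.subset_adjoin (Or.inr ⟨m + 2, rfl⟩))

/-! ### The action of the symmetric group -/

section Flip

variable {n : ℕ} {a b : Fin n}

theorem parityBelow_of_eq_succ (hab : (b : ℕ) = a + 1) (J : Fin n → Fin 2) :
    parityBelow J b = parityBelow J a + J a := by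
  have : Iio b = insert a (Iio a) := by
    ext k
    simp only [mem_Iio, mem_insert, Fin.lt_def, Fin.ext_iff]
    omega
  rw [parityBelow, this, sum_insert (by simp), add_comm, parityBelow]

theorem parityBelow_comp_swap_left (hab : (b : ℕ) = a + 1) (J : Fin n → Fin 2) :
    parityBelow (J ∘ Equiv.swap a b) a = parityBelow J a := by
  refine sum_congr rfl fun k hk => ?_
  have hk : (k : ℕ) < a := Fin.lt_def.1 (mem_Iio.1 hk)
  rw [Function.comp_apply, Equiv.swap_apply_of_ne_of_ne (Fin.ne_of_val_ne hk.ne)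
    (Fin.ne_of_val_ne (by omega))]

theorem parityBelow_comp_swap_of_ne (hab : (b : ℕ) = a + 1) {s : Fin n} (ha : s ≠ a) (hb : s ≠ b)
    (J : Fin n → Fin 2) : parityBelow (J ∘ Equiv.swap a b) s = parityBelow J s := by
  refine sum_equiv (Equiv.swap a b) (fun k => ?_) (fun k _ => rfl)
  have := Fin.val_ne_of_ne ha
  have := Fin.val_ne_of_ne hb
  simp only [mem_Iio, Fin.lt_def, Equiv.swap_apply_def]
  split_ifs with h₁ h₂ <;> grind

/-- `flipOp` as a map that is semilinear along the exchange of the variables `z_a` and `z_b`. -/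
def flipMap (a b : Fin n) :
    VPoly n →ₛₗ[(MvPolynomial.rename (R := ℂ) (Equiv.swap a b)).toRingHom] VPoly n where
  toFun := flipOp n a b
  map_add' F G := by
    funext J
    simp [flipOp, mul_add]
  map_smul' p F := by
    funext J
    simp [flipOp, mul_left_comm]

theorem flipMap_apply (a b : Fin n) (F : VPoly n) (J : Fin n → Fin 2) :
    flipMap a b F J = (-1) ^ ((J a : ℕ) * J b) *
      MvPolynomial.rename (Equiv.swap a b) (F (J ∘ Equiv.swap a b)) :=
  rfl

theorem mem_VSym_iff {F : VPoly n} :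
    F ∈ VSym n ↔ ∀ a b : Fin n, (b : ℕ) = a + 1 → flipMap a b F = F :=
  Iff.rfl

theorem koszulSign_flip (hab : (b : ℕ) = a + 1) (j : Fin 2) (s : Fin n) (J : Fin n → Fin 2) :
    (-1 : MvPolynomial (Fin n) ℂ) ^ ((J a : ℕ) * J b +
        parityBelow (J ∘ Equiv.swap a b) s * ((J (Equiv.swap a b s) : ℕ) + j)) =
      (-1) ^ (parityBelow J (Equiv.swap a b s) * ((J (Equiv.swap a b s) : ℕ) + j) +
        (Function.update J (Equiv.swap a b s) j a : ℕ) *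
          Function.update J (Equiv.swap a b s) j b) := by
  have hne : a ≠ b := Fin.ne_of_val_ne (by omega)
  rw [neg_one_pow_congr]
  rcases eq_or_ne s a with rfl | hsa
  · simp only [Equiv.swap_apply_left, Function.update_self, Function.update_of_ne hne,
      parityBelow_comp_swap_left hab, parityBelow_of_eq_succ hab J]
    grind
  rcases eq_or_ne s b with rfl | hsb
  · have h := parityBelow_of_eq_succ hab (J ∘ Equiv.swap a s)
    rw [parityBelow_comp_swap_left hab, Function.comp_apply, Equiv.swap_apply_left] at h
    simp only [Equiv.swap_apply_right, Function.update_self, Function.update_of_ne hne.symm, h]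
    grind
  · rw [Equiv.swap_apply_of_ne_of_ne hsa hsb, Function.update_of_ne hsa.symm,
      Function.update_of_ne hsb.symm, parityBelow_comp_swap_of_ne hab hsa hsb, add_comm]

theorem flipMap_fockOp (hab : (b : ℕ) = a + 1) (i j : Fin 2) (s : Fin n) (F : VPoly n) :
    flipMap a b (fockOp i j s F) = fockOp i j (Equiv.swap a b s) (flipMap a b F) := by
  funext J
  have hcomp : Function.update J (Equiv.swap a b s) j ∘ Equiv.swap a b =
      Function.update (J ∘ Equiv.swap a b) s j :=
    Function.update_comp_eq_of_injective _ (Equiv.swap a b).injective s j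
  simp only [flipMap_apply, fockOp_apply, hcomp, Function.comp_apply]
  by_cases hJ : J (Equiv.swap a b s) = i
  · subst hJ
    simp only [if_true, map_mul, map_pow, map_neg, map_one, ← mul_assoc, ← pow_add,
      koszulSign_flip hab]
  · simp [hJ]

theorem flipMap_weightedOp_X_pow (hab : (b : ℕ) = a + 1) (i j : Fin 2) (r : ℕ) (F : VPoly n) :
    flipMap a b (weightedOp i j (MvPolynomial.X ^ r) F) =
      weightedOp i j (MvPolynomial.X ^ r) (flipMap a b F) := by
  simp only [weightedOp_apply, LinearMap.sum_apply, LinearMap.smul_apply, map_sum]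
  refine Fintype.sum_equiv (Equiv.swap a b) _ _ fun s => ?_
  rw [map_smulₛₗ, flipMap_fockOp hab]
  simp

theorem weightedOp_X_pow_mem_VSym (i j : Fin 2) (r : ℕ) {F : VPoly n} (hF : F ∈ VSym n) :
    weightedOp i j (MvPolynomial.X ^ r) F ∈ VSym n :=
  mem_VSym_iff.2 fun a b hab => by
    rw [flipMap_weightedOp_X_pow hab, mem_VSym_iff.1 hF a b hab]

theorem smul_mem_VSym {p : MvPolynomial (Fin n) ℂ} (hp : p.IsSymmetric) {F : VPoly n}
    (hF : F ∈ VSym n) : p • F ∈ VSym n :=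
  mem_VSym_iff.2 fun a b hab => by
    rw [map_smulₛₗ, mem_VSym_iff.1 hF a b hab]
    exact congrArg (· • F) (hp _)

theorem vacuum_mem_VSym : (Pi.single 0 1 : VPoly n) ∈ VSym n :=
  mem_VSym_iff.2 fun a b _ => by
    funext J
    have hJ : J ∘ Equiv.swap a b = 0 ↔ J = 0 :=
      (Equiv.swap a b).surjective.injective_comp_right.eq_iff' rfl
    rw [flipMap_apply]
    by_cases h : J = 0
    · simp [h]
    · simp [Pi.single_eq_of_ne h, Pi.single_eq_of_ne (mt hJ.1 h)]

theorem transferOp_mem_VSym (m : ℕ) {F : VPoly n} (hF : F ∈ VSym n) :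
    transferOp MvPolynomial.X m F ∈ VSym n := by
  rw [transferOp, LinearMap.sum_apply]
  refine sum_mem fun x _ => sub_mem ?_ ?_
  · exact smul_mem_VSym (MvPolynomial.psum_isSymmetric _ _ x.1)
      (weightedOp_X_pow_mem_VSym 1 1 x.2 hF)
  · exact weightedOp_X_pow_mem_VSym 1 0 x.1 (weightedOp_X_pow_mem_VSym 0 1 x.2 hF)

theorem creationState_X_pow_mem_VSym (k : ℕ) (r : Fin k → ℕ) :
    creationState k (fun i => (MvPolynomial.X : Fin n → MvPolynomial (Fin n) ℂ) ^ r i) ∈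
      VSym n := by
  induction k with
  | zero => simpa [creationState] using vacuum_mem_VSym
  | succ k ih =>
    rw [creationState_succ]
    exact weightedOp_X_pow_mem_VSym 1 0 _ (ih _)

theorem amplitude_flipMap (k : ℕ) (hab : (b : ℕ) = a + 1) (F : VPoly n) (t : Fin k → Fin n) :
    amplitude k (fun j => Pi.single (Equiv.swap a b (t j)) 1) (flipMap a b F) =
      MvPolynomial.rename (Equiv.swap a b) (amplitude k (fun j => Pi.single (t j) 1) F) := by
  induction k generalizing F with
  | zero =>
    rw [amplitude_zero, amplitude_zero, flipMap_apply, Pi.zero_comp]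
    simp
  | succ k ih =>
    rw [amplitude_succ, amplitude_succ, annOp_single, annOp_single, ← ih, flipMap_fockOp hab]

theorem rename_amplitude {k : ℕ} {F : VPoly n} (hF : F ∈ VSym n) (π : Equiv.Perm (Fin n))
    (t : Fin k → Fin n) :
    MvPolynomial.rename π (amplitude k (fun j => Pi.single (t j) 1) F) =
      amplitude k (fun j => Pi.single (π (t j)) 1) F := by
  cases n with
  | zero => simp [Subsingleton.elim π 1]
  | succ n =>
    have hπ : π ∈ Submonoid.closure (Set.range fun i : Fin n => Equiv.swap i.castSucc i.succ) :=
      Equiv.Perm.mclosure_swap_castSucc_succ n ▸ Submonoid.mem_top π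
    induction hπ using Submonoid.closure_induction generalizing t with
    | mem x hx =>
      obtain ⟨i, rfl⟩ := hx
      have hi : ((i.succ : Fin (n + 1)) : ℕ) = i.castSucc + 1 := by simp
      rw [← amplitude_flipMap k hi, mem_VSym_iff.1 hF _ _ hi]
    | one => simp
    | mul x y _ _ hx hy =>
      rw [Equiv.Perm.coe_mul, ← MvPolynomial.rename_rename, hy, hx]
      rfl

end Flip

/-! ### Singular vectors -/

section Singular

variable {n l : ℕ}

theorem mem_M_iff {F : VPoly n} :
    F ∈ M n l ↔ F ∈ VSym n ∧ annOp 1 F = 0 ∧ numOp 1 F = (l : ℂ) • F := by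
  have hann : act n (e 0 1 0) F = annOp 1 F := by rw [act_e_apply, pow_zero]
  have hnum : act n (e 1 1 0) F = numOp 1 F := by rw [act_e_apply, pow_zero]
  have hdiag : act n (e 0 0 0) F + act n (e 1 1 0) F = (n : ℂ) • F := by
    rw [← LinearMap.add_apply, ← map_add, act_e_zero_zero_add_e_one_one, MvPolynomial.psum_zero,
      Fintype.card_fin, Nat.cast_smul_eq_nsmul, Nat.cast_smul_eq_nsmul]
  change (F ∈ VSym n ∧ act n (e 0 1 0) F = 0 ∧
    act n (e 0 0 0) F = ((n : ℂ) - l) • F ∧ act n (e 1 1 0) F = (l : ℂ) • F) ↔ _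
  rw [hann, ← hnum]
  refine ⟨fun h => ⟨h.1, h.2.1, h.2.2.2⟩, fun h => ⟨h.1, h.2.1, ?_, h.2.2⟩⟩
  rw [sub_smul, ← h.2.2, eq_sub_iff_add_eq, hdiag]

theorem transferOp_mem_M (m : ℕ) {F : VPoly n} (hF : F ∈ M n l) :
    transferOp MvPolynomial.X m F ∈ M n l := by
  rw [mem_M_iff] at hF ⊢
  exact ⟨transferOp_mem_VSym m hF.1, by rw [annOp_one_transferOp, hF.2.1, map_zero],
    by rw [numOp_one_transferOp, hF.2.2, LinearMap.map_smul_of_tower]⟩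

theorem smul_mem_M {p : MvPolynomial (Fin n) ℂ} (hp : p.IsSymmetric) {F : VPoly n}
    (hF : F ∈ M n l) : p • F ∈ M n l := by
  rw [mem_M_iff] at hF ⊢
  exact ⟨smul_mem_VSym hp hF.1, by rw [map_smul, hF.2.1, smul_zero],
    by rw [map_smul, hF.2.2, smul_comm]⟩

theorem act_mem_M {b : CurrentU} (hb : b ∈ bethe) {v : VPoly n} (hv : v ∈ M n l) :
    act n b v ∈ M n l := by
  rw [bethe_eq_adjoin] at hb
  induction hb using Algebra.adjoin_induction generalizing v with
  | mem x hx =>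
    rcases hx with ⟨r, rfl⟩ | ⟨m, rfl⟩
    · simpa only [act_e_zero_zero_add_e_one_one] using
        smul_mem_M (MvPolynomial.psum_isSymmetric _ _ r) hv
    · simpa only [act_coeff_transferSer] using transferOp_mem_M m hv
  | algebraMap c =>
    rw [AlgHom.commutes]
    exact Submodule.smul_mem _ c hv
  | add x y _ _ hx hy =>
    rw [map_add]
    exact add_mem (hx hv) (hy hv)
  | mul x y _ _ hx hy =>
    rw [map_mul]
    exact hx (hy hv)

theorem uvec_eq (n l : ℕ) :
    uvec n l = annOp 1 (creationState (l + 1) fun i => MvPolynomial.X ^ (i : ℕ)) := by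
  have hcre (L : List ℕ) : act n ((L.map fun r => e 1 0 r).prod) (vplus n) =
      ((L.map fun r => creOp ((MvPolynomial.X : Fin n → MvPolynomial (Fin n) ℂ) ^ r)).prod)
        (vplus n) := by
    induction L with
    | nil => simp
    | cons r L ih =>
      simp only [List.map_cons, List.prod_cons, map_mul, Module.End.mul_apply, ih, act_e_apply]
  rw [uvec, map_mul, Module.End.mul_apply, act_e_apply, hcre, pow_zero, creationState,
    ← List.map_coe_finRange_eq_range, List.map_map, List.ofFn_eq_map]
  rfl

theorem uvec_mem_M (n l : ℕ) : uvec n l ∈ M n l := by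
  rw [mem_M_iff, uvec_eq]
  refine ⟨?_, ?_, ?_⟩
  · rw [← pow_zero MvPolynomial.X]
    exact weightedOp_X_pow_mem_VSym 0 1 0 (creationState_X_pow_mem_VSym _ _)
  · rw [← Module.End.mul_apply, annOp_mul_self, LinearMap.zero_apply]
  · set F := creationState (l + 1) fun i =>
      (MvPolynomial.X : Fin n → MvPolynomial (Fin n) ℂ) ^ (i : ℕ)
    have h : annOp 1 (numOp 1 F) = numOp 1 (annOp 1 F) + annOp 1 F := by
      rw [annOp_numOp, one_mul]
    rw [numOp_one_creationState, map_smul, Nat.cast_succ, add_smul, one_smul,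
      add_left_inj] at h
    rw [← h, Nat.cast_smul_eq_nsmul, Nat.cast_smul_eq_nsmul]

end Singular

/-! ### Polynomials with symmetric coefficients -/

section Substitution

open MvPolynomial

/-- The ring `ℂ[σ₁, …, σₙ]`, whose `j`-th variable stands for the elementary symmetric polynomial
`σ_{j+1}` in `z₁, …, zₙ`. -/
abbrev SymRing (n : ℕ) : Type := MvPolynomial (Fin n) ℂ

/-- The embedding of `SymRing n` in `ℂ[z₁, …, zₙ]` as the ring of symmetric polynomials. -/
def symToPoly (n : ℕ) : SymRing n →ₐ[ℂ] MvPolynomial (Fin n) ℂ :=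
  aeval fun j : Fin n => esymm (Fin n) ℂ (j + 1)

/-- Substitution of `z_{t 1}, …, z_{t l}` for the variables of a polynomial whose coefficients are
symmetric polynomials in `z₁, …, zₙ`. -/
def substAt {n l : ℕ} (t : Fin l → Fin n) :
    MvPolynomial (Fin l) (SymRing n) →ₐ[ℂ] MvPolynomial (Fin n) ℂ :=
  aevalTower (symToPoly n) fun i => X (t i)

variable {n l : ℕ}

theorem exists_symToPoly_eq {p : MvPolynomial (Fin n) ℂ} (hp : p.IsSymmetric) :
    ∃ a, symToPoly n a = p := by
  obtain ⟨a, ha⟩ := esymmAlgHom_surjective ℂ (Fintype.card_fin n).le ⟨p, hp⟩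
  exact ⟨a, by rw [symToPoly, ← esymmAlgHom_apply, ha]⟩

theorem rename_symToPoly (π : Equiv.Perm (Fin n)) (a : SymRing n) :
    rename π (symToPoly n a) = symToPoly n a := by
  have : (rename π).comp (symToPoly n) = symToPoly n :=
    algHom_ext fun i => by simp [symToPoly, rename_esymm]
  exact DFunLike.congr_fun this a

@[simp]
theorem substAt_C (t : Fin l → Fin n) (a : SymRing n) : substAt t (C a) = symToPoly n a :=
  aevalTower_C ..

@[simp]
theorem substAt_X (t : Fin l → Fin n) (i : Fin l) : substAt t (X i) = X (t i) :=
  aevalTower_X ..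

theorem substAt_rename (t : Fin l → Fin n) (σ : Equiv.Perm (Fin l))
    (P : MvPolynomial (Fin l) (SymRing n)) : substAt t (rename σ P) = substAt (t ∘ σ) P := by
  induction P using MvPolynomial.induction_on <;> simp_all

theorem rename_substAt (t : Fin l → Fin n) (π : Equiv.Perm (Fin n))
    (P : MvPolynomial (Fin l) (SymRing n)) : rename π (substAt t P) = substAt (π ∘ t) P := by
  induction P using MvPolynomial.induction_on <;> simp_all [rename_symToPoly]

theorem IsAlternating.substAt_eq_zero {P : MvPolynomial (Fin l) (SymRing n)}
    (hP : IsAlternating P) {t : Fin l → Fin n} (ht : ¬ Function.Injective t) :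
    substAt t P = 0 := by
  obtain ⟨i, j, hij, hne⟩ : ∃ i j, t i = t j ∧ i ≠ j := by
    simpa [Function.Injective] using ht
  have hswap : t ∘ Equiv.swap i j = t := by
    funext k
    grind
  have h := congrArg (substAt t) (hP (Equiv.swap i j))
  rw [substAt_rename, hswap, Equiv.Perm.sign_swap hne, Units.smul_def] at h
  simpa [eq_neg_iff_add_eq_zero, ← two_mul] using h

variable {F : VPoly n}

theorem exists_substAt_eq_amplitude (hl : l ≤ n) (hF : F ∈ VSym n) :
    ∃ P : MvPolynomial (Fin l) (SymRing n), ∀ t : Fin l → Fin n, Function.Injective t →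
      substAt t P = amplitude l (fun j => Pi.single (t j) 1) F := by
  let t₀ : Fin l → Fin n := Fin.castLE hl
  have hmem : amplitude l (fun j => Pi.single (t₀ j) 1) F ∈ (substAt t₀).range := by
    refine mem_of_rename_eq_of_fixing (Set.range t₀) _ ?_ (fun k => ?_) fun π hπ => ?_
    · rintro _ ⟨i, rfl⟩
      exact ⟨X i, substAt_X t₀ i⟩
    · obtain ⟨a, ha⟩ := exists_symToPoly_eq (psum_isSymmetric (Fin n) ℂ k)
      exact ⟨C a, (substAt_C t₀ a).trans ha⟩
    · simp only [rename_amplitude hF, hπ _ (Set.mem_range_self _)]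
  obtain ⟨P, hP⟩ := hmem
  refine ⟨P, fun t ht => ?_⟩
  have := Equiv.Perm.isMultiplyPretransitive (Fin n) l
  obtain ⟨π, hπ⟩ := MulAction.exists_smul_eq (Equiv.Perm (Fin n))
    (Fin.castLEEmb hl : Fin l ↪ Fin n) ⟨t, ht⟩
  have hπt (j : Fin l) : π (t₀ j) = t j := congrArg (fun f => f j) hπ
  rw [← funext hπt]
  change substAt (π ∘ t₀) P = _
  rw [← rename_substAt]
  exact (congrArg (rename π) hP).trans (rename_amplitude hF π t₀)

theorem exists_isAlternating_substAt_eq_amplitude (hl : l ≤ n) (hF : F ∈ VSym n) :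
    ∃ P : MvPolynomial (Fin l) (SymRing n), IsAlternating P ∧
      ∀ t : Fin l → Fin n, substAt t P = amplitude l (fun j => Pi.single (t j) 1) F := by
  obtain ⟨P, hP⟩ := exists_substAt_eq_amplitude hl hF
  have halt := (isAlternating_alternization P).C_mul (C (l.factorial : ℂ)⁻¹)
  refine ⟨_, halt, fun t => ?_⟩
  by_cases ht : Function.Injective t
  · have hterm (σ : Equiv.Perm (Fin l)) : substAt t (Equiv.Perm.sign σ • rename σ P) =
        amplitude l (fun j => Pi.single (t j) 1) F := by
      rw [Units.smul_def, map_zsmul, substAt_rename, hP _ (ht.comp σ.injective)]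
      have h := DFunLike.congr_fun ((amplitude l).map_perm
        (fun j => (Pi.single (t j) 1 : Fin n → MvPolynomial (Fin n) ℂ)) σ) F
      simp only [Function.comp_def] at h ⊢
      rw [h, Units.smul_def, LinearMap.smul_apply, smul_smul, ← Units.val_mul,
        Int.units_mul_self, Units.val_one, one_smul]
    rw [map_mul, substAt_C, alternization, map_sum, sum_congr rfl fun σ _ => hterm σ, sum_const,
      card_univ, Fintype.card_perm, Fintype.card_fin, nsmul_eq_mul, ← mul_assoc,
      symToPoly, aeval_C, algebraMap_eq, ← map_natCast C, ← map_mul,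
      inv_mul_cancel₀ (Nat.cast_ne_zero.2 l.factorial_ne_zero), map_one, one_mul]
  · rw [halt.substAt_eq_zero ht]
    obtain ⟨i, j, hij, hne⟩ : ∃ i j, t i = t j ∧ i ≠ j := by
      simpa [Function.Injective] using ht
    rw [(amplitude l).map_eq_zero_of_eq _ (congrArg (Pi.single · 1) hij) hne,
      LinearMap.zero_apply]

end Substitution

/-! ### Central elements -/

theorem e_zero_zero_add_e_one_one_mem_center (r : ℕ) :
    e 0 0 r + e 1 1 r ∈ Subalgebra.center ℂ CurrentU := by
  have hgen (i j : Fin 2) (s : ℕ) : Commute (e i j s) (e 0 0 r + e 1 1 r) := by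
    have hadd : e i j s * e 0 0 r - e 0 0 r * e i j s +
        (e i j s * e 1 1 r - e 1 1 r * e i j s) =
        ((if j = 0 then e i 0 (s + r) else 0) - (if i = 0 then e 0 j (s + r) else 0)) +
          ((if j = 1 then e i 1 (s + r) else 0) - (if i = 1 then e 1 j (s + r) else 0)) := by
      have h0 := e_supercomm i j 0 0 s r
      have h1 := e_supercomm i j 1 1 s r
      simpa only [Fin.val_zero, Fin.val_one, add_zero, mul_zero, pow_zero, one_smul,
        one_add_one_eq_two, pow_mul', neg_one_sq, one_pow] using congrArg₂ (· + ·) h0 h1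
    rw [commute_iff_eq, ← sub_eq_zero, mul_add, add_mul, add_sub_add_comm, hadd]
    fin_cases i <;> fin_cases j <;> simp
  rw [Subalgebra.mem_center_iff]
  intro b
  obtain ⟨b, rfl⟩ := RingQuot.mkAlgHom_surjective ℂ CurrentRel b
  induction b using FreeAlgebra.induction with
  | grade0 c => rw [AlgHom.commutes, Algebra.commutes]
  | grade1 x => exact hgen x.1 x.2.1 x.2.2
  | mul a b ha hb => rw [map_mul, mul_assoc, hb, ← mul_assoc, ha, mul_assoc]
  | add a b ha hb => rw [map_add, add_mul, ha, hb, ← mul_add]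

/-- The polynomials whose multiplication operator on `VPoly n` is the action of a central element
of the Bethe algebra. -/
def centralMultipliers (n : ℕ) : Subalgebra ℂ (MvPolynomial (Fin n) ℂ) where
  carrier := {p | ∃ c ∈ Subalgebra.center ℂ CurrentU ⊓ bethe, ∀ F : VPoly n, act n c F = p • F}
  mul_mem' := by
    rintro p q ⟨c, hc, hp⟩ ⟨d, hd, hq⟩
    refine ⟨c * d, mul_mem hc hd, fun F => ?_⟩
    rw [map_mul, Module.End.mul_apply, hq, hp, smul_smul]
  add_mem' := by
    rintro p q ⟨c, hc, hp⟩ ⟨d, hd, hq⟩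
    refine ⟨c + d, add_mem hc hd, fun F => ?_⟩
    rw [map_add, LinearMap.add_apply, hq, hp, add_smul]
  algebraMap_mem' a := ⟨algebraMap ℂ _ a, Subalgebra.algebraMap_mem _ a, fun F => by
    rw [AlgHom.commutes, Module.algebraMap_end_apply, algebraMap_smul]⟩

theorem exists_isCentralLift (n : ℕ) :
    ∃ C : ℕ → CurrentU, IsCentralLift n C ∧ ∀ j, C j ∈ bethe := by
  have hpsum (k : ℕ) : MvPolynomial.psum (Fin n) ℂ k ∈ centralMultipliers n := by
    refine ⟨e 0 0 k + e 1 1 k, ⟨e_zero_zero_add_e_one_one_mem_center k, ?_⟩,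
      act_e_zero_zero_add_e_one_one n k⟩
    rw [bethe_eq_adjoin]
    exact Algebra.subset_adjoin (Or.inl ⟨k, rfl⟩)
  choose C hC hact using fun k => esymm_mem_of_psum_mem (centralMultipliers n) hpsum k
  exact ⟨C, fun j _ _ => ⟨(hC j).1, fun v _ => hact j v⟩, fun j => (hC j).2⟩

/-! ### The algebra `𝓞_l` and its generators -/

section Coordinates

open Polynomial

/-- The reversal `1 + f₁ x + ⋯ + f_l x ^ l` of `fPoly n l`. -/
def fRev (n l : ℕ) : (O n l)[X] := unitPoly fun i : Fin l => MvPolynomial.X (Sum.inl i)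

/-- The reversal `1 + g₁ x + ⋯ + g_{n-l-1} x ^ (n - l - 1)` of `gPoly n l`. -/
def gRev (n l : ℕ) : (O n l)[X] :=
  unitPoly fun j : Fin (n - l - 1) => MvPolynomial.X (Sum.inr (Sum.inl j))

variable {n l : ℕ}

theorem SigmaO_eq {j : ℕ} (hl : l < n) (hj : j < n) :
    SigmaO n l j = ((-1 : ℂ) ^ j / (n - j) * n) • (fRev n l * gRev n l).coeff j := by
  rw [SigmaO, if_neg hj.ne, mul_assoc, coeff_C_mul, mul_smul, Nat.cast_smul_eq_nsmul,
    nsmul_eq_mul, fRev, gRev, ← coeff_monicPoly_mul _ _ (by omega),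
    show l + (n - l - 1) - j = n - 1 - j by omega]
  rfl

theorem SigmaO_self : SigmaO n l n = MvPolynomial.X (Sum.inr (Sum.inr ())) := if_pos rfl

theorem GO_eq {i : ℕ} (hl : l < n) (hi : i + 2 ≤ n) :
    GO n l i = (n : ℂ) • (eulerOp l (fRev n l) * gRev n l).coeff i := by
  rw [GO, mul_assoc, coeff_C_mul, Nat.cast_smul_eq_nsmul, nsmul_eq_mul, fRev, gRev,
    ← coeff_derivative_monicPoly_mul _ _ (by omega),
    show l + (n - l - 1) - 1 - i = n - 2 - i by omega]
  rfl

theorem coeff_fRev_zero : (fRev n l).coeff 0 = 1 := coeff_unitPoly_zero _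

theorem coeff_gRev_zero : (gRev n l).coeff 0 = 1 := coeff_unitPoly_zero _

theorem coeff_fRev_succ (i : Fin l) :
    (fRev n l).coeff (i + 1) = MvPolynomial.X (Sum.inl i) :=
  coeff_unitPoly_succ _ i

theorem coeff_gRev_succ (j : Fin (n - l - 1)) :
    (gRev n l).coeff (j + 1) = MvPolynomial.X (Sum.inr (Sum.inl j)) :=
  coeff_unitPoly_succ _ j

/-- The generic polynomial `Q(x) = x ^ n - Σ₁ x ^ (n - 1) + ⋯ + (-1) ^ n Σ_n`. -/
def qPoly (n l : ℕ) : (O n l)[X] :=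
  monicPoly fun j : Fin n => (-1) ^ ((j : ℕ) + 1) * SigmaO n l (j + 1)

/-- The reversal of `qPoly n l`. -/
def qRev (n l : ℕ) : (O n l)[X] :=
  unitPoly fun j : Fin n => (-1) ^ ((j : ℕ) + 1) * SigmaO n l (j + 1)

/-- The reversed form of `Q' = n f g`. -/
theorem eulerOp_qRev (hl : l < n) :
    eulerOp n (qRev n l) = C (n : O n l) * (fRev n l * gRev n l) := by
  ext k
  rw [coeff_eulerOp, coeff_C_mul]
  rcases k with _ | k
  · simp [qRev, coeff_unitPoly_zero, mul_coeff_zero, coeff_fRev_zero, coeff_gRev_zero]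
  rcases Nat.lt_or_ge (k + 1) n with hkn | hnk
  · have hne : (n : ℂ) - (k + 1 : ℕ) ≠ 0 := sub_ne_zero.2 (by exact_mod_cast hkn.ne')
    have hsign : ((-1 : ℂ) ^ (k + 1)) ^ 2 = 1 := by rw [pow_right_comm]; simp
    have hcoeff := coeff_unitPoly_succ (fun j : Fin n => (-1) ^ ((j : ℕ) + 1) * SigmaO n l (j + 1))
      ⟨k, by omega⟩
    have hcast : ((n : O n l) - (k + 1 : ℕ)) * (-1) ^ (k + 1) =
        algebraMap ℂ (O n l) ((n - (k + 1 : ℕ)) * (-1) ^ (k + 1)) := by simp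
    rw [qRev, hcoeff, SigmaO_eq hl hkn, ← mul_assoc, hcast, ← Algebra.smul_def, smul_smul,
      ← map_natCast (algebraMap ℂ (O n l)), ← Algebra.smul_def]
    congr 1
    field_simp
    rw [hsign, mul_one]
  · have hdeg : (fRev n l * gRev n l).natDegree ≤ l + (n - l - 1) :=
      natDegree_mul_le_of_le (natDegree_unitPoly_le _) (natDegree_unitPoly_le _)
    rw [coeff_eq_zero_of_natDegree_lt (hdeg.trans_lt (by omega)), mul_zero]
    rcases hnk.eq_or_lt with rfl | hnk
    · rw [sub_self, zero_mul]
    · rw [qRev, coeff_unitPoly_of_lt _ hnk, mul_zero]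

end Coordinates

section Generators

open Polynomial

variable {S : Type*} [CommRing S] [Algebra ℂ S] (A : ℕ → Submodule ℂ S) [SetLike.GradedMonoid A]
  {f g : S[X]} {i : ℕ}

theorem sum_smul_coeff_mul_mem_iff (hf : f.coeff 0 = 1) (hg : g.coeff 0 = 1) (hi : 0 < i)
    (h : ∀ p < i, f.coeff p ∈ A p ∧ g.coeff p ∈ A p) (c : ℕ → ℂ) :
    ∑ x ∈ antidiagonal i, c x.1 • (f.coeff x.1 * g.coeff x.2) ∈ A i ↔
      c i • f.coeff i + c 0 • g.coeff i ∈ A i := by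
  have hright : ((0, i) : ℕ × ℕ) ∈ (antidiagonal i).erase (i, 0) := by simp [hi.ne]
  rw [← add_sum_erase _ _ (show (i, 0) ∈ antidiagonal i by simp), ← add_sum_erase _ _ hright,
    ← add_assoc]
  simp only [hf, hg, mul_one, one_mul]
  refine add_mem_cancel_right (Submodule.sum_mem _ fun x hx => Submodule.smul_mem _ _ ?_)
  obtain ⟨p, q⟩ := x
  obtain ⟨hq, hp, rfl⟩ : p ≠ 0 ∧ q ≠ 0 ∧ p + q = i := by
    simp only [mem_erase, HasAntidiagonal.mem_antidiagonal, ne_eq, Prod.mk.injEq] at hx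
    grind
  exact SetLike.GradedMul.mul_mem (h p (by omega)).1 (h q (by omega)).2

theorem coeff_mul_mem_iff (hf : f.coeff 0 = 1) (hg : g.coeff 0 = 1) (hi : 0 < i)
    (h : ∀ p < i, f.coeff p ∈ A p ∧ g.coeff p ∈ A p) :
    (f * g).coeff i ∈ A i ↔ f.coeff i + g.coeff i ∈ A i := by
  simpa [coeff_mul] using sum_smul_coeff_mul_mem_iff A hf hg hi h 1

theorem coeff_eulerOp_mul_mem_iff (hf : f.coeff 0 = 1) (hg : g.coeff 0 = 1) (hi : 0 < i)
    (h : ∀ p < i, f.coeff p ∈ A p ∧ g.coeff p ∈ A p) (l : ℕ) :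
    (eulerOp l f * g).coeff i ∈ A i ↔ ((l : ℂ) - i) • f.coeff i + (l : ℂ) • g.coeff i ∈ A i := by
  have hsum : (eulerOp l f * g).coeff i =
      ∑ x ∈ antidiagonal i, ((l : ℂ) - x.1) • (f.coeff x.1 * g.coeff x.2) := by
    rw [coeff_mul]
    refine sum_congr rfl fun x _ => ?_
    rw [coeff_eulerOp, Algebra.smul_def, map_sub, map_natCast, map_natCast, mul_assoc]
  simpa [hsum] using sum_smul_coeff_mul_mem_iff A hf hg hi h fun p => (l : ℂ) - p

end Generators

section Coordinates

variable {n l : ℕ} (A : ℕ → Submodule ℂ (O n l)) [SetLike.GradedMonoid A]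

theorem coeff_fRev_mem_and_coeff_gRev_mem (hl : l < n)
    (hG : ∀ i, 1 ≤ i → i + 2 ≤ n → GO n l i ∈ A i)
    (hS : ∀ j, 1 ≤ j → j < n → SigmaO n l j ∈ A j) (i : ℕ) :
    (fRev n l).coeff i ∈ A i ∧ (gRev n l).coeff i ∈ A i := by
  have hn : (n : ℂ) ≠ 0 := Nat.cast_ne_zero.2 (by omega)
  induction i using Nat.strong_induction_on with
  | _ i ih =>
  rcases Nat.eq_zero_or_pos i with rfl | hi
  · rw [coeff_fRev_zero, coeff_gRev_zero]
    exact ⟨SetLike.GradedOne.one_mem, SetLike.GradedOne.one_mem⟩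
  rcases Nat.lt_or_ge i n with hin | hin
  swap
  · rw [fRev, gRev, coeff_unitPoly_of_lt _ (by omega), coeff_unitPoly_of_lt _ (by omega)]
    exact ⟨zero_mem _, zero_mem _⟩
  have hsum : (fRev n l).coeff i + (gRev n l).coeff i ∈ A i := by
    have hne : (-1 : ℂ) ^ i / (n - i) * n ≠ 0 :=
      mul_ne_zero (div_ne_zero (by simp) (sub_ne_zero.2 (by exact_mod_cast hin.ne'))) hn
    rw [← coeff_mul_mem_iff A coeff_fRev_zero coeff_gRev_zero hi ih,
      ← Submodule.smul_mem_iff _ hne, ← SigmaO_eq hl hin]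
    exact hS i hi hin
  suffices hf : (fRev n l).coeff i ∈ A i from ⟨hf, by simpa using sub_mem hsum hf⟩
  rcases Nat.lt_or_ge (i + 1) n with hin' | hin'
  · -- `l (f_i + g_i) - ((l - i) f_i + l g_i) = i f_i`
    have hdiff := hG i hi hin'
    rw [GO_eq hl hin', Submodule.smul_mem_iff _ hn,
      coeff_eulerOp_mul_mem_iff A coeff_fRev_zero coeff_gRev_zero hi ih] at hdiff
    rw [← Submodule.smul_mem_iff _ (Nat.cast_ne_zero.2 hi.ne' : (i : ℂ) ≠ 0)]
    convert sub_mem (Submodule.smul_mem _ (l : ℂ) hsum) hdiff using 1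
    module
  · rcases Nat.lt_or_ge l i with hli | hli
    · rw [fRev, coeff_unitPoly_of_lt _ hli]
      exact zero_mem _
    · rwa [gRev, coeff_unitPoly_of_lt _ (by omega), add_zero] at hsum

theorem mem_of_generators (hl : l < n)
    (hG : ∀ i, 1 ≤ i → i + 2 ≤ n → GO n l i ∈ A i)
    (hS : ∀ j, 1 ≤ j → j ≤ n → SigmaO n l j ∈ A j)
    {d : ℕ} {F : O n l} (hF : MvPolynomial.IsWeightedHomogeneous (OWeight n l) F d) :
    F ∈ A d := by
  have hfg := coeff_fRev_mem_and_coeff_gRev_mem A hl hG fun j hj hjn => hS j hj hjn.le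
  refine mem_of_isWeightedHomogeneous A ?_ hF
  rintro (i | j | ⟨⟩)
  · exact coeff_fRev_succ (n := n) i ▸ (hfg (i + 1)).1
  · exact coeff_gRev_succ j ▸ (hfg (j + 1)).2
  · exact SigmaO_self (n := n) (l := l) ▸ hS n (by omega) le_rfl

end Coordinates

section RootRing

open Polynomial

/-- The index set of the roots of `f` and `g`. -/
abbrev RootIdx (n l : ℕ) : Type := Fin l ⊕ Fin (n - l - 1)

/-- The polynomial ring in the roots of `f`, the roots of `g`, and `Σ_n`. -/
abbrev RootRing (n l : ℕ) : Type := MvPolynomial (RootIdx n l ⊕ Unit) ℂ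

/-- The generic roots of `f` and `g`. -/
def rootVar (n l : ℕ) (i : RootIdx n l) : RootRing n l := MvPolynomial.X (Sum.inl i)

/-- The embedding of `𝓞_l` in the ring of roots for which `f` and `g` are the products of the linear
factors with the roots `rootVar n l`. -/
def rootHom (n l : ℕ) : O n l →ₐ[ℂ] RootRing n l :=
  MvPolynomial.aeval (Sum.elim
    (fun i : Fin l => (revProd fun k : Fin l => rootVar n l (Sum.inl k)).coeff (i + 1))
    (Sum.elim (fun j : Fin (n - l - 1) =>
      (revProd fun k : Fin (n - l - 1) => rootVar n l (Sum.inr k)).coeff (j + 1))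
      fun _ => MvPolynomial.X (Sum.inr ())))

/-- The homomorphism `σ_j ↦ Σ_j`. -/
def symRingToO (n l : ℕ) : SymRing n →ₐ[ℂ] O n l :=
  MvPolynomial.aeval fun j : Fin n => SigmaO n l (j + 1)

/-- The composition of `ℂ[z]^𝔖 → 𝓞_l` with the embedding of `𝓞_l` in the ring of roots. -/
def symToRoot (n l : ℕ) : SymRing n →ₐ[ℂ] RootRing n l :=
  (rootHom n l).comp (symRingToO n l)

variable {n l : ℕ}

theorem map_rootHom_fRev : (fRev n l).map (rootHom n l).toRingHom =
    revProd fun k : Fin l => rootVar n l (Sum.inl k) := by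
  rw [fRev, map_unitPoly, ← unitPoly_coeff_revProd (Fintype.card_fin l)]
  exact congrArg unitPoly (funext fun i => MvPolynomial.aeval_X _ _)

theorem map_rootHom_gRev : (gRev n l).map (rootHom n l).toRingHom =
    revProd fun k : Fin (n - l - 1) => rootVar n l (Sum.inr k) := by
  rw [gRev, map_unitPoly, ← unitPoly_coeff_revProd (Fintype.card_fin (n - l - 1))]
  exact congrArg unitPoly (funext fun j => MvPolynomial.aeval_X _ _)

theorem map_rootHom_fRev_mul_gRev :
    (fRev n l * gRev n l).map (rootHom n l).toRingHom = revProd (rootVar n l) := by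
  rw [Polynomial.map_mul, map_rootHom_fRev, map_rootHom_gRev, revProd_sumElim]

theorem symToRoot_X (j : Fin n) :
    symToRoot n l (MvPolynomial.X j) = rootHom n l (SigmaO n l (j + 1)) := by
  simp [symToRoot, symRingToO]

theorem rootHom_SigmaO {j : ℕ} (hl : l < n) (hj : j < n) :
    rootHom n l (SigmaO n l j) =
      ((-1 : ℂ) ^ j / (n - j) * n) • (revProd (rootVar n l)).coeff j := by
  rw [SigmaO_eq hl hj, map_smul, ← map_rootHom_fRev_mul_gRev, coeff_map]
  rfl

theorem rootHom_SigmaO_self : rootHom n l (SigmaO n l n) = MvPolynomial.X (Sum.inr ()) := by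
  simp [SigmaO_self, rootHom]

theorem symToRoot_X_last (hn : 0 < n) :
    symToRoot n l (MvPolynomial.X ⟨n - 1, Nat.sub_one_lt_of_lt hn⟩) =
      MvPolynomial.X (Sum.inr ()) := by
  rw [symToRoot_X, ← rootHom_SigmaO_self (n := n), Nat.sub_add_cancel hn]

theorem card_rootIdx (hl : l < n) : Fintype.card (RootIdx n l) = n - 1 := by
  simp; omega

theorem coeff_revProd_rootVar (hl : l < n) (j : Fin (n - 1)) :
    (revProd (rootVar n l)).coeff (j + 1) = symToRoot n l
      (((-1 : ℂ) ^ ((j : ℕ) + 1) * ((n : ℂ) - ((j : ℕ) + 1 : ℕ)) / n) •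
        MvPolynomial.X (j.castLE (Nat.sub_le n 1))) := by
  have hn : (n : ℂ) ≠ 0 := Nat.cast_ne_zero.2 (by omega)
  have hnj : (n : ℂ) - ((j : ℕ) + 1 : ℕ) ≠ 0 :=
    sub_ne_zero.2 (by exact_mod_cast (by omega : n ≠ j + 1))
  have hsign : ((-1 : ℂ) ^ ((j : ℕ) + 1)) ^ 2 = 1 := by rw [pow_right_comm]; simp
  rw [map_smul, symToRoot_X, Fin.val_castLE, rootHom_SigmaO hl (by omega), smul_smul]
  field_simp
  rw [hsign, one_smul]

theorem isIntegralElem_symToRoot (hl : l < n) (i : RootIdx n l ⊕ Unit) :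
    (symToRoot n l).toRingHom.IsIntegralElem (MvPolynomial.X i) := by
  rcases i with i | ⟨⟩
  · refine ⟨monicPoly fun j : Fin (n - 1) =>
      ((-1 : ℂ) ^ ((j : ℕ) + 1) * ((n : ℂ) - ((j : ℕ) + 1 : ℕ)) / n) •
        MvPolynomial.X (j.castLE (Nat.sub_le n 1)), monic_monicPoly _, ?_⟩
    rw [← eval_map, map_monicPoly, (unitPoly_eq_revProd_iff (card_rootIdx hl) (rootVar n l) _).1]
    · rw [eval_prod]
      exact prod_eq_zero (mem_univ i) (by simp [rootVar])
    · rw [← unitPoly_coeff_revProd (card_rootIdx hl)]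
      exact congrArg unitPoly (funext fun j => (coeff_revProd_rootVar hl j).symm)
  · have hlast := symToRoot_X_last (l := l) (Nat.zero_lt_of_lt hl)
    exact ⟨_, monic_X_sub_C (MvPolynomial.X ⟨n - 1, by omega⟩),
      by simp [← hlast]⟩

theorem symToRoot_injective (hl : l < n) : Function.Injective (symToRoot n l) :=
  injective_of_isIntegralElem (by simp; omega) _ (isIntegralElem_symToRoot hl)

theorem rootHom_injective (hl : l < n) : Function.Injective (rootHom n l) := by
  refine injective_of_isIntegralElem (by simp; omega) _ fun i => ?_
  obtain ⟨p, hp, h0⟩ := isIntegralElem_symToRoot hl i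
  exact ⟨p.map (symRingToO n l).toRingHom, hp.map _, (eval₂_map ..).trans h0⟩

theorem rename_symToRoot (hl : l < n) (π : Equiv.Perm (RootIdx n l)) (a : SymRing n) :
    MvPolynomial.rename (Sum.map π id) (symToRoot n l a) = symToRoot n l a := by
  have hrev : (revProd (rootVar n l)).map
      (MvPolynomial.rename (Sum.map π id) : RootRing n l →ₐ[ℂ] RootRing n l).toRingHom =
      revProd (rootVar n l) := by
    rw [map_revProd]
    exact Fintype.prod_equiv π _ _ fun i => by simp [rootVar]
  have hcomp : (MvPolynomial.rename (Sum.map π id)).comp (symToRoot n l) = symToRoot n l := by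
    refine MvPolynomial.algHom_ext fun j => ?_
    rw [AlgHom.comp_apply, symToRoot_X]
    rcases (show (j : ℕ) + 1 ≤ n from j.isLt).lt_or_eq with hj | hj
    · rw [rootHom_SigmaO hl hj, map_smul]
      conv_rhs => rw [← hrev, coeff_map]
      rfl
    · rw [hj, rootHom_SigmaO_self]
      simp
  exact DFunLike.congr_fun hcomp a

end RootRing

section BetheRoots

open Polynomial

/-- A field `K` that contains the generic roots of `f` and `g`, and in which `Q` splits. -/
structure BetheRoots (n l : ℕ) (K : Type*) [Field K] [Algebra ℂ K] where
  /-- The embedding of the ring of roots of `f` and `g`. -/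
  embed : RootRing n l →ₐ[ℂ] K
  embed_injective : Function.Injective embed
  /-- The roots of `Q`. -/
  ζ : Fin n → K
  map_qRev : (qRev n l).map (embed.comp (rootHom n l)).toRingHom = revProd ζ

theorem exists_betheRoots (n l : ℕ) :
    ∃ (K : Type) (_ : Field K) (_ : Algebra ℂ K), Nonempty (BetheRoots n l K) := by
  let K := AlgebraicClosure (FractionRing (RootRing n l))
  let φ : RootRing n l →ₐ[ℂ] K := IsScalarTower.toAlgHom ℂ (RootRing n l) K
  have hφ : Function.Injective φ :=
    (algebraMap (FractionRing (RootRing n l)) K).injective.comp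
      (IsFractionRing.injective (RootRing n l) (FractionRing (RootRing n l)))
  obtain ⟨ζ, hζ⟩ := exists_unitPoly_eq_revProd fun j : Fin n =>
    φ (rootHom n l ((-1) ^ ((j : ℕ) + 1) * SigmaO n l (j + 1)))
  exact ⟨K, inferInstance, inferInstance, ⟨⟨φ, hφ, ζ, (map_unitPoly _ _).trans hζ⟩⟩⟩

end BetheRoots

/-! ### Specialization at the roots -/

namespace BetheRoots

variable {K : Type*} [Field K] [Algebra ℂ K] {n l : ℕ} (D : BetheRoots n l K)

/-- The roots of `f` and `g` in `K`. -/
def root (i : RootIdx n l) : K := D.embed (rootVar n l i)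

/-- The embedding of `𝓞_l` in `K`. -/
def coordHom : O n l →ₐ[ℂ] K := D.embed.comp (rootHom n l)

/-- The evaluation of polynomials in `z` at the roots of `Q`. -/
def ev : MvPolynomial (Fin n) ℂ →ₐ[ℂ] K := MvPolynomial.aeval D.ζ

theorem root_injective : Function.Injective D.root :=
  D.embed_injective.comp ((MvPolynomial.X_injective (R := ℂ)).comp Sum.inl_injective)

theorem map_qPoly : (qPoly n l).map D.coordHom.toRingHom =
    ∏ s, (Polynomial.X - Polynomial.C (D.ζ s)) := by
  rw [qPoly, map_monicPoly, ← unitPoly_eq_revProd_iff (Fintype.card_fin n), ← D.map_qRev, qRev,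
    map_unitPoly]
  rfl

theorem eulerOp_revProd_ζ (hl : l < n) :
    eulerOp n (revProd D.ζ) = Polynomial.C (n : K) * revProd D.root := by
  have hroot : (fRev n l * gRev n l).map (D.embed.comp (rootHom n l)).toRingHom =
      revProd D.root := by
    have := congrArg (Polynomial.map D.embed.toRingHom)
      (map_rootHom_fRev_mul_gRev (n := n) (l := l))
    rwa [Polynomial.map_map, map_revProd] at this
  rw [← D.map_qRev, ← map_eulerOp, eulerOp_qRev hl, Polynomial.map_mul, hroot, Polynomial.map_C,
    map_natCast]

theorem root_ne_ζ (hn : 0 < n) (i : RootIdx n l) (s : Fin n) : D.root i ≠ D.ζ s := by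
  intro h
  have hembed : D.embed ((qPoly n l).eval₂ (rootHom n l).toRingHom (rootVar n l i)) = 0 := by
    calc D.embed ((qPoly n l).eval₂ (rootHom n l).toRingHom (rootVar n l i))
        = (qPoly n l).eval₂ D.coordHom.toRingHom (D.root i) :=
          Polynomial.hom_eval₂ _ _ D.embed.toRingHom _
      _ = 0 := by
          rw [← Polynomial.eval_map, D.map_qPoly, h, Polynomial.eval_prod]
          exact prod_eq_zero (mem_univ s) (by simp)
  rw [map_eq_zero_iff _ D.embed_injective] at hembed
  let θ : RootRing n l →ₐ[ℂ] ℂ := MvPolynomial.aeval (Sum.elim (fun _ => 0) fun _ => 1)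
  have hθ : θ (rootHom n l ((qPoly n l).coeff 0)) = 0 := by
    rw [← map_zero θ, ← hembed]
    refine Eq.trans ?_ (Polynomial.hom_eval₂ _ _ θ.toRingHom _).symm
    rw [show θ.toRingHom (rootVar n l i) = 0 by simp [θ, rootVar], Polynomial.eval₂_at_zero]
    rfl
  have hcoeff : (qPoly n l).coeff 0 = (-1) ^ n * SigmaO n l n := by
    have := coeff_unitPoly_succ (fun j : Fin n => (-1) ^ ((j : ℕ) + 1) * SigmaO n l (j + 1))
      ⟨n - 1, by omega⟩
    rw [← reflect_monicPoly, Polynomial.coeff_reflect] at this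
    simpa [qPoly, Nat.sub_add_cancel hn, Polynomial.revAt_le] using this
  rw [hcoeff, map_mul, rootHom_SigmaO_self] at hθ
  simp [θ] at hθ

theorem isBetheRoot_root (hl : l < n) (i : RootIdx n l) : IsBetheRoot D.ζ (D.root i) := by
  refine isBetheRoot_of_isRoot_derivative (D.root_ne_ζ (by omega) i) ?_
  have hdeg : (∏ s, (Polynomial.X - Polynomial.C (D.ζ s))).natDegree ≤ n := by
    simp
  have hderiv : (∏ s, (Polynomial.X - Polynomial.C (D.ζ s))).derivative =
      Polynomial.C (n : K) * ∏ i, (Polynomial.X - Polynomial.C (D.root i)) := by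
    rw [← Polynomial.reflect_reflect (N := n - 1) (p := Polynomial.derivative _),
      reflect_derivative hdeg, ← reflect_revProd D.root, card_rootIdx hl,
      ← Polynomial.reflect_C_mul, ← D.eulerOp_revProd_ζ hl, ← reflect_revProd D.ζ,
      Fintype.card_fin, Polynomial.reflect_reflect]
  rw [hderiv, Polynomial.IsRoot.def, Polynomial.eval_mul, Polynomial.eval_prod,
    prod_eq_zero (mem_univ i) (by simp), mul_zero]

theorem ev_esymm (j : Fin n) :
    D.ev (MvPolynomial.esymm (Fin n) ℂ (j + 1)) = D.coordHom (SigmaO n l (j + 1)) := by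
  have hcoeff := congrArg (Polynomial.coeff · ((j : ℕ) + 1)) D.map_qRev
  simp only [Polynomial.coeff_map, coeff_revProd ℂ, qRev, coeff_unitPoly_succ] at hcoeff
  rw [map_mul] at hcoeff
  simpa [coordHom, ev] using hcoeff.symm

theorem ev_symToPoly (a : SymRing n) : D.ev (symToPoly n a) = D.embed (symToRoot n l a) := by
  have : D.ev.comp (symToPoly n) = D.embed.comp (symToRoot n l) := by
    refine MvPolynomial.algHom_ext fun j => ?_
    rw [AlgHom.comp_apply, AlgHom.comp_apply, symToRoot_X, symToPoly, MvPolynomial.aeval_X,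
      D.ev_esymm, coordHom, AlgHom.comp_apply]
  exact DFunLike.congr_fun this a

theorem ev_injective (hl : l < n) : Function.Injective D.ev := by
  refine injective_of_injective_comp le_rfl D.ev (symToPoly n) fun a b hab => ?_
  simp only [AlgHom.comp_apply, ev_symToPoly] at hab
  exact symToRoot_injective hl (D.embed_injective hab)

/-- The functional `F ↦ ⟨vac, e₁₂(c_{κ 1}) ⋯ e₁₂(c_{κ k}) F⟩`, where `c_i` are the roots of `f` and
`g`, and `z` is specialised to the roots of `Q`. -/
def amplitudeAt {k : ℕ} (κ : Fin k → RootIdx n l) : VPoly n →ₛₗ[D.ev.toRingHom] K :=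
  (amplitude k fun j => betheWeight D.ζ (D.root (κ j))).comp (mapFock D.ev.toRingHom)

theorem amplitudeAt_apply {k : ℕ} (κ : Fin k → RootIdx n l) (F : VPoly n) : D.amplitudeAt κ F =
    amplitude k (fun j => betheWeight D.ζ (D.root (κ j))) (mapFock D.ev.toRingHom F) := rfl

theorem amplitudeAt_transferOp (hl : l < n) {k : ℕ} (κ : Fin k → RootIdx n l) (m : ℕ)
    (F : VPoly n) : D.amplitudeAt κ (transferOp MvPolynomial.X m F) =
      (∑ j, transferEigenvalue D.ζ m (D.root (κ j))) * D.amplitudeAt κ F := by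
  have hζ : D.ev.toRingHom ∘ MvPolynomial.X = D.ζ := funext fun s => MvPolynomial.aeval_X _ s
  rw [amplitudeAt_apply, mapFock_transferOp, hζ]
  exact amplitude_transferOp _ _ _
    (fun j => (D.isBetheRoot_root hl (κ j)).transferWeight_betheWeight m) _

theorem amplitude_mapFock_single {k : ℕ} (t : Fin k → Fin n) (F : VPoly n) :
    amplitude k (fun j => Pi.single (t j) 1) (mapFock D.ev.toRingHom F) =
      D.ev (amplitude k (fun j => Pi.single (t j) 1) F) := by
  have := amplitude_mapFock D.ev.toRingHom k (fun j => Pi.single (t j) 1) F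
  have hsingle (j : Fin k) : D.ev.toRingHom ∘ (Pi.single (t j) 1 : Fin n → MvPolynomial (Fin n) ℂ) =
      Pi.single (t j) 1 := funext fun s => by
    simpa using Pi.apply_single (fun _ => D.ev) (fun _ => map_zero D.ev) (t j) 1 s
  simp only [hsingle] at this
  exact this

theorem eq_zero_of_amplitudeAt (hl : l < n) {F : VPoly n} (hF : F ∈ M n l)
    (h : ∀ κ : Fin l → RootIdx n l, Function.Injective κ → D.amplitudeAt κ F = 0) : F = 0 := by
  obtain ⟨-, hsing, hnum⟩ := (mem_M_iff ..).1 hF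
  have := charZero_of_injective_algebraMap (algebraMap ℂ K).injective
  let b := basisOfLinearIndependentOfCardEqFinrank (linearIndependent_betheWeight
    (Nat.cast_ne_zero.2 (by omega)) D.root_injective (D.isBetheRoot_root hl)) (by simp; omega)
  have hb : ⇑b = Sum.elim (fun i => betheWeight D.ζ (D.root i)) fun _ : Unit => 1 :=
    coe_basisOfLinearIndependentOfCardEqFinrank _ _
  have hzero : (LinearMap.applyₗ (mapFock D.ev.toRingHom F)).compAlternatingMap
      (amplitude l) = 0 := by
    refine Module.Basis.ext_alternating b fun v hv => ?_
    simp only [LinearMap.compAlternatingMap_apply, LinearMap.applyₗ_apply_apply,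
      AlternatingMap.zero_apply, hb]
    by_cases hr : ∃ j, v j = Sum.inr ()
    · obtain ⟨j, hj⟩ := hr
      refine amplitude_eq_zero_of_annOp_eq_zero l (j := j) ?_
      rw [hj, Sum.elim_inr]
      have hmap := congrArg (mapFock D.ev.toRingHom) hsing
      rw [mapFock_weightedOp, map_zero] at hmap
      have hone : D.ev.toRingHom ∘ (1 : Fin n → MvPolynomial (Fin n) ℂ) = 1 :=
        funext fun _ => map_one D.ev
      rwa [hone] at hmap
    · have hinl (j) : ∃ i, v j = Sum.inl i := by
        rcases hvj : v j with i | ⟨⟩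
        exacts [⟨i, rfl⟩, absurd ⟨j, hvj⟩ hr]
      choose κ hκ using hinl
      have hinj : Function.Injective κ := fun i j hij => hv (by rw [hκ, hκ, hij])
      simp only [hκ, Sum.elim_inl]
      exact h κ hinj
  refine eq_zero_of_amplitude_single_eq_zero (l := l) ?_ fun t => D.ev_injective hl ?_
  · rw [hnum, Nat.cast_smul_eq_nsmul, Nat.cast_smul_eq_nsmul]
  · rw [map_zero, ← amplitude_mapFock_single]
    exact DFunLike.congr_fun hzero _

end BetheRoots

/-! ### The Vandermonde factor -/

section Moments

open MvPolynomial

variable {n l : ℕ}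

/-- The power sum `z₁ ^ q + ⋯ + zₙ ^ q` as a polynomial in the elementary symmetric ones. -/
def symPsum (n q : ℕ) : SymRing n :=
  (exists_symToPoly_eq (psum_isSymmetric (Fin n) ℂ q)).choose

theorem symToPoly_symPsum (n q : ℕ) : symToPoly n (symPsum n q) = psum (Fin n) ℂ q :=
  (exists_symToPoly_eq (psum_isSymmetric (Fin n) ℂ q)).choose_spec

/-- The moment `∑ₛ zₛ ^ q / (u_j - zₛ)` at a root `u_j` of the derivative of `∏ₛ (u - zₛ)`, as a
polynomial in `u_j`. -/
def momentVar (n : ℕ) {l : ℕ} (j : Fin l) : ℕ → MvPolynomial (Fin l) (SymRing n)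
  | 0 => 0
  | q + 1 => X j * momentVar n j q - C (symPsum n q)

/-- The linear map replacing every power `u_j ^ q` by the `q`-th moment at `u_j`. -/
def momentMap (n l : ℕ) :
    MvPolynomial (Fin l) (SymRing n) →ₗ[SymRing n] MvPolynomial (Fin l) (SymRing n) :=
  (basisMonomials (Fin l) (SymRing n)).constr (SymRing n) fun m => ∏ j, momentVar n j (m j)

theorem momentMap_monomial (m : Fin l →₀ ℕ) (a : SymRing n) :
    momentMap n l (monomial m a) = C a * ∏ j, momentVar n j (m j) := by
  have hmonomial : monomial m a = a • basisMonomials (Fin l) (SymRing n) m := by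
    rw [coe_basisMonomials, smul_monomial, smul_eq_mul, mul_one]
  rw [hmonomial, map_smul, momentMap, Module.Basis.constr_basis, smul_eq_C_mul]

theorem rename_momentVar (σ : Equiv.Perm (Fin l)) (j : Fin l) (q : ℕ) :
    rename σ (momentVar n j q) = momentVar n (σ j) q := by
  induction q with
  | zero => simp [momentVar]
  | succ q ih => simp [momentVar, ih]

theorem rename_momentMap (σ : Equiv.Perm (Fin l)) (P : MvPolynomial (Fin l) (SymRing n)) :
    rename σ (momentMap n l P) = momentMap n l (rename σ P) := by
  induction P using MvPolynomial.induction_on' with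
  | monomial m a =>
    rw [rename_monomial, momentMap_monomial, momentMap_monomial, map_mul, map_prod, rename_C,
      ← Equiv.prod_comp σ fun j => momentVar n j (m.mapDomain σ j)]
    simp only [rename_momentVar, Finsupp.mapDomain_apply σ.injective]
  | add p q hp hq => simp only [map_add, hp, hq]

theorem IsAlternating.momentMap {P : MvPolynomial (Fin l) (SymRing n)} (hP : IsAlternating P) :
    IsAlternating (momentMap n l P) := fun σ => by
  rw [rename_momentMap, hP, Units.smul_def, map_zsmul, Units.smul_def]

/-- Evaluation at the roots with the indices `κ 1, …, κ l`. -/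
def evalAt (κ : Fin l → RootIdx n l) : MvPolynomial (Fin l) (SymRing n) →ₐ[ℂ] RootRing n l :=
  aevalTower (symToRoot n l) fun j => rootVar n l (κ j)

@[simp]
theorem evalAt_C (κ : Fin l → RootIdx n l) (a : SymRing n) :
    evalAt κ (C a) = symToRoot n l a :=
  aevalTower_C ..

@[simp]
theorem evalAt_X (κ : Fin l → RootIdx n l) (j : Fin l) :
    evalAt κ (X j) = rootVar n l (κ j) :=
  aevalTower_X ..

theorem rename_evalAt (hl : l < n) (π : Equiv.Perm (RootIdx n l)) (κ : Fin l → RootIdx n l)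
    (P : MvPolynomial (Fin l) (SymRing n)) :
    rename (Sum.map π id) (evalAt κ P) = evalAt (π ∘ κ) P := by
  induction P using MvPolynomial.induction_on <;> simp_all [rename_symToRoot hl, rootVar]

theorem evalAt_inl_mem_range {S : MvPolynomial (Fin l) (SymRing n)} (hS : S.IsSymmetric) :
    evalAt Sum.inl S ∈ (rootHom n l).range := by
  obtain ⟨q, hq⟩ := esymmAlgHom_surjective (SymRing n) (Fintype.card_fin l).le ⟨S, hS⟩
  obtain rfl : aeval (fun i : Fin l => esymm (Fin l) (SymRing n) (i + 1)) q = S := by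
    rw [← esymmAlgHom_apply, hq]
  clear hq hS
  have hesymm (i : Fin l) :
      evalAt Sum.inl (esymm (Fin l) (SymRing n) (i + 1)) ∈ (rootHom n l).range := by
    have hcoeff := congrArg (Polynomial.coeff · ((i : ℕ) + 1))
      (map_rootHom_fRev (n := n) (l := l))
    simp only [Polynomial.coeff_map, coeff_revProd ℂ] at hcoeff
    have heval : evalAt Sum.inl (esymm (Fin l) (SymRing n) (i + 1)) =
        aeval (fun k : Fin l => rootVar n l (Sum.inl k)) (esymm (Fin l) ℂ (i + 1)) := by
      simp only [esymm, map_sum, map_prod, evalAt_X, aeval_X]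
    have hsign : ((-1) ^ ((i : ℕ) + 1) * (-1) ^ ((i : ℕ) + 1) : RootRing n l) = 1 := by
      rw [← mul_pow, neg_one_mul, neg_neg, one_pow]
    refine ⟨(-1) ^ ((i : ℕ) + 1) * (fRev n l).coeff (i + 1), ?_⟩
    change rootHom n l _ = _
    rw [map_mul, map_pow, map_neg, map_one, heval]
    refine (congrArg ((-1) ^ ((i : ℕ) + 1) * ·) hcoeff).trans ?_
    simp only [← mul_assoc, hsign, one_mul]
  induction q using MvPolynomial.induction_on with
  | C a =>
    rw [aeval_C, algebraMap_eq, evalAt_C]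
    exact ⟨_, rfl⟩
  | add a b ha hb => rw [map_add, map_add]; exact add_mem ha hb
  | mul_X a i ha => rw [map_mul, map_mul, aeval_X]; exact mul_mem ha (hesymm i)

end Moments

namespace BetheRoots

variable {K : Type*} [Field K] [Algebra ℂ K] {n l : ℕ} (D : BetheRoots n l K)

theorem embed_evalAt_momentVar (hl : l < n) (κ : Fin l → RootIdx n l) (j : Fin l) (q : ℕ) :
    D.embed (evalAt κ (momentVar n j q)) = betheWeight D.ζ (D.root (κ j)) ⬝ᵥ D.ζ ^ q := by
  have hroot := D.isBetheRoot_root hl (κ j)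
  induction q with
  | zero => rw [momentVar, map_zero, map_zero, pow_zero, hroot.betheWeight_dotProduct_one]
  | succ q ih =>
    have hpsum : D.embed (symToRoot n l (symPsum n q)) = ∑ s, D.ζ s ^ q := by
      rw [← D.ev_symToPoly, symToPoly_symPsum]
      simp [MvPolynomial.psum, ev]
    rw [momentVar, map_sub, map_sub, map_mul, map_mul, ih, evalAt_C, evalAt_X, hpsum,
      hroot.betheWeight_dotProduct_pow_succ_eq_mul_sub, root]

theorem amplitudeAt_eq_embed_evalAt (hl : l < n) {F : VPoly n}
    {P : MvPolynomial (Fin l) (SymRing n)}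
    (hP : ∀ t : Fin l → Fin n, substAt t P = amplitude l (fun j => Pi.single (t j) 1) F)
    (κ : Fin l → RootIdx n l) :
    D.amplitudeAt κ F = D.embed (evalAt κ (momentMap n l P)) := by
  rw [amplitudeAt_apply, amplitude_eq_sum]
  simp only [amplitude_mapFock_single, ← hP]
  clear hP
  induction P using MvPolynomial.induction_on' with
  | monomial m a =>
    have hsubst (t : Fin l → Fin n) : D.ev (substAt t (MvPolynomial.monomial m a)) =
        D.embed (symToRoot n l a) * ∏ j, D.ζ (t j) ^ m j := by
      rw [MvPolynomial.monomial_eq, Finsupp.prod_fintype _ _ fun _ => pow_zero _]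
      rw [map_mul, map_mul, substAt_C, D.ev_symToPoly]
      simp [ev]
    simp only [hsubst, momentMap_monomial, map_mul, map_prod, evalAt_C,
      D.embed_evalAt_momentVar hl, dotProduct, Pi.pow_apply, prod_univ_sum, Fintype.piFinset_univ,
      prod_mul_distrib, mul_sum]
    exact sum_congr rfl fun t _ => mul_left_comm ..
  | add p q hp hq => simp only [map_add, mul_add, sum_add_distrib, hp, hq]

theorem exists_isSymmetric_amplitudeAt_eq (hl : l < n) {F : VPoly n} (hF : F ∈ VSym n) :
    ∃ S : MvPolynomial (Fin l) (SymRing n), S.IsSymmetric ∧ ∀ κ, D.amplitudeAt κ F =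
      D.embed (evalAt κ ((Matrix.vandermonde MvPolynomial.X).det * S)) := by
  obtain ⟨P, hP, hPF⟩ := exists_isAlternating_substAt_eq_amplitude hl.le hF
  obtain ⟨S, hS, hPS⟩ := hP.momentMap.exists_eq_det_vandermonde_mul
  exact ⟨S, hS, fun κ => by rw [D.amplitudeAt_eq_embed_evalAt hl hPF, hPS]⟩

/-- The Vandermonde determinant of the roots of `f`. -/
def vandermondeDet : K := (Matrix.vandermonde fun j : Fin l => D.root (Sum.inl j)).det

theorem vandermondeDet_ne_zero : D.vandermondeDet ≠ 0 :=
  Matrix.det_vandermonde_ne_zero_iff.2 (D.root_injective.comp Sum.inl_injective)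

theorem embed_evalAt_inl_det_vandermonde :
    D.embed (evalAt Sum.inl (Matrix.vandermonde MvPolynomial.X).det) = D.vandermondeDet := by
  rw [AlgHom.map_det, AlgHom.map_det, vandermondeDet]
  congr 1
  ext i j
  simp [Matrix.vandermonde_apply, root]

theorem exists_amplitudeAt_inl_eq (hl : l < n) {F : VPoly n} (hF : F ∈ VSym n) :
    ∃ H : O n l, D.amplitudeAt Sum.inl F = D.vandermondeDet * D.coordHom H := by
  obtain ⟨S, hS, hF⟩ := D.exists_isSymmetric_amplitudeAt_eq hl hF
  obtain ⟨H, hH⟩ := evalAt_inl_mem_range hS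
  refine ⟨H, ?_⟩
  rw [hF, map_mul, map_mul, embed_evalAt_inl_det_vandermonde, ← hH]
  rfl

/-- The Galois group permutes the functionals `amplitudeAt κ`, so one of them separates points. -/
theorem eq_zero_of_amplitudeAt_inl (hl : l < n) {F : VPoly n} (hF : F ∈ M n l)
    (h : D.amplitudeAt Sum.inl F = 0) : F = 0 := by
  refine D.eq_zero_of_amplitudeAt hl hF fun κ hκ => ?_
  obtain ⟨S, -, hS⟩ := D.exists_isSymmetric_amplitudeAt_eq hl ((mem_M_iff ..).1 hF).1
  have := Equiv.Perm.isMultiplyPretransitive (RootIdx n l) l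
  obtain ⟨π, hπ⟩ := MulAction.exists_smul_eq (Equiv.Perm (RootIdx n l))
    (⟨Sum.inl, Sum.inl_injective⟩ : Fin l ↪ RootIdx n l) ⟨κ, hκ⟩
  have hπκ : π ∘ Sum.inl = κ := congrArg DFunLike.coe hπ
  rw [hS, map_eq_zero_iff _ D.embed_injective] at h
  rw [hS, ← hπκ, ← rename_evalAt hl, h, map_zero, map_zero]

theorem amplitudeAt_uvec (hl : l < n) :
    D.amplitudeAt Sum.inl (uvec n l) = (n : K) * ((-n) ^ l * D.vandermondeDet) := by
  have hcons : D.amplitudeAt Sum.inl (uvec n l) =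
      amplitude (l + 1) (Fin.cons 1 fun j => betheWeight D.ζ (D.root (Sum.inl j)))
        (creationState (l + 1) fun i => D.ζ ^ (i : ℕ)) := by
    have hone : D.ev.toRingHom ∘ (1 : Fin n → MvPolynomial (Fin n) ℂ) = 1 :=
      funext fun _ => map_one D.ev
    have hpow (i : ℕ) : D.ev.toRingHom ∘ (MvPolynomial.X ^ i : Fin n → MvPolynomial (Fin n) ℂ) =
        D.ζ ^ i := funext fun s => by simp [ev]
    rw [amplitudeAt_apply, uvec_eq, mapFock_weightedOp, mapFock_creationState, hone, amplitude_succ]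
    simp only [hpow, Fin.cons_zero, Fin.cons_succ]
  rw [hcons, amplitude_creationState, Matrix.det_succ_column_zero, Fin.sum_univ_succ]
  have hcol (i : Fin l) := (D.isBetheRoot_root hl (Sum.inl i)).betheWeight_dotProduct_one
  have hminor : (Matrix.of fun i j : Fin l =>
      betheWeight D.ζ (D.root (Sum.inl i)) ⬝ᵥ D.ζ ^ ((j : ℕ) + 1)).det =
        (-n) ^ l * D.vandermondeDet := by
    have hneg : (Matrix.of fun i j : Fin l =>
        betheWeight D.ζ (D.root (Sum.inl i)) ⬝ᵥ D.ζ ^ ((j : ℕ) + 1)) =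
          -Matrix.of fun i j : Fin l => transferEigenvalue D.ζ j (D.root (Sum.inl i)) := by
      ext i j
      exact (D.isBetheRoot_root hl _).betheWeight_dotProduct_pow_succ _
    rw [hneg, Matrix.det_neg, det_transferEigenvalue, Fintype.card_fin, neg_pow (n : K) l,
      vandermondeDet]
    ring
  simp only [Matrix.of_apply, Fin.cons_zero, Fin.cons_succ, Fin.val_zero, pow_zero, hcol, mul_zero,
    zero_mul, sum_const_zero, add_zero, one_mul, Matrix.submatrix, Fin.succAbove_zero, Fin.val_succ,
    hminor]
  simp [dotProduct]

end BetheRoots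

/-! ### The operators `B_i` -/

section BetheOp

variable {n l : ℕ}

/-- The coefficients of `∏ₛ (1 - zₛ x)`. -/
def charCoeff (n k : ℕ) : MvPolynomial (Fin n) ℂ :=
  (revProd (MvPolynomial.X : Fin n → MvPolynomial (Fin n) ℂ)).coeff k

theorem charCoeff_eq (n k : ℕ) :
    charCoeff n k = (-1 : ℂ) ^ k • MvPolynomial.esymm (Fin n) ℂ k := by
  rw [charCoeff, coeff_revProd ℂ, MvPolynomial.aeval_X_left, Algebra.smul_def]
  simp

theorem charCoeff_isSymmetric (n k : ℕ) : (charCoeff n k).IsSymmetric := by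
  rw [charCoeff_eq]
  exact (MvPolynomial.symmetricSubalgebra (Fin n) ℂ).smul_mem
    (MvPolynomial.esymm_isSymmetric (Fin n) ℂ k) _

/-- The operator by which `B_{i+2}` acts on symmetric vectors. -/
def betheOp (n i : ℕ) : Module.End (MvPolynomial (Fin n) ℂ) (VPoly n) :=
  ∑ x ∈ antidiagonal i, charCoeff n x.1 • transferOp MvPolynomial.X x.2

theorem betheOp_apply (i : ℕ) (F : VPoly n) : betheOp n i F =
    ∑ x ∈ antidiagonal i, charCoeff n x.1 • transferOp MvPolynomial.X x.2 F := by
  simp only [betheOp, LinearMap.sum_apply, LinearMap.smul_apply]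

theorem act_coeff_centralSer {C : ℕ → CurrentU} (hC : IsCentralLift n C) (j : ℕ) {F : VPoly n}
    (hF : F ∈ VSym n) : act n (PowerSeries.coeff j (centralSer n C)) F = charCoeff n j • F := by
  rw [centralSer, map_add, map_sum, charCoeff_eq]
  simp only [PowerSeries.coeff_monomial, PowerSeries.coeff_one, sum_ite_eq, mem_Icc]
  rcases Nat.eq_zero_or_pos j with rfl | hj
  · simp
  rw [if_neg hj.ne', zero_add]
  split_ifs with hjn
  · rw [map_smul, LinearMap.smul_apply, (hC j hj hjn.2).2 F hF, smul_assoc]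
  · rw [map_zero, LinearMap.zero_apply, MvPolynomial.esymm,
      powersetCard_eq_empty.2 (by simp; omega), sum_empty, smul_zero, zero_smul]

theorem act_B {C : ℕ → CurrentU} (hC : IsCentralLift n C) (i : ℕ) {F : VPoly n}
    (hF : F ∈ VSym n) : act n (B n C (i + 2)) F = betheOp n i F := by
  rw [B, PowerSeries.coeff_mul, map_sum, LinearMap.sum_apply, Nat.sum_antidiagonal_succ',
    Nat.sum_antidiagonal_succ', coeff_transferSer_of_lt (by omega),
    coeff_transferSer_of_lt (by omega), mul_zero, mul_zero, map_zero, LinearMap.zero_apply,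
    zero_add, zero_add, betheOp_apply]
  refine sum_congr rfl fun x _ => ?_
  rw [map_mul, Module.End.mul_apply, act_coeff_transferSer,
    act_coeff_centralSer hC _ (transferOp_mem_VSym _ hF)]

end BetheOp

namespace BetheRoots

variable {K : Type*} [Field K] [Algebra ℂ K] {n l : ℕ} (D : BetheRoots n l K)

theorem ev_charCoeff (k : ℕ) : D.ev (charCoeff n k) = (revProd D.ζ).coeff k := by
  have hmap := map_revProd D.ev.toRingHom (MvPolynomial.X : Fin n → MvPolynomial (Fin n) ℂ)
  have hζ : (fun s => D.ev.toRingHom (MvPolynomial.X s)) = D.ζ :=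
    funext fun s => MvPolynomial.aeval_X _ s
  rw [← hζ, ← hmap, Polynomial.coeff_map]
  rfl

theorem coordHom_GO (hl : l < n) {i : ℕ} (hi : i + 2 ≤ n) : D.coordHom (GO n l i) =
    (Polynomial.C (n : K) * (eulerOp l (revProd fun j => D.root (Sum.inl j)) *
      revProd fun j => D.root (Sum.inr j))).coeff i := by
  have hf := congrArg (Polynomial.map D.embed.toRingHom) (map_rootHom_fRev (n := n) (l := l))
  have hg := congrArg (Polynomial.map D.embed.toRingHom) (map_rootHom_gRev (n := n) (l := l))
  rw [Polynomial.map_map, map_revProd] at hf hg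
  have hmap : (eulerOp l (fRev n l) * gRev n l).map D.coordHom.toRingHom =
      eulerOp l (revProd fun j => D.root (Sum.inl j)) * revProd fun j => D.root (Sum.inr j) := by
    rw [Polynomial.map_mul, map_eulerOp]
    exact congrArg₂ (fun f g => eulerOp l f * g) hf hg
  rw [GO_eq hl hi, map_smul, ← hmap, Polynomial.coeff_C_mul, Polynomial.coeff_map,
    Algebra.smul_def, map_natCast]
  rfl

theorem sum_coeff_mul_transferEigenvalue (hl : l < n) {i : ℕ} (hi : i + 2 ≤ n) :
    ∑ x ∈ antidiagonal i, (revProd D.ζ).coeff x.1 *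
      ∑ j : Fin l, transferEigenvalue D.ζ x.2 (D.root (Sum.inl j)) = D.coordHom (GO n l i) := by
  have hζ : (revProd D.ζ : PowerSeries K) * PowerSeries.mk (fun m => ∑ s, D.ζ s ^ m) =
      ((Polynomial.C (n : K) * revProd D.root : Polynomial K) : PowerSeries K) := by
    rw [revProd_mul_mk_sum_pow, Fintype.card_fin, D.eulerOp_revProd_ζ hl]
  have heigen : PowerSeries.mk (fun m => ∑ j : Fin l,
      transferEigenvalue D.ζ m (D.root (Sum.inl j))) =
        PowerSeries.mk (fun m => ∑ s, D.ζ s ^ m) *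
          PowerSeries.mk fun m => ∑ j : Fin l, D.root (Sum.inl j) ^ m := by
    ext m
    simp only [PowerSeries.coeff_mul, PowerSeries.coeff_mk, transferEigenvalue, mul_sum]
    exact sum_comm
  have hf := revProd_mul_mk_sum_pow fun j : Fin l => D.root (Sum.inl j)
  rw [Fintype.card_fin] at hf
  have hseries : (revProd D.ζ : PowerSeries K) * PowerSeries.mk (fun m => ∑ j : Fin l,
      transferEigenvalue D.ζ m (D.root (Sum.inl j))) =
        ((Polynomial.C (n : K) * (eulerOp l (revProd fun j => D.root (Sum.inl j)) *
          revProd fun j => D.root (Sum.inr j)) : Polynomial K) : PowerSeries K) := by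
    rw [heigen, ← mul_assoc, hζ, revProd_sumElim]
    simp only [Polynomial.coe_mul, ← hf]
    ring
  have hcoeff := congrArg (PowerSeries.coeff i) hseries
  rw [PowerSeries.coeff_mul, Polynomial.coeff_coe, ← D.coordHom_GO hl hi] at hcoeff
  simpa only [Polynomial.coeff_coe, PowerSeries.coeff_mk] using hcoeff

theorem amplitudeAt_smul {k : ℕ} (κ : Fin k → RootIdx n l) (p : MvPolynomial (Fin n) ℂ)
    (F : VPoly n) : D.amplitudeAt κ (p • F) = D.ev p * D.amplitudeAt κ F :=
  (D.amplitudeAt κ).map_smulₛₗ p F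

theorem amplitudeAt_betheOp (hl : l < n) {i : ℕ} (hi : i + 2 ≤ n) (F : VPoly n) :
    D.amplitudeAt Sum.inl (betheOp n i F) =
      D.coordHom (GO n l i) * D.amplitudeAt Sum.inl F := by
  rw [betheOp_apply, map_sum, ← D.sum_coeff_mul_transferEigenvalue hl hi, sum_mul]
  refine sum_congr rfl fun x _ => ?_
  rw [amplitudeAt_smul, D.amplitudeAt_transferOp hl, ev_charCoeff, mul_assoc]

theorem ev_coe_eq_coordHom_symToO (q : MvPolynomial.symmetricSubalgebra (Fin n) ℂ) :
    D.ev q = D.coordHom (symToO n l q) := by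
  obtain ⟨a, rfl⟩ := (MvPolynomial.esymmAlgEquiv (Fin n) ℂ (Fintype.card_fin n)).surjective q
  have hcoe : ((MvPolynomial.esymmAlgEquiv (Fin n) ℂ (Fintype.card_fin n) a :
      MvPolynomial.symmetricSubalgebra (Fin n) ℂ) : MvPolynomial (Fin n) ℂ) = symToPoly n a :=
    MvPolynomial.esymmAlgHom_apply ..
  have hsymm : symToO n l (MvPolynomial.esymmAlgEquiv (Fin n) ℂ (Fintype.card_fin n) a) =
      symRingToO n l a :=
    congrArg (symRingToO n l) ((MvPolynomial.esymmAlgEquiv (Fin n) ℂ _).symm_apply_apply a)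
  rw [hcoe, D.ev_symToPoly, hsymm]
  rfl

end BetheRoots

section Degree

variable {n m d : ℕ} {F : VPoly n}

theorem smul_mem_VHom {p : MvPolynomial (Fin n) ℂ} (hp : p.IsHomogeneous d) (hF : F ∈ VHom n m) :
    p • F ∈ VHom n (m + d) := fun J => by
  rw [add_comm]
  exact hp.mul (hF J)

theorem fockOp_mem_VHom (i j : Fin 2) (s : Fin n) (hF : F ∈ VHom n m) :
    fockOp i j s F ∈ VHom n m := fun J => by
  rw [fockOp_apply]
  split_ifs
  · rcases neg_one_pow_eq_or (MvPolynomial (Fin n) ℂ) (parityBelow J s * ((i : ℕ) + j)) with h | h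
    · rw [h, one_mul]
      exact hF _
    · rw [h, neg_one_mul]
      exact (hF _).neg
  · exact MvPolynomial.isHomogeneous_zero _ _ _

theorem weightedOp_mem_VHom (i j : Fin 2) {w : Fin n → MvPolynomial (Fin n) ℂ}
    (hw : ∀ s, (w s).IsHomogeneous d) (hF : F ∈ VHom n m) :
    weightedOp i j w F ∈ VHom n (m + d) := by
  rw [weightedOp_apply, LinearMap.sum_apply]
  exact sum_mem fun s _ => smul_mem_VHom (hw s) (fockOp_mem_VHom i j s hF)

theorem transferOp_mem_VHom (k : ℕ) (hF : F ∈ VHom n m) :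
    transferOp MvPolynomial.X k F ∈ VHom n (m + k) := by
  have hX (r : ℕ) (s : Fin n) := MvPolynomial.isHomogeneous_X_pow (R := ℂ) s r
  rw [transferOp, LinearMap.sum_apply]
  refine sum_mem fun x hx => ?_
  rw [← HasAntidiagonal.mem_antidiagonal.1 hx, add_comm x.1, ← add_assoc]
  exact sub_mem
    (smul_mem_VHom (MvPolynomial.IsHomogeneous.sum _ _ _ fun s _ => hX x.1 s)
      (weightedOp_mem_VHom _ _ (hX x.2) hF))
    (weightedOp_mem_VHom _ _ (hX x.1) (weightedOp_mem_VHom _ _ (hX x.2) hF))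

theorem isHomogeneous_esymm (n k : ℕ) : (MvPolynomial.esymm (Fin n) ℂ k).IsHomogeneous k := by
  refine MvPolynomial.IsHomogeneous.sum _ _ _ fun s hs => ?_
  have h := MvPolynomial.IsHomogeneous.prod s (fun i => (MvPolynomial.X i : MvPolynomial _ ℂ))
    (fun _ => 1) fun i _ => MvPolynomial.isHomogeneous_X ℂ i
  rwa [sum_const, (mem_powersetCard.1 hs).2, smul_eq_mul, mul_one] at h

theorem isHomogeneous_charCoeff (n k : ℕ) : (charCoeff n k).IsHomogeneous k := by
  rw [charCoeff_eq]
  exact (MvPolynomial.homogeneousSubmodule _ _ _).smul_mem _ (isHomogeneous_esymm n k)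

theorem betheOp_mem_VHom (i : ℕ) (hF : F ∈ VHom n m) : betheOp n i F ∈ VHom n (m + i) := by
  rw [betheOp_apply]
  refine sum_mem fun x hx => ?_
  rw [← HasAntidiagonal.mem_antidiagonal.1 hx, add_comm x.1, ← add_assoc]
  exact smul_mem_VHom (isHomogeneous_charCoeff n _) (transferOp_mem_VHom _ hF)

theorem creationState_X_pow_mem_VHom (k : ℕ) (a : Fin k → ℕ) :
    creationState k (fun i => (MvPolynomial.X : Fin n → MvPolynomial (Fin n) ℂ) ^ a i) ∈
      VHom n (∑ i, a i) := by
  induction k with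
  | zero =>
    intro J
    rw [univ_eq_empty, sum_empty]
    by_cases hJ : J = 0
    · subst hJ
      simpa [creationState] using MvPolynomial.isHomogeneous_one _ _
    · simpa [creationState, Pi.single_eq_of_ne hJ] using MvPolynomial.isHomogeneous_zero _ _ _
  | succ k ih =>
    rw [creationState_succ, Fin.sum_univ_succ, add_comm]
    exact weightedOp_mem_VHom _ _ (fun s => MvPolynomial.isHomogeneous_X_pow s _)
      (ih fun i => a i.succ)

theorem uvec_mem_VHom (n l : ℕ) : uvec n l ∈ VHom n (l * (l + 1) / 2) := by
  have hdegree : ∑ i : Fin (l + 1), (i : ℕ) = l * (l + 1) / 2 := by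
    rw [Fin.sum_univ_eq_sum_range (fun i => i), sum_range_id, Nat.add_sub_cancel, mul_comm]
  rw [uvec_eq, ← hdegree, ← add_zero (∑ i : Fin (l + 1), (i : ℕ))]
  exact weightedOp_mem_VHom _ _ (fun _ => MvPolynomial.isHomogeneous_one _ _)
    (creationState_X_pow_mem_VHom (l + 1) _)

end Degree

/-! ### The isomorphisms `η_l` and `ρ_l` -/

section Generation

variable {n l : ℕ}

theorem eq_top_of_generators (hl : l < n) (A : Subalgebra ℂ (O n l))
    (hG : ∀ i, 1 ≤ i → i + 2 ≤ n → GO n l i ∈ A)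
    (hS : ∀ j, 1 ≤ j → j ≤ n → SigmaO n l j ∈ A) : A = ⊤ := by
  have : SetLike.GradedMonoid fun _ : ℕ => Subalgebra.toSubmodule A :=
    { one_mem := A.one_mem, mul_mem := fun _ _ _ _ => A.mul_mem }
  rw [eq_top_iff, ← MvPolynomial.adjoin_range_X]
  refine Algebra.adjoin_le ?_
  rintro _ ⟨i, rfl⟩
  exact mem_of_generators (fun _ => Subalgebra.toSubmodule A) hl hG hS
    (MvPolynomial.isWeightedHomogeneous_X ℂ (OWeight n l) i)

theorem eq_of_sendsGenerators (hl : l < n) {C : ℕ → CurrentU} {η₁ η₂ : O n l →ₐ[ℂ] betheM n l}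
    (h₁ : SendsGenerators n l C η₁) (h₂ : SendsGenerators n l C η₂) : η₁ = η₂ :=
  AlgHom.equalizer_eq_top.1 <| eq_top_of_generators hl _
    (fun i hi hin => Subtype.ext <| LinearMap.ext fun v => Subtype.ext <|
      (h₁.1 i hi hin v).trans (h₂.1 i hi hin v).symm)
    fun j hj hjn => Subtype.ext <| LinearMap.ext fun v => Subtype.ext <|
      (h₁.2 j hj hjn v).trans (h₂.2 j hj hjn v).symm

/-- The image in `𝓑_l` of an element of the Bethe algebra. -/
def toBetheM {b : CurrentU} (hb : b ∈ bethe) : betheM n l :=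
  ⟨(act n b).restrict fun _ => act_mem_M hb, b, hb, fun _ => rfl⟩

/-- `u_l` as an element of `𝓜_l`. -/
def cyclicVector (n l : ℕ) : M n l := ⟨uvec n l, uvec_mem_M n l⟩

theorem coeff_transferSer_mem_bethe (m : ℕ) : PowerSeries.coeff m transferSer ∈ bethe := by
  rcases lt_or_ge m 2 with hm | hm
  · exact coeff_transferSer_of_lt hm ▸ zero_mem bethe
  · rw [bethe_eq_adjoin]
    exact Algebra.subset_adjoin (Or.inr ⟨m - 2, by simp only [Nat.sub_add_cancel hm]⟩)

theorem B_mem_bethe {C : ℕ → CurrentU} (hC : ∀ j, C j ∈ bethe) (i : ℕ) : B n C i ∈ bethe := by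
  rw [B, PowerSeries.coeff_mul]
  refine sum_mem fun x _ => mul_mem ?_ (coeff_transferSer_mem_bethe _)
  rw [centralSer, map_add, map_sum, PowerSeries.coeff_one]
  refine add_mem ?_ (sum_mem fun k _ => ?_)
  · split_ifs
    exacts [one_mem _, zero_mem _]
  · rw [PowerSeries.coeff_monomial]
    split_ifs
    exacts [bethe.smul_mem (hC k) _, zero_mem _]

theorem betheOp_mem_M (i : ℕ) {F : VPoly n} (hF : F ∈ M n l) : betheOp n i F ∈ M n l := by
  rw [betheOp_apply]
  exact sum_mem fun x _ => smul_mem_M (charCoeff_isSymmetric n x.1) (transferOp_mem_M x.2 hF)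

theorem natCast_mul_neg_pow_ne_zero (hl : l < n) : (n * (-n) ^ l : ℂ) ≠ 0 := by
  have hn : (n : ℂ) ≠ 0 := Nat.cast_ne_zero.2 (by omega)
  exact mul_ne_zero hn (pow_ne_zero _ (neg_ne_zero.2 hn))

end Generation

namespace BetheRoots

variable {K : Type*} [Field K] [Algebra ℂ K] {n l : ℕ} (D : BetheRoots n l K)

/-- The joint eigenfunctional of `𝓑_l` on `𝓜_l` attached to the roots of `f`. -/
def eigenfunctional : M n l →ₗ[ℂ] K where
  toFun v := D.amplitudeAt Sum.inl v
  map_add' v w := map_add (D.amplitudeAt Sum.inl) (v : VPoly n) w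
  map_smul' c v := by
    have hC : ((c • v : M n l) : VPoly n) =
        (MvPolynomial.C c : MvPolynomial (Fin n) ℂ) • (v : VPoly n) :=
      funext fun J => MvPolynomial.smul_eq_C_mul ((v : VPoly n) J) c
    rw [hC, amplitudeAt_smul, RingHom.id_apply, Algebra.smul_def]
    exact congrArg (· * _) (D.ev.commutes c)

theorem eigenfunctional_apply (v : M n l) :
    D.eigenfunctional v = D.amplitudeAt Sum.inl (v : VPoly n) := rfl

theorem eigenfunctional_injective (hl : l < n) : Function.Injective D.eigenfunctional :=
  (injective_iff_map_eq_zero _).2 fun v hv => Subtype.ext (D.eq_zero_of_amplitudeAt_inl hl v.2 hv)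

theorem coordHom_injective (hl : l < n) : Function.Injective D.coordHom :=
  D.embed_injective.comp (rootHom_injective hl)

theorem eigenfunctional_cyclicVector (hl : l < n) : D.eigenfunctional (cyclicVector n l) =
    D.vandermondeDet * algebraMap ℂ K (n * (-n) ^ l) := by
  rw [eigenfunctional_apply, cyclicVector, D.amplitudeAt_uvec hl]
  simp only [map_mul, map_pow, map_neg, map_natCast]
  ring

theorem eigenfunctional_cyclicVector_ne_zero (hl : l < n) :
    D.eigenfunctional (cyclicVector n l) ≠ 0 := by
  rw [D.eigenfunctional_cyclicVector hl]
  exact mul_ne_zero D.vandermondeDet_ne_zero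
    ((map_ne_zero _).2 (natCast_mul_neg_pow_ne_zero hl))

theorem exists_eigenfunctional_eq (hl : l < n) (v : M n l) : ∃ H : O n l,
    D.eigenfunctional v = D.coordHom H * D.eigenfunctional (cyclicVector n l) := by
  obtain ⟨H, hH⟩ := D.exists_amplitudeAt_inl_eq hl ((mem_M_iff ..).1 v.2).1
  have hc := (map_ne_zero (algebraMap ℂ K)).2 (natCast_mul_neg_pow_ne_zero hl)
  refine ⟨(n * (-n) ^ l : ℂ)⁻¹ • H, ?_⟩
  rw [eigenfunctional_apply, hH, D.eigenfunctional_cyclicVector hl, map_smul, Algebra.smul_def,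
    map_inv₀]
  field_simp

theorem exists_eigenvalue (hl : l < n) {b : CurrentU} (hb : b ∈ bethe) :
    ∃ μ : K, ∀ v ∈ M n l, D.amplitudeAt Sum.inl (act n b v) = μ * D.amplitudeAt Sum.inl v := by
  rw [bethe_eq_adjoin] at hb
  induction hb using Algebra.adjoin_induction with
  | mem x hx =>
    rcases hx with ⟨r, rfl⟩ | ⟨m, rfl⟩
    · exact ⟨D.ev (MvPolynomial.psum (Fin n) ℂ r), fun v _ => by
        rw [act_e_zero_zero_add_e_one_one, amplitudeAt_smul]⟩
    · exact ⟨∑ j : Fin l, transferEigenvalue D.ζ m (D.root (Sum.inl j)), fun v _ => by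
        rw [act_coeff_transferSer, D.amplitudeAt_transferOp hl]⟩
  | algebraMap r =>
    refine ⟨algebraMap ℂ K r, fun v hv => ?_⟩
    rw [AlgHom.commutes, Module.algebraMap_end_apply, ← Algebra.smul_def]
    exact D.eigenfunctional.map_smul r ⟨v, hv⟩
  | add x y _ _ hx hy =>
    obtain ⟨μ, hμ⟩ := hx
    obtain ⟨ν, hν⟩ := hy
    exact ⟨μ + ν, fun v hv => by
      rw [map_add, LinearMap.add_apply, map_add, hμ v hv, hν v hv, add_mul]⟩
  | mul x y _ hy' hx hy =>
    obtain ⟨μ, hμ⟩ := hx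
    obtain ⟨ν, hν⟩ := hy
    rw [← bethe_eq_adjoin] at hy'
    exact ⟨μ * ν, fun v hv => by
      rw [map_mul, Module.End.mul_apply, hμ _ (act_mem_M hy' hv), hν v hv, mul_assoc]⟩

/-- The pairs `(H, T)` of an element of `𝓞_l` and an operator in `𝓑_l` with eigenvalue `H`: the
graph of `η_l`. -/
def eigenPairs : Subalgebra ℂ (O n l × betheM n l) where
  carrier := {p | ∀ v, D.eigenfunctional ((p.2 : Module.End ℂ (M n l)) v) =
    D.coordHom p.1 * D.eigenfunctional v}
  mul_mem' {p q} hp hq v := by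
    rw [Prod.snd_mul, Prod.fst_mul, Subalgebra.coe_mul, Module.End.mul_apply, hp, hq, map_mul,
      mul_assoc]
  add_mem' {p q} hp hq v := by
    rw [Prod.snd_add, Prod.fst_add, Subalgebra.coe_add, LinearMap.add_apply, map_add, hp, hq,
      map_add, add_mul]
  algebraMap_mem' c v := by
    rw [Prod.algebraMap_apply, Subalgebra.coe_algebraMap, Module.algebraMap_end_apply, map_smul,
      AlgHom.commutes, Algebra.smul_def]

theorem amplitudeAt_esymm_smul {j : ℕ} (hj : 1 ≤ j) (hjn : j ≤ n) (F : VPoly n) :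
    D.amplitudeAt Sum.inl (MvPolynomial.esymm (Fin n) ℂ j • F) =
      D.coordHom (SigmaO n l j) * D.amplitudeAt Sum.inl F := by
  obtain ⟨j, rfl⟩ := Nat.exists_eq_add_of_le' hj
  rw [amplitudeAt_smul, D.ev_esymm ⟨j, hjn⟩]

/-- The projection of the graph of `η_l` to `𝓞_l`. -/
def eigenPairsFst : D.eigenPairs →ₐ[ℂ] O n l := (AlgHom.fst ℂ _ _).comp D.eigenPairs.val

/-- The projection of the graph of `η_l` to `𝓑_l`. -/
def eigenPairsSnd : D.eigenPairs →ₐ[ℂ] betheM n l := (AlgHom.snd ℂ _ _).comp D.eigenPairs.val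

theorem mem_range_eigenPairsFst {H : O n l} {b : CurrentU} (hb : b ∈ bethe)
    (h : ∀ v ∈ M n l, D.amplitudeAt Sum.inl (act n b v) =
      D.coordHom H * D.amplitudeAt Sum.inl v) : H ∈ D.eigenPairsFst.range :=
  ⟨⟨(H, toBetheM hb), fun v => h v v.2⟩, rfl⟩

theorem eigenPairsFst_bijective (hl : l < n) : Function.Bijective D.eigenPairsFst := by
  constructor
  · rintro ⟨⟨H, T⟩, hT⟩ ⟨⟨H', T'⟩, hT'⟩ (rfl : H = H')
    have hTT' : T = T' := Subtype.ext <| LinearMap.ext fun v =>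
      D.eigenfunctional_injective hl ((hT v).trans (hT' v).symm)
    rw [Subtype.mk.injEq, hTT']
  · obtain ⟨C, hC, hCb⟩ := exists_isCentralLift n
    rw [← AlgHom.range_eq_top]
    refine eq_top_of_generators hl _ (fun i _ hin => ?_) fun j hj hjn => ?_
    · refine D.mem_range_eigenPairsFst (B_mem_bethe (n := n) hCb (i + 2)) fun v hv => ?_
      rw [act_B hC i ((mem_M_iff ..).1 hv).1, D.amplitudeAt_betheOp hl hin]
    · refine D.mem_range_eigenPairsFst (hCb j) fun v hv => ?_
      rw [(hC j hj hjn).2 v ((mem_M_iff ..).1 hv).1, D.amplitudeAt_esymm_smul hj hjn]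

theorem eigenPairsSnd_bijective (hl : l < n) : Function.Bijective D.eigenPairsSnd := by
  have hu := D.eigenfunctional_cyclicVector_ne_zero hl
  constructor
  · rintro ⟨⟨H, T⟩, hT⟩ ⟨⟨H', T'⟩, hT'⟩ (rfl : T = T')
    have hHH' : H = H' := D.coordHom_injective hl <|
      mul_right_cancel₀ hu ((hT _).symm.trans (hT' _))
    rw [Subtype.mk.injEq, hHH']
  · intro T
    obtain ⟨b, hb, hT⟩ := T.2
    obtain ⟨μ, hμ⟩ := D.exists_eigenvalue hl hb
    have heigen (v : M n l) : D.eigenfunctional ((T : Module.End ℂ (M n l)) v) =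
        μ * D.eigenfunctional v := by
      rw [eigenfunctional_apply, hT, hμ v v.2, eigenfunctional_apply]
    obtain ⟨H, hH⟩ := D.exists_eigenfunctional_eq hl
      ((T : Module.End ℂ (M n l)) (cyclicVector n l))
    obtain rfl : μ = D.coordHom H := mul_right_cancel₀ hu ((heigen _).symm.trans hH)
    exact ⟨⟨(H, T), heigen⟩, rfl⟩

/-- The isomorphism `η_l`. -/
def eta (hl : l < n) : O n l ≃ₐ[ℂ] betheM n l :=
  (AlgEquiv.ofBijective _ (D.eigenPairsFst_bijective hl)).symm.trans
    (AlgEquiv.ofBijective _ (D.eigenPairsSnd_bijective hl))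

variable (hl : l < n)

theorem eigenfunctional_eta (H : O n l) (v : M n l) :
    D.eigenfunctional ((D.eta hl H : Module.End ℂ (M n l)) v) =
      D.coordHom H * D.eigenfunctional v := by
  obtain ⟨p, rfl⟩ := (D.eigenPairsFst_bijective hl).2 H
  have heta : D.eta hl (D.eigenPairsFst p) = D.eigenPairsSnd p :=
    congrArg D.eigenPairsSnd
      ((AlgEquiv.ofBijective _ (D.eigenPairsFst_bijective hl)).symm_apply_apply p)
  rw [heta]
  exact p.2 v

theorem eta_eq_of_amplitudeAt {H : O n l} {v : M n l} {F : VPoly n} (hF : F ∈ M n l)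
    (h : D.amplitudeAt Sum.inl F = D.coordHom H * D.amplitudeAt Sum.inl (v : VPoly n)) :
    (((D.eta hl H : Module.End ℂ (M n l)) v : M n l) : VPoly n) = F :=
  congrArg Subtype.val (a₂ := (⟨F, hF⟩ : M n l)) <| D.eigenfunctional_injective hl <|
    (D.eigenfunctional_eta hl H v).trans h.symm

theorem eta_GO {i : ℕ} (hi : i + 2 ≤ n) (v : M n l) :
    (((D.eta hl (GO n l i) : Module.End ℂ (M n l)) v : M n l) : VPoly n) = betheOp n i v :=
  D.eta_eq_of_amplitudeAt hl (betheOp_mem_M i v.2) (D.amplitudeAt_betheOp hl hi v)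

theorem eta_SigmaO {j : ℕ} (hj : 1 ≤ j) (hjn : j ≤ n) (v : M n l) :
    (((D.eta hl (SigmaO n l j) : Module.End ℂ (M n l)) v : M n l) : VPoly n) =
      MvPolynomial.esymm (Fin n) ℂ j • (v : VPoly n) :=
  D.eta_eq_of_amplitudeAt hl (smul_mem_M (MvPolynomial.esymm_isSymmetric _ _ _) v.2)
    (D.amplitudeAt_esymm_smul hj hjn v)

theorem eta_symToO_mul (p : MvPolynomial.symmetricSubalgebra (Fin n) ℂ) (F : O n l) (v : M n l) :
    (((D.eta hl (symToO n l p * F) : Module.End ℂ (M n l)) v : M n l) : VPoly n) =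
      (p : MvPolynomial (Fin n) ℂ) •
        (((D.eta hl F : Module.End ℂ (M n l)) v : M n l) : VPoly n) :=
  D.eta_eq_of_amplitudeAt hl (smul_mem_M p.2 (Subtype.prop _)) <| by
    rw [amplitudeAt_smul, D.ev_coe_eq_coordHom_symToO, map_mul, mul_assoc]
    exact congrArg (_ * ·) (D.eigenfunctional_eta hl F v)

theorem sendsGenerators_eta {C : ℕ → CurrentU} (hC : IsCentralLift n C) :
    SendsGenerators n l C (D.eta hl).toAlgHom :=
  ⟨fun i _ hin v => (D.eta_GO hl hin v).trans (act_B hC i ((mem_M_iff ..).1 v.2).1).symm,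
    fun j hj hjn v => (D.eta_SigmaO hl hj hjn v).trans
      ((hC j hj hjn).2 v ((mem_M_iff ..).1 v.2).1).symm⟩

/-- The isomorphism `ρ_l`. -/
def rho : O n l ≃ₗ[ℂ] M n l :=
  LinearEquiv.ofBijective
    (LinearMap.applyₗ (cyclicVector n l) ∘ₗ (betheM n l).val.toLinearMap ∘ₗ
      (D.eta hl).toAlgHom.toLinearMap) <| by
    have heigen (H : O n l) := D.eigenfunctional_eta hl H (cyclicVector n l)
    refine ⟨fun F H hFH => D.coordHom_injective hl ?_, fun v => ?_⟩
    · exact mul_right_cancel₀ (D.eigenfunctional_cyclicVector_ne_zero hl)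
        ((heigen F).symm.trans ((congrArg D.eigenfunctional hFH).trans (heigen H)))
    · obtain ⟨H, hH⟩ := D.exists_eigenfunctional_eq hl v
      exact ⟨H, D.eigenfunctional_injective hl ((heigen H).trans hH.symm)⟩

theorem rho_apply (F : O n l) :
    D.rho hl F = (D.eta hl F : Module.End ℂ (M n l)) (cyclicVector n l) := rfl

theorem rho_mul (F H : O n l) :
    D.rho hl (F * H) = (D.eta hl F : Module.End ℂ (M n l)) (D.rho hl H) := by
  rw [rho_apply, rho_apply, map_mul, Subalgebra.coe_mul, Module.End.mul_apply]

end BetheRoots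

section Grading

variable {n l d : ℕ}

/-- The endomorphisms of `𝓜_l` of degree `d`. -/
def endDegree (n l d : ℕ) : Submodule ℂ (Module.End ℂ (M n l)) where
  carrier := {φ | EndHasDegree n l d φ}
  add_mem' hφ hψ m v hv := add_mem (hφ m v hv) (hψ m v hv)
  zero_mem' m _ _ := zero_mem (VHom n (m + d))
  smul_mem' c _ hφ m v hv := (VHom n (m + d)).smul_mem c (hφ m v hv)

instance : SetLike.GradedMonoid (endDegree n l) where
  one_mem _ _ hv := hv
  mul_mem d e φ ψ hφ hψ m v hv := by
    rw [add_comm d e, ← add_assoc]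
    exact hφ _ _ (hψ m v hv)

namespace BetheRoots

variable {K : Type*} [Field K] [Algebra ℂ K] (D : BetheRoots n l K) (hl : l < n) {F : O n l}

theorem endHasDegree_eta (hF : MvPolynomial.IsWeightedHomogeneous (OWeight n l) F d) :
    EndHasDegree n l d (D.eta hl F : Module.End ℂ (M n l)) := by
  have := gradedMonoid_comap ((betheM n l).val.comp (D.eta hl).toAlgHom) (endDegree n l)
  refine mem_of_generators (fun d => (endDegree n l d).comap
    ((betheM n l).val.comp (D.eta hl).toAlgHom).toLinearMap) hl ?_ ?_ hF
  · intro i _ hin m v hv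
    exact D.eta_GO hl hin v ▸ betheOp_mem_VHom i hv
  · intro j hj hjn m v hv
    exact D.eta_SigmaO hl hj hjn v ▸ smul_mem_VHom (isHomogeneous_esymm n j) hv

theorem rho_mem_VHom_of_endHasDegree
    (h : EndHasDegree n l d (D.eta hl F : Module.End ℂ (M n l))) :
    (D.rho hl F : VPoly n) ∈ VHom n (d + l * (l + 1) / 2) := by
  rw [add_comm]
  exact h _ _ (uvec_mem_VHom n l)

theorem isWeightedHomogeneous_iff_rho_mem_VHom :
    MvPolynomial.IsWeightedHomogeneous (OWeight n l) F d ↔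
      (D.rho hl F : VPoly n) ∈ VHom n (d + l * (l + 1) / 2) :=
  isWeightedHomogeneous_iff_of_injective ((M n l).subtype ∘ₗ (D.rho hl).toLinearMap)
    (Subtype.val_injective.comp (D.rho hl).injective) fun _ _ hF =>
      D.rho_mem_VHom_of_endHasDegree hl (D.endHasDegree_eta hl hF)

theorem isWeightedHomogeneous_iff_endHasDegree_eta :
    MvPolynomial.IsWeightedHomogeneous (OWeight n l) F d ↔
      EndHasDegree n l d (D.eta hl F : Module.End ℂ (M n l)) :=
  ⟨D.endHasDegree_eta hl, fun h =>
    (D.isWeightedHomogeneous_iff_rho_mem_VHom hl).2 (D.rho_mem_VHom_of_endHasDegree hl h)⟩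

end BetheRoots

end Grading

end Gaudin

end

theorem theorem4p5 (n l : ℕ) (hl : l < n) :
    (∀ b ∈ Gaudin.bethe, ∀ v ∈ Gaudin.M n l, Gaudin.act n b v ∈ Gaudin.M n l) ∧
    (∃ C : ℕ → Gaudin.CurrentU, Gaudin.IsCentralLift n C) ∧
    ∀ C : ℕ → Gaudin.CurrentU, Gaudin.IsCentralLift n C →
      ∃ η : Gaudin.O n l ≃ₐ[ℂ] Gaudin.betheM n l,
        Gaudin.SendsGenerators n l C η.toAlgHom ∧
        (∀ η' : Gaudin.O n l →ₐ[ℂ] Gaudin.betheM n l,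
          Gaudin.SendsGenerators n l C η' → η' = η.toAlgHom) ∧
        (∀ (d : ℕ) (F : Gaudin.O n l),
          MvPolynomial.IsWeightedHomogeneous (Gaudin.OWeight n l) F d ↔
            Gaudin.EndHasDegree n l d (η F : Module.End ℂ (Gaudin.M n l))) ∧
        (∀ (p : MvPolynomial.symmetricSubalgebra (Fin n) ℂ) (F : Gaudin.O n l)
            (v : Gaudin.M n l),
          (((η (Gaudin.symToO n l p * F) : Module.End ℂ (Gaudin.M n l)) v : Gaudin.M n l) :
              Gaudin.VPoly n) =
            (p : MvPolynomial (Fin n) ℂ) •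
              (((η F : Module.End ℂ (Gaudin.M n l)) v : Gaudin.M n l) : Gaudin.VPoly n)) ∧
        ∃ (hu : Gaudin.uvec n l ∈ Gaudin.M n l) (ρ : Gaudin.O n l ≃ₗ[ℂ] Gaudin.M n l),
          (∀ F : Gaudin.O n l,
            ρ F = (η F : Module.End ℂ (Gaudin.M n l)) ⟨Gaudin.uvec n l, hu⟩) ∧
          (∀ F H : Gaudin.O n l, ρ (F * H) = (η F : Module.End ℂ (Gaudin.M n l)) (ρ H)) ∧
          (∀ (d : ℕ) (F : Gaudin.O n l),
            MvPolynomial.IsWeightedHomogeneous (Gaudin.OWeight n l) F d ↔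
              (ρ F : Gaudin.VPoly n) ∈ Gaudin.VHom n (d + l * (l + 1) / 2)) := by
  obtain ⟨K, _, _, ⟨D⟩⟩ := Gaudin.exists_betheRoots n l
  obtain ⟨C₀, hC₀, -⟩ := Gaudin.exists_isCentralLift n
  refine ⟨fun b hb v => Gaudin.act_mem_M hb, ⟨C₀, hC₀⟩, fun C hC => ?_⟩
  have hη := D.sendsGenerators_eta hl hC
  exact ⟨D.eta hl, hη, fun η' hη' => Gaudin.eq_of_sendsGenerators hl hη' hη,
    fun _ _ => D.isWeightedHomogeneous_iff_endHasDegree_eta hl, D.eta_symToO_mul hl,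
    Gaudin.uvec_mem_M n l, D.rho hl, D.rho_apply hl, D.rho_mul hl,
    fun _ _ => D.isWeightedHomogeneous_iff_rho_mem_VHom hl⟩
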